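/- **Setting.** Let $D\subset\mathbb R^2$ be open and let a $3$-web on $D$ be given by smooth $1$-forms $\omega_1,\omega_2,\omega_3$, any two of which are linearly independent at each point, normalized by $\omega_1+\omega_2+\omega_3=0$. Let $\partial_1,\partial_2$ be the frame dual to $\omega_1,\omega_2$, let $\gamma=g_1\omega_1+g_2\omega_2$ be the $1$-form with $d\omega_i=\omega_i\wedge\gamma$ $(i=1,2)$, and let $K$ (the web curvature) be defined by $d\gamma=K\,\omega_1\wedge\omega_2$. For a function $h$ of weight $w$ put $\delta_i h=\partial_i h-w\,g_i h$, a function of weight $w+1$; $\delta_{i_1\dots i_l}h$ is the average of $\delta_{i_{\sigma(1)}}\cdots\delta_{i_{\sigma(l)}}h$ over all orders of the indices. $K$ has weight $2$; the functions $\mu,\lambda_1,\lambda_2$ have weight $1$; $K_{i_1\dots i_l}=\delta_{i_1\dots i_l}K$. Jets of a function $u$ of weight $1$ have coordinates $u$, $p_{i_1\dots i_l}=\delta_{i_1\dots i_l}u$. "Smooth" means $C^\infty$. A smooth function satisfies an equation $F=0$ (where $F$ is a function of some weight on a jet space) *to order $k$ at $x$* if, along the jets of the function, all symmetrized covariant derivatives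 of $F$ of order $\le k$ vanish at $x$. The Akivis–Goldberg equations for $\lambda_1,\lambda_2$, with given smooth $\mu$, are $$\begin{aligned} 2\partial_2\lambda_1-\partial_1\lambda_2+\partial_2\mu&=K+\lambda_1\lambda_2+g_2(2\lambda_1+\mu)-g_1\lambda_2,\\ \partial_2\lambda_2&=\lambda_2(g_2+\lambda_2-\mu),\\ \partial_1\lambda_1&=\lambda_1(g_1+\lambda_1+\mu),\\ \partial_2\lambda_1-2\partial_1\lambda_2+\partial_1\mu&=K-\lambda_1\lambda_2+\lambda_1g_2-g_1(2\lambda_2-\mu). \end{aligned}$$ Put $$I_1=p_{11}-2p_{12}-up_1+2up_2+K_1,\qquad I_2=p_{22}-2p_{12}-2up_1+up_2+K_2,$$ both of weight $3$, and let $I_i(\mu)$ be $I_i$ evaluated on the $2$-jets of $\mu$. For functions $F,G$ on the space of $2$-jets, the Mayer bracket is $[F,G]=\sum_{\sigma}\frac{\partial F}{\partial p_\sigma}\hat\delta_\sigma(G)-\sum_\sigma\frac{\partial G}{\partial p_\sigma}\hat\delta_\sigma(F)$, $\sigma\in\{11,12,22\}$, where $\hat\delta_\sigma$ is the symmetrized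 total covariant derivative. Put $$\begin{aligned}I_{12}={}&24Kp_{12}+6(2K_1-K_2)p_1+6(2K_2-K_1)p_2+24Ku(p_1-p_2)+3u(K_{11}-K_{12}+K_{22})\\&-8K(K_1+K_2)+3(K_{112}-K_{122})-3Ku^3.\end{aligned}$$ **Theorem.** 1. Let $\mu$ be smooth on $D$. Every point of $D$ has a neighbourhood on which the Akivis–Goldberg equations have a smooth solution $(\lambda_1,\lambda_2)$ if and only if $I_1(\mu)=I_2(\mu)=0$ on $D$. If $I_1(\mu)=I_2(\mu)=0$ on $D$, then for every $x_0\in D$ and all prescribed values $\lambda_1(x_0),\lambda_2(x_0)$ there is a smooth solution near $x_0$ with these values. Two solutions on a connected open set $U\subset D$ that agree at one point agree on $U$. 2. $I_{12}=0$ is the compatibility condition of the system $I_1=I_2=0$ for the unknown function $\mu=u$. That is: if a smooth $\mu$ satisfies $I_1=I_2=0$ to order $1$ at $x\in D$, then $[I_1,I_2]$ on the jet of $\mu$ at $x$ equals $I_{12}$ on the $2$-jet of $\mu$ at $x$. A $2$-jet at $x\in D$ is the $2$-jet of a smooth function on $D$ satisfying $I_1=I_2=0$ to order $1$ at $x$ if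 and only if $I_1=I_2=0$ on this $2$-jet; it is the $2$-jet of a smooth function on $D$ satisfying $I_1=I_2=0$ to order $2$ at $x$ if and only if $I_1=I_2=I_{12}=0$ on this $2$-jet. In particular, $[I_1,I_2]=0$ and $I_{12}=0$ on the jets of every smooth solution $\mu$ of $I_1=I_2=0$ on $D$. At a point where $K\ne0$, a $2$-jet satisfies $I_1=I_2=I_{12}=0$ if and only if it satisfies $$p_{11}=P_{11},\qquad p_{12}=P_{12},\qquad p_{22}=P_{22},\tag{P}$$ where, with $B=3Ku^3+6(K_2-2K_1)p_1+6(K_1-2K_2)p_2-3u(K_{11}-K_{12}+K_{22})+3(K_{122}-K_{112})$, $$\begin{aligned}12K P_{11}&=B-12Kup_1+4K(2K_2-K_1),\\ 12KP_{22}&=B+12Kup_2+4K(2K_1-K_2),\\ 24KP_{12}&=B+24Ku(p_2-p_1)+8K(K_1+K_2).\end{aligned}$$ If $K\neq0$ everywhere on $D$, then a smooth $\mu$ on $D$ satisfies $I_1(\mu)=I_2(\mu)=0$ on $D$ if and only if it satisfies (P) on $D$. 3. The compatibility conditions of (P) are $G_1=G_2=0$, where $$G_1=p_1^2-2p_1p_2+A_{11}p_1+A_{12}p_2+A_{10},\qquad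 G_2=p_2^2-2p_1p_2+A_{21}p_1+A_{22}p_2+A_{20},$$ $$\begin{aligned} A_{11}={}&\tfrac{5u^2}{8}+\tfrac{3u(K_1-K_2)}{4K}-\tfrac{13K}{4}-\tfrac{7(K_1-2K_2)(2K_1-K_2)}{16K^2}+\tfrac{5K_{11}+5K_{22}-11K_{12}}{8K},\\ A_{12}={}&-\tfrac{5u^2}{4}-\tfrac{3uK_1}{4K}+\tfrac{7(K_1-2K_2)^2}{16K^2}+\tfrac{5K_{12}-2K_{11}-5K_{22}}{4K},\\ A_{10}={}&\tfrac{9u^3(K_1-2K_2)}{96K}+u\Big(-\tfrac{5K_1}{2}+\tfrac{21(2K_2-K_1)(K_{11}-K_{12}+K_{22})}{96K^2}\Big)+\tfrac{u(K_{111}-2K_{222}-3K_{112}+3K_{122})}{8K}\\ &+\tfrac{9(2K_{22}-2K_{12}-K_{11})}{16}-\tfrac{21(2K_2-K_1)(K_{122}-K_{112})}{96K^2}+\tfrac{17(2K_2^2-2K_1K_2-K_1^2)}{48K}+\tfrac{2K_{1222}-3K_{1122}+K_{1112}}{8K}, \end{aligned}$$ and $A_{21}=-\tau(A_{12})$, $A_{22}=-\tau(A_{11})$,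 $A_{20}=\tau(A_{10})$, where $\tau$ replaces $u$ by $-u$, $K$ by $-K$, and each $K_{i_1\dots i_l}$ by $-K_{j_1\dots j_l}$ with the indices $1$ and $2$ exchanged. That is: if $x\in D$, $K(x)\neq0$ and the $2$-jet at $x$ of a smooth $\mu$ satisfies (P), then at $x$, on the jets of $\mu$, $$\begin{aligned}\hat\delta_2(P_{11})-\hat\delta_1(P_{12})-\tfrac52Kp_1-\tfrac12K_1u&=G_1(u,p_1,p_2),\\ \hat\delta_2(P_{12})-\hat\delta_1(P_{22})-\tfrac52Kp_2-\tfrac12K_2u&=G_2(u,p_1,p_2).\end{aligned}$$ If $K(x)\ne0$, then a $1$-jet $(u,p_1,p_2)$ at $x$ is the $1$-jet of a smooth function on $D$ satisfying (P) to order $1$ at $x$ if and only if $G_1=G_2=0$ at $(u,p_1,p_2)$. In particular, if $K\ne0$ everywhere on $D$, every smooth solution $\mu$ of (P) on $D$ satisfies $G_1=G_2=0$ on $D$. -/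

import Mathlib

open scoped ContDiff

noncomputable section

/-! ### Exterior calculus of one-forms on the plane -/

/-- A differential one-form on the plane. -/
abbrev PlaneForm : Type := ℝ × ℝ → (ℝ × ℝ →L[ℝ] ℝ)

/-- The exterior derivative of a one-form, `dθ(v, w) = D_v θ (w) - D_w θ (v)`. -/
def formD (θ : PlaneForm) (x v w : ℝ × ℝ) : ℝ :=
  fderiv ℝ θ x v w - fderiv ℝ θ x w v

/-- `formD` is Mathlib's exterior derivative of the one-form. -/
theorem formD_eq_extDeriv (θ : PlaneForm) (x v w : ℝ × ℝ) (h : DifferentiableAt ℝ θ x) :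
    extDeriv (fun y => ContinuousAlternatingMap.ofSubsingletonLIE (0 : Fin 1) (θ y)) x
      ![v, w] = formD θ x v w := by
  have h' : DifferentiableAt ℝ
      (fun y => (ContinuousAlternatingMap.ofSubsingletonLIE (0 : Fin 1) (θ y) :
        (ℝ × ℝ) [⋀^Fin 1]→L[ℝ] ℝ)) x := by
    exact (ContinuousAlternatingMap.ofSubsingletonLIE (𝕜 := ℝ) (E := ℝ × ℝ) (F := ℝ)
      (0 : Fin 1)).toContinuousLinearEquiv.differentiableAt.comp x h
  rw [extDeriv_apply h']
  rw [Fin.sum_univ_two]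
  have e : ∀ z : ℝ × ℝ, fderiv ℝ (fun y => (ContinuousAlternatingMap.ofSubsingletonLIE
      (0 : Fin 1) (θ y) : (ℝ × ℝ) [⋀^Fin 1]→L[ℝ] ℝ) ![z]) x = (fderiv ℝ θ x).flip z := by
    intro z
    have : (fun y => (ContinuousAlternatingMap.ofSubsingletonLIE
      (0 : Fin 1) (θ y) : (ℝ × ℝ) [⋀^Fin 1]→L[ℝ] ℝ) ![z]) = fun y => θ y z := by
      funext y; rfl
    rw [this]
    ext <;> simp [fderiv_clm_apply h (differentiableAt_const z)]
  have e0 : (Fin.removeNth (0 : Fin 2) ![v, w] : Fin 1 → ℝ × ℝ) = ![w] := by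
    funext i; fin_cases i; rfl
  have e1 : (Fin.removeNth (1 : Fin 2) ![v, w] : Fin 1 → ℝ × ℝ) = ![v] := by
    funext i; fin_cases i; rfl
  rw [e0, e1, e, e]
  simp [formD, sub_eq_add_neg]

/-- The wedge product of two covectors, `(α ∧ β)(v, w) = α(v) β(w) - α(w) β(v)`. -/
def wedge (α β : ℝ × ℝ →L[ℝ] ℝ) (v w : ℝ × ℝ) : ℝ := α v * β w - α w * β v

/-! ### Planar three-webs -/

/-- A smooth `3`-web on `D`, given by three smooth one-forms, any two of which are linearly
independent at each point, normalized by `ω₁ + ω₂ + ω₃ = 0`. -/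
structure PlanarWeb (D : Set (ℝ × ℝ)) where
  ω₁ : PlaneForm
  ω₂ : PlaneForm
  ω₃ : PlaneForm
  smooth₁ : ContDiffOn ℝ ∞ ω₁ D
  smooth₂ : ContDiffOn ℝ ∞ ω₂ D
  smooth₃ : ContDiffOn ℝ ∞ ω₃ D
  indep₁₂ : ∀ x ∈ D, LinearIndependent ℝ ![ω₁ x, ω₂ x]
  indep₁₃ : ∀ x ∈ D, LinearIndependent ℝ ![ω₁ x, ω₃ x]
  indep₂₃ : ∀ x ∈ D, LinearIndependent ℝ ![ω₂ x, ω₃ x]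
  normalized : ∀ x ∈ D, ω₁ x + ω₂ x + ω₃ x = 0

namespace PlanarWeb

/-- The value of `ω₁ ∧ ω₂` on the coordinate frame. -/
def area {D : Set (ℝ × ℝ)} (W : PlanarWeb D) (x : ℝ × ℝ) : ℝ :=
  wedge (W.ω₁ x) (W.ω₂ x) (1, 0) (0, 1)

/-- The vector field `∂₁` of the frame dual to `(ω₁, ω₂)`. -/
def frame₁ {D : Set (ℝ × ℝ)} (W : PlanarWeb D) (x : ℝ × ℝ) : ℝ × ℝ :=
  (W.ω₂ x (0, 1) / W.area x, -(W.ω₂ x (1, 0)) / W.area x)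

/-- The vector field `∂₂` of the frame dual to `(ω₁, ω₂)`. -/
def frame₂ {D : Set (ℝ × ℝ)} (W : PlanarWeb D) (x : ℝ × ℝ) : ℝ × ℝ :=
  (-(W.ω₁ x (0, 1)) / W.area x, W.ω₁ x (1, 0) / W.area x)

/-- The derivative `∂₁(h)` of a function. -/
def pd₁ {D : Set (ℝ × ℝ)} (W : PlanarWeb D) (h : ℝ × ℝ → ℝ) (x : ℝ × ℝ) : ℝ :=
  fderiv ℝ h x (W.frame₁ x)

/-- The derivative `∂₂(h)` of a function. -/
def pd₂ {D : Set (ℝ × ℝ)} (W : PlanarWeb D) (h : ℝ × ℝ → ℝ) (x : ℝ × ℝ) : ℝ :=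
  fderiv ℝ h x (W.frame₂ x)

/-- The component `g₁` of the connection form `γ = g₁ ω₁ + g₂ ω₂`. -/
def g₁ {D : Set (ℝ × ℝ)} (W : PlanarWeb D) (x : ℝ × ℝ) : ℝ :=
  -(formD W.ω₂ x (W.frame₁ x) (W.frame₂ x))

/-- The component `g₂` of the connection form `γ = g₁ ω₁ + g₂ ω₂`. -/
def g₂ {D : Set (ℝ × ℝ)} (W : PlanarWeb D) (x : ℝ × ℝ) : ℝ :=
  formD W.ω₁ x (W.frame₁ x) (W.frame₂ x)

/-- The connection form `γ`, determined by `dω₁ = ω₁ ∧ γ` and `dω₂ = ω₂ ∧ γ`. -/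
def γ {D : Set (ℝ × ℝ)} (W : PlanarWeb D) : PlaneForm :=
  fun x => W.g₁ x • W.ω₁ x + W.g₂ x • W.ω₂ x

/-- The web curvature `K`, determined by `dγ = K ω₁ ∧ ω₂`. -/
def K {D : Set (ℝ × ℝ)} (W : PlanarWeb D) (x : ℝ × ℝ) : ℝ :=
  formD W.γ x (W.frame₁ x) (W.frame₂ x)

theorem area_ne_zero {D : Set (ℝ × ℝ)} (W : PlanarWeb D) {x : ℝ × ℝ} (hx : x ∈ D) :
    W.area x ≠ 0 := by
  intro h
  have hl := W.indep₁₂ x hx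
  rw [LinearIndependent.pair_iff] at hl
  have hv : ∀ (θ : ℝ × ℝ →L[ℝ] ℝ) (v : ℝ × ℝ), θ v = v.1 * θ (1, 0) + v.2 * θ (0, 1) := by
    intro θ v
    have : v = v.1 • ((1, 0) : ℝ × ℝ) + v.2 • ((0, 1) : ℝ × ℝ) := by ext <;> simp
    conv_lhs => rw [this]
    rw [map_add, map_smul, map_smul, smul_eq_mul, smul_eq_mul]
  simp only [area, wedge] at h
  have key : ∀ s t : ℝ, s * W.ω₁ x (1, 0) + t * W.ω₂ x (1, 0) = 0 →
      s * W.ω₁ x (0, 1) + t * W.ω₂ x (0, 1) = 0 → s = 0 ∧ t = 0 := by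
    intro s t h1 h2
    apply hl
    apply ContinuousLinearMap.ext
    intro v
    simp only [add_apply, smul_apply, smul_eq_mul,
      zero_apply]
    rw [hv (W.ω₁ x) v, hv (W.ω₂ x) v]
    linear_combination v.1 * h1 + v.2 * h2
  have k1 := key (W.ω₂ x (0, 1)) (-(W.ω₁ x (0, 1))) (by linear_combination h) (by ring)
  have k2 := key (W.ω₂ x (1, 0)) (-(W.ω₁ x (1, 0))) (by ring) (by linear_combination -h)
  have k3 := key 0 1 (by rw [k2.1]; ring) (by rw [k1.1]; ring)
  exact one_ne_zero k3.2

theorem apply_eq (θ : ℝ × ℝ →L[ℝ] ℝ) (a b : ℝ) : θ (a, b) = a * θ (1, 0) + b * θ (0, 1) := by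
  have : ((a, b) : ℝ × ℝ) = a • ((1, 0) : ℝ × ℝ) + b • ((0, 1) : ℝ × ℝ) := by ext <;> simp
  rw [this, map_add, map_smul, map_smul, smul_eq_mul, smul_eq_mul]

/-- The frame is dual to the coframe. -/
theorem frame_dual {D : Set (ℝ × ℝ)} (W : PlanarWeb D) {x : ℝ × ℝ} (hx : x ∈ D) :
    W.ω₁ x (W.frame₁ x) = 1 ∧ W.ω₁ x (W.frame₂ x) = 0 ∧
      W.ω₂ x (W.frame₁ x) = 0 ∧ W.ω₂ x (W.frame₂ x) = 1 := by
  have h := W.area_ne_zero hx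
  simp only [frame₁, frame₂]
  rw [apply_eq (W.ω₁ x) (W.ω₂ x (0, 1) / _), apply_eq (W.ω₁ x) (-(W.ω₁ x (0, 1)) / _),
    apply_eq (W.ω₂ x) (W.ω₂ x (0, 1) / _), apply_eq (W.ω₂ x) (-(W.ω₁ x (0, 1)) / _)]
  refine ⟨?_, ?_, ?_, ?_⟩ <;> field_simp <;> simp only [area, wedge] <;> ring

/-- Every vector is decomposed in the frame by the coframe. -/
theorem decompose {D : Set (ℝ × ℝ)} (W : PlanarWeb D) {x : ℝ × ℝ} (hx : x ∈ D) (v : ℝ × ℝ) :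
    v = W.ω₁ x v • W.frame₁ x + W.ω₂ x v • W.frame₂ x := by
  have h := W.area_ne_zero hx
  obtain ⟨a, b⟩ := v
  rw [apply_eq (W.ω₁ x) a b, apply_eq (W.ω₂ x) a b]
  ext <;> simp only [frame₁, frame₂, Prod.fst_add, Prod.snd_add, Prod.smul_fst, Prod.smul_snd,
    smul_eq_mul] <;> field_simp <;> simp only [area, wedge] <;> ring

/-- An alternating bilinear form is a multiple of `ω₁ ∧ ω₂`. -/
theorem formD_eq {D : Set (ℝ × ℝ)} (W : PlanarWeb D) {x : ℝ × ℝ} (hx : x ∈ D) (θ : PlaneForm)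
    (v w : ℝ × ℝ) :
    formD θ x v w =
      formD θ x (W.frame₁ x) (W.frame₂ x) * wedge (W.ω₁ x) (W.ω₂ x) v w := by
  have hv := W.decompose hx v
  have hw := W.decompose hx w
  simp only [wedge]
  generalize W.ω₁ x v = a at *
  generalize W.ω₂ x v = b at *
  generalize W.ω₁ x w = c at *
  generalize W.ω₂ x w = d at *
  subst hv hw
  simp only [formD, map_add, map_smul, add_apply,
    smul_apply, smul_eq_mul]
  ring

/-- The web structure equations, and the defining equation of the curvature. -/
theorem structure_equations {D : Set (ℝ × ℝ)} (W : PlanarWeb D) {x : ℝ × ℝ} (hx : x ∈ D)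
    (v w : ℝ × ℝ) :
    formD W.ω₁ x v w = wedge (W.ω₁ x) (W.γ x) v w ∧
      formD W.ω₂ x v w = wedge (W.ω₂ x) (W.γ x) v w ∧
      formD W.γ x v w = W.K x * wedge (W.ω₁ x) (W.ω₂ x) v w := by
  refine ⟨?_, ?_, W.formD_eq hx _ v w⟩
  · rw [W.formD_eq hx W.ω₁ v w]
    simp only [wedge, γ, g₂, add_apply, smul_apply,
      smul_eq_mul]
    ring
  · rw [W.formD_eq hx W.ω₂ v w]
    simp only [wedge, γ, g₁, add_apply, smul_apply,
      smul_eq_mul]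
    ring

/-- The covariant derivative `δ₁` of a function of weight `w`. -/
def δ₁ {D : Set (ℝ × ℝ)} (W : PlanarWeb D) (w : ℕ) (h : ℝ × ℝ → ℝ) (x : ℝ × ℝ) : ℝ :=
  W.pd₁ h x - w * W.g₁ x * h x

/-- The covariant derivative `δ₂` of a function of weight `w`. -/
def δ₂ {D : Set (ℝ × ℝ)} (W : PlanarWeb D) (w : ℕ) (h : ℝ × ℝ → ℝ) (x : ℝ × ℝ) : ℝ :=
  W.pd₂ h x - w * W.g₂ x * h x

/-- The sum of all compositions, in all distinct orders, of `a` covariant derivatives `δ₁` and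
`b` covariant derivatives `δ₂` of a function of weight `w`; each derivative raises the weight
by one. -/
def orderedSum {D : Set (ℝ × ℝ)} (W : PlanarWeb D) (w : ℕ) (h : ℝ × ℝ → ℝ) :
    ℕ → ℕ → ℝ × ℝ → ℝ
  | 0, 0 => h
  | a + 1, 0 => W.δ₁ (w + a) (W.orderedSum w h a 0)
  | 0, b + 1 => W.δ₂ (w + b) (W.orderedSum w h 0 b)
  | a + 1, b + 1 => fun x =>
      W.δ₁ (w + a + (b + 1)) (W.orderedSum w h a (b + 1)) x +
        W.δ₂ (w + (a + 1) + b) (W.orderedSum w h (a + 1) b) x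
  termination_by a b => a + b

/-- The symmetrized covariant derivative `δ_{1…12…2}` with `a` indices `1` and `b` indices `2`
of a function of weight `w`: the average over all orders of the derivatives. -/
def sym {D : Set (ℝ × ℝ)} (W : PlanarWeb D) (w : ℕ) (h : ℝ × ℝ → ℝ) (a b : ℕ) (x : ℝ × ℝ) : ℝ :=
  W.orderedSum w h a b x / ((a + b).choose a : ℝ)

/-- All covariant derivatives up to order `k` of the function `h` of weight `w` vanish at `x`. -/
def VanishesToOrder {D : Set (ℝ × ℝ)} (W : PlanarWeb D) (w : ℕ) (h : ℝ × ℝ → ℝ) (k : ℕ)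
    (x : ℝ × ℝ) : Prop :=
  ∀ a b : ℕ, a + b ≤ k → W.sym w h a b x = 0

end PlanarWeb

/-! ### Jets -/

/-- The fibre coordinates of a two-jet of a function `u` of weight one: `u` and its symmetrized
covariant derivatives. -/
@[ext]
structure Jet2 where
  u : ℝ
  p₁ : ℝ
  p₂ : ℝ
  p₁₁ : ℝ
  p₁₂ : ℝ
  p₂₂ : ℝ

/-- The curvature and the symmetrized covariant derivatives of it that occur below. -/
structure CurvJet where
  k : ℝ
  k₁ : ℝ
  k₂ : ℝ
  k₁₁ : ℝ
  k₁₂ : ℝ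
  k₂₂ : ℝ
  k₁₁₁ : ℝ
  k₁₁₂ : ℝ
  k₁₂₂ : ℝ
  k₂₂₂ : ℝ
  k₁₁₁₂ : ℝ
  k₁₁₂₂ : ℝ
  k₁₂₂₂ : ℝ

namespace PlanarWeb

/-- The two-jet at `x` of a function of weight one. -/
def jet {D : Set (ℝ × ℝ)} (W : PlanarWeb D) (μ : ℝ × ℝ → ℝ) (x : ℝ × ℝ) : Jet2 where
  u := μ x
  p₁ := W.sym 1 μ 1 0 x
  p₂ := W.sym 1 μ 0 1 x
  p₁₁ := W.sym 1 μ 2 0 x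
  p₁₂ := W.sym 1 μ 1 1 x
  p₂₂ := W.sym 1 μ 0 2 x

/-- The jet at `x` of the curvature, a function of weight two. -/
def curvJet {D : Set (ℝ × ℝ)} (W : PlanarWeb D) (x : ℝ × ℝ) : CurvJet where
  k := W.K x
  k₁ := W.sym 2 W.K 1 0 x
  k₂ := W.sym 2 W.K 0 1 x
  k₁₁ := W.sym 2 W.K 2 0 x
  k₁₂ := W.sym 2 W.K 1 1 x
  k₂₂ := W.sym 2 W.K 0 2 x
  k₁₁₁ := W.sym 2 W.K 3 0 x
  k₁₁₂ := W.sym 2 W.K 2 1 x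
  k₁₂₂ := W.sym 2 W.K 1 2 x
  k₂₂₂ := W.sym 2 W.K 0 3 x
  k₁₁₁₂ := W.sym 2 W.K 3 1 x
  k₁₁₂₂ := W.sym 2 W.K 2 2 x
  k₁₂₂₂ := W.sym 2 W.K 1 3 x

/-- The Mayer bracket `[F, G]`, evaluated along the jets of `μ`, of two functions `F`, `G` of
weights `w₁`, `w₂` on the space of two-jets of functions of weight one:
`[F, G] = ∑ ∂F/∂p_σ δ_σ(G) - ∑ ∂G/∂p_σ δ_σ(F)` over `σ = 11, 12, 22`. Along the jets of `μ` the
total covariant derivative of `G` is the covariant derivative of the function `y ↦ G(j_y μ)`. -/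
def mayerBracket {D : Set (ℝ × ℝ)} (W : PlanarWeb D) (w₁ w₂ : ℕ) (F G : ℝ × ℝ → Jet2 → ℝ)
    (μ : ℝ × ℝ → ℝ) (x : ℝ × ℝ) : ℝ :=
  (deriv (fun t => F x { W.jet μ x with p₁₁ := t }) (W.jet μ x).p₁₁ *
        W.sym w₂ (fun y => G y (W.jet μ y)) 2 0 x +
      deriv (fun t => F x { W.jet μ x with p₁₂ := t }) (W.jet μ x).p₁₂ *
        W.sym w₂ (fun y => G y (W.jet μ y)) 1 1 x +
      deriv (fun t => F x { W.jet μ x with p₂₂ := t }) (W.jet μ x).p₂₂ *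
        W.sym w₂ (fun y => G y (W.jet μ y)) 0 2 x) -
    (deriv (fun t => G x { W.jet μ x with p₁₁ := t }) (W.jet μ x).p₁₁ *
        W.sym w₁ (fun y => F y (W.jet μ y)) 2 0 x +
      deriv (fun t => G x { W.jet μ x with p₁₂ := t }) (W.jet μ x).p₁₂ *
        W.sym w₁ (fun y => F y (W.jet μ y)) 1 1 x +
      deriv (fun t => G x { W.jet μ x with p₂₂ := t }) (W.jet μ x).p₂₂ *
        W.sym w₁ (fun y => F y (W.jet μ y)) 0 2 x)

/-! ### The Akivis–Goldberg equations -/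

/-- `l₁`, `l₂` are smooth on `U` and solve there the Akivis–Goldberg equations with the given
function `μ`. -/
def IsAGSolutionOn {D : Set (ℝ × ℝ)} (W : PlanarWeb D) (μ l₁ l₂ : ℝ × ℝ → ℝ)
    (U : Set (ℝ × ℝ)) : Prop :=
  ContDiffOn ℝ ∞ l₁ U ∧ ContDiffOn ℝ ∞ l₂ U ∧ ∀ x ∈ U,
    2 * W.pd₂ l₁ x - W.pd₁ l₂ x + W.pd₂ μ x =
        W.K x + l₁ x * l₂ x + W.g₂ x * (2 * l₁ x + μ x) - W.g₁ x * l₂ x ∧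
      W.pd₂ l₂ x = l₂ x * (W.g₂ x + l₂ x - μ x) ∧
      W.pd₁ l₁ x = l₁ x * (W.g₁ x + l₁ x + μ x) ∧
      W.pd₂ l₁ x - 2 * W.pd₁ l₂ x + W.pd₁ μ x =
        W.K x - l₁ x * l₂ x + l₁ x * W.g₂ x - W.g₁ x * (2 * l₂ x - μ x)

end PlanarWeb

namespace CurvJet

/-- The function `I₁` of weight three on two-jets. -/
def I₁ (c : CurvJet) (j : Jet2) : ℝ :=
  j.p₁₁ - 2 * j.p₁₂ - j.u * j.p₁ + 2 * j.u * j.p₂ + c.k₁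

/-- The function `I₂` of weight three on two-jets. -/
def I₂ (c : CurvJet) (j : Jet2) : ℝ :=
  j.p₂₂ - 2 * j.p₁₂ - 2 * j.u * j.p₁ + j.u * j.p₂ + c.k₂

/-- The function `I₁₂` on two-jets: the reduced form of the Mayer bracket of `I₁` and `I₂`. -/
def I₁₂ (c : CurvJet) (j : Jet2) : ℝ :=
  24 * c.k * j.p₁₂ + 6 * (2 * c.k₁ - c.k₂) * j.p₁ + 6 * (2 * c.k₂ - c.k₁) * j.p₂ +
    24 * c.k * j.u * (j.p₁ - j.p₂) + 3 * j.u * (c.k₁₁ - c.k₁₂ + c.k₂₂) -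
    8 * c.k * (c.k₁ + c.k₂) + 3 * (c.k₁₁₂ - c.k₁₂₂) - 3 * c.k * j.u ^ 3

/-- The right-hand side of the equation `p₁₁ = P₁₁(u, p₁, p₂)`. -/
def P₁₁ (c : CurvJet) (u p₁ p₂ : ℝ) : ℝ :=
  (3 * c.k * u ^ 3 - 12 * c.k * u * p₁ + 6 * (c.k₂ - 2 * c.k₁) * p₁ + 6 * (c.k₁ - 2 * c.k₂) * p₂ -
    3 * u * (c.k₁₁ - c.k₁₂ + c.k₂₂) + 3 * (c.k₁₂₂ - c.k₁₁₂) +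
    4 * c.k * (2 * c.k₂ - c.k₁)) / (12 * c.k)

/-- The right-hand side of the equation `p₂₂ = P₂₂(u, p₁, p₂)`. -/
def P₂₂ (c : CurvJet) (u p₁ p₂ : ℝ) : ℝ :=
  (3 * c.k * u ^ 3 + 12 * c.k * u * p₂ + 6 * (c.k₂ - 2 * c.k₁) * p₁ + 6 * (c.k₁ - 2 * c.k₂) * p₂ -
    3 * u * (c.k₁₁ - c.k₁₂ + c.k₂₂) + 3 * (c.k₁₂₂ - c.k₁₁₂) +
    4 * c.k * (2 * c.k₁ - c.k₂)) / (12 * c.k)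

/-- The right-hand side of the equation `p₁₂ = P₁₂(u, p₁, p₂)`. -/
def P₁₂ (c : CurvJet) (u p₁ p₂ : ℝ) : ℝ :=
  (3 * c.k * u ^ 3 + 24 * c.k * u * (p₂ - p₁) + 6 * (c.k₂ - 2 * c.k₁) * p₁ +
    6 * (c.k₁ - 2 * c.k₂) * p₂ - 3 * u * (c.k₁₁ - c.k₁₂ + c.k₂₂) + 3 * (c.k₁₂₂ - c.k₁₁₂) +
    8 * c.k * (c.k₁ + c.k₂)) / (24 * c.k)

/-- A two-jet satisfies the second-order system `p_{ij} = P_{ij}(u, p₁, p₂)`. -/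
def PSystem (c : CurvJet) (j : Jet2) : Prop :=
  j.p₁₁ = c.P₁₁ j.u j.p₁ j.p₂ ∧ j.p₁₂ = c.P₁₂ j.u j.p₁ j.p₂ ∧ j.p₂₂ = c.P₂₂ j.u j.p₁ j.p₂

/-- The action of the involution `τ` on the curvature jet: the indices `1`, `2` are exchanged and
`K` changes sign. On functions, `τ` also sends `u` to `-u`. -/
def tau (c : CurvJet) : CurvJet where
  k := -c.k
  k₁ := -c.k₂
  k₂ := -c.k₁
  k₁₁ := -c.k₂₂
  k₁₂ := -c.k₁₂
  k₂₂ := -c.k₁₁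
  k₁₁₁ := -c.k₂₂₂
  k₁₁₂ := -c.k₁₂₂
  k₁₂₂ := -c.k₁₁₂
  k₂₂₂ := -c.k₁₁₁
  k₁₁₁₂ := -c.k₁₂₂₂
  k₁₁₂₂ := -c.k₁₁₂₂
  k₁₂₂₂ := -c.k₁₁₁₂

/-- The coefficient of `p₁` in `G₁`. -/
def A₁₁ (c : CurvJet) (u : ℝ) : ℝ :=
  5 * u ^ 2 / 8 + 3 * u * (c.k₁ - c.k₂) / (4 * c.k) - 13 * c.k / 4 -
    7 * (c.k₁ - 2 * c.k₂) * (2 * c.k₁ - c.k₂) / (16 * c.k ^ 2) +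
    (5 * c.k₁₁ + 5 * c.k₂₂ - 11 * c.k₁₂) / (8 * c.k)

/-- The coefficient of `p₂` in `G₁`. -/
def A₁₂ (c : CurvJet) (u : ℝ) : ℝ :=
  -(5 * u ^ 2 / 4) - 3 * u * c.k₁ / (4 * c.k) +
    7 * (c.k₁ - 2 * c.k₂) ^ 2 / (16 * c.k ^ 2) +
    (5 * c.k₁₂ - 2 * c.k₁₁ - 5 * c.k₂₂) / (4 * c.k)

/-- The free term of `G₁`. -/
def A₁₀ (c : CurvJet) (u : ℝ) : ℝ :=
  9 * u ^ 3 * (c.k₁ - 2 * c.k₂) / (96 * c.k) +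
    u * (-(5 * c.k₁ / 2) +
      21 * (2 * c.k₂ - c.k₁) * (c.k₁₁ - c.k₁₂ + c.k₂₂) / (96 * c.k ^ 2)) +
    u * (c.k₁₁₁ - 2 * c.k₂₂₂ - 3 * c.k₁₁₂ + 3 * c.k₁₂₂) / (8 * c.k) +
    9 * (2 * c.k₂₂ - 2 * c.k₁₂ - c.k₁₁) / 16 -
    21 * (2 * c.k₂ - c.k₁) * (c.k₁₂₂ - c.k₁₁₂) / (96 * c.k ^ 2) +
    17 * (2 * c.k₂ ^ 2 - 2 * c.k₁ * c.k₂ - c.k₁ ^ 2) / (48 * c.k) +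
    (2 * c.k₁₂₂₂ - 3 * c.k₁₁₂₂ + c.k₁₁₁₂) / (8 * c.k)

/-- The quadratic polynomial `G₁`. -/
def G₁ (c : CurvJet) (u p₁ p₂ : ℝ) : ℝ :=
  (p₁ ^ 2 - 2 * p₁ * p₂) + c.A₁₁ u * p₁ + c.A₁₂ u * p₂ + c.A₁₀ u

/-- The quadratic polynomial `G₂`, with coefficients `A₂₁ = -τ(A₁₂)`, `A₂₂ = -τ(A₁₁)`,
`A₂₀ = τ(A₁₀)`. -/
def G₂ (c : CurvJet) (u p₁ p₂ : ℝ) : ℝ :=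
  (p₂ ^ 2 - 2 * p₁ * p₂) + -(c.tau.A₁₂ (-u)) * p₁ + -(c.tau.A₁₁ (-u)) * p₂ + c.tau.A₁₀ (-u)

end CurvJet

namespace PlanarWeb

/-- The function `I₁(μ)`. -/
def opI₁ {D : Set (ℝ × ℝ)} (W : PlanarWeb D) (μ : ℝ × ℝ → ℝ) (x : ℝ × ℝ) : ℝ :=
  (W.curvJet x).I₁ (W.jet μ x)

/-- The function `I₂(μ)`. -/
def opI₂ {D : Set (ℝ × ℝ)} (W : PlanarWeb D) (μ : ℝ × ℝ → ℝ) (x : ℝ × ℝ) : ℝ :=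
  (W.curvJet x).I₂ (W.jet μ x)

/-- The Mayer bracket `[I₁, I₂]` along the jets of `μ`. -/
def opMayer {D : Set (ℝ × ℝ)} (W : PlanarWeb D) (μ : ℝ × ℝ → ℝ) (x : ℝ × ℝ) : ℝ :=
  W.mayerBracket 3 3 (fun y => (W.curvJet y).I₁) (fun y => (W.curvJet y).I₂) μ x

/-- The function `P₁₁(μ, δ₁μ, δ₂μ)`, of weight three. -/
def opP₁₁ {D : Set (ℝ × ℝ)} (W : PlanarWeb D) (μ : ℝ × ℝ → ℝ) (x : ℝ × ℝ) : ℝ :=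
  (W.curvJet x).P₁₁ (μ x) (W.δ₁ 1 μ x) (W.δ₂ 1 μ x)

/-- The function `P₁₂(μ, δ₁μ, δ₂μ)`, of weight three. -/
def opP₁₂ {D : Set (ℝ × ℝ)} (W : PlanarWeb D) (μ : ℝ × ℝ → ℝ) (x : ℝ × ℝ) : ℝ :=
  (W.curvJet x).P₁₂ (μ x) (W.δ₁ 1 μ x) (W.δ₂ 1 μ x)

/-- The function `P₂₂(μ, δ₁μ, δ₂μ)`, of weight three. -/
def opP₂₂ {D : Set (ℝ × ℝ)} (W : PlanarWeb D) (μ : ℝ × ℝ → ℝ) (x : ℝ × ℝ) : ℝ :=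
  (W.curvJet x).P₂₂ (μ x) (W.δ₁ 1 μ x) (W.δ₂ 1 μ x)

/-- At `x`, the function `ν` satisfies the equations `I₁ = I₂ = 0` and their prolongations up to
order `k`. -/
def SolvesIToOrder {D : Set (ℝ × ℝ)} (W : PlanarWeb D) (ν : ℝ × ℝ → ℝ) (k : ℕ)
    (x : ℝ × ℝ) : Prop :=
  W.VanishesToOrder 3 (W.opI₁ ν) k x ∧ W.VanishesToOrder 3 (W.opI₂ ν) k x

/-- At `x`, the function `ν` satisfies the equations `p_{ij} = P_{ij}` and their prolongations up
to order `k`. -/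
def SolvesPToOrder {D : Set (ℝ × ℝ)} (W : PlanarWeb D) (ν : ℝ × ℝ → ℝ) (k : ℕ)
    (x : ℝ × ℝ) : Prop :=
  W.VanishesToOrder 3 (fun y => W.sym 1 ν 2 0 y - W.opP₁₁ ν y) k x ∧
    W.VanishesToOrder 3 (fun y => W.sym 1 ν 1 1 y - W.opP₁₂ ν y) k x ∧
    W.VanishesToOrder 3 (fun y => W.sym 1 ν 0 2 y - W.opP₂₂ ν y) k x

end PlanarWeb

end

/-!
The whole argument takes place in the calculus of the covariant derivatives `δ₁`, `δ₂`. They obey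
the Leibniz rule, weights being additive, and the Ricci identity `δ₁ δ₂ h - δ₂ δ₁ h = -w K h` for
`h` of weight `w` (`δ_comm`), which is the dual form of the structure equations together with
`dγ = K ω₁ ∧ ω₂`. Applied repeatedly, the identity expresses `δᵢ` of a symmetrized derivative
through symmetrized derivatives of one order more and curvature terms (`hasCovAt_sym_one`,
`hasCovAt_sym_two`, `hasCovAt_sym_three`). Conversely the symmetrized derivatives at a point are
free: every finite jet is attained by a smooth function on `D` (`exists_sym_eq`), by induction on
the order, since a function vanishing to order `n - 1` has a well-defined symbol of order `n`, and
products of the functions `ωᵢ(x)(y - x)` attain all symbols.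

*The system `I₁ = I₂ = 0`.* After expansion of the total derivatives, `[I₁, I₂] - I₁₂` is a
combination of `I₁`, `I₂` and their first derivatives (`opMayer_sub`). Given a two-jet with
`I₁ = I₂ = 0`, the four equations `δᵢ Iⱼ = 0` are uniquely solvable for the four third derivatives.
The six second-order equations for the five fourth derivatives have one linear relation, which is
the Mayer bracket, so `I₁₂ = 0` is the only obstruction (`exists_solvesIToOrder_two`). Where `K ≠ 0`
the equations `I₁ = I₂ = I₁₂ = 0` are linear in the second derivatives with determinant `24 K` up
to sign, and solving them gives the system `p_{ij} = P_{ij}` (`PSystem_iff`).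

*The system `p_{ij} = P_{ij}`.* Its first prolongation prescribes all the derivatives of the three
second-order coordinates, subject to the two Ricci identities (`ricci_two`), and `G₁`, `G₂` are the
failure of the prescribed values to satisfy these (`δ_opP_sub`).

*The Akivis–Goldberg equations.* They can be solved for all first derivatives of `λ₁`, `λ₂`, and so
are a total differential equation `d(λ₁, λ₂) = Φ(x, λ₁, λ₂)` (`hasFDerivAt_agForm_iff`). The Ricci
identities for the prescribed derivatives of `λ₁`, `λ₂` fail by exactly `I₁(μ) / 3` and
`I₂(μ) / 3`, whatever `λ₁` and `λ₂` are (`ag_integrability`). Hence `I₁(μ) = I₂(μ) = 0` is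
necessary, and it is sufficient by the Frobenius theorem, proved in the section on total
differential equations by integrating along rays and comparing nearby rays by Grönwall's inequality.
-/

noncomputable section

namespace PlanarWeb

variable {D : Set (ℝ × ℝ)}

/-! ### Smoothness of the invariants of the web -/

theorem contDiffOn_area (W : PlanarWeb D) : ContDiffOn ℝ ∞ W.area D := by
  have h₁ := W.smooth₁
  have h₂ := W.smooth₂
  exact ((h₁.clm_apply contDiffOn_const).mul (h₂.clm_apply contDiffOn_const)).sub
    ((h₁.clm_apply contDiffOn_const).mul (h₂.clm_apply contDiffOn_const))

theorem contDiffOn_frame₁ (W : PlanarWeb D) : ContDiffOn ℝ ∞ W.frame₁ D := by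
  have h₂ := W.smooth₂
  have ha := W.contDiffOn_area
  exact ((h₂.clm_apply contDiffOn_const).div ha fun x hx => W.area_ne_zero hx).prodMk
    ((h₂.clm_apply contDiffOn_const).neg.div ha fun x hx => W.area_ne_zero hx)

theorem contDiffOn_frame₂ (W : PlanarWeb D) : ContDiffOn ℝ ∞ W.frame₂ D := by
  have h₁ := W.smooth₁
  have ha := W.contDiffOn_area
  exact ((h₁.clm_apply contDiffOn_const).neg.div ha fun x hx => W.area_ne_zero hx).prodMk
    ((h₁.clm_apply contDiffOn_const).div ha fun x hx => W.area_ne_zero hx)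

theorem contDiffAt_pd₁ (W : PlanarWeb D) (hD : IsOpen D) {h : ℝ × ℝ → ℝ} {x : ℝ × ℝ}
    (hx : x ∈ D) (hh : ContDiffAt ℝ ∞ h x) : ContDiffAt ℝ ∞ (W.pd₁ h) x :=
  (hh.fderiv_right (by simp)).clm_apply (W.contDiffOn_frame₁.contDiffAt (hD.mem_nhds hx))

theorem contDiffAt_pd₂ (W : PlanarWeb D) (hD : IsOpen D) {h : ℝ × ℝ → ℝ} {x : ℝ × ℝ}
    (hx : x ∈ D) (hh : ContDiffAt ℝ ∞ h x) : ContDiffAt ℝ ∞ (W.pd₂ h) x :=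
  (hh.fderiv_right (by simp)).clm_apply (W.contDiffOn_frame₂.contDiffAt (hD.mem_nhds hx))

theorem contDiffOn_pd₁ (W : PlanarWeb D) (hD : IsOpen D) {h : ℝ × ℝ → ℝ}
    (hh : ContDiffOn ℝ ∞ h D) : ContDiffOn ℝ ∞ (W.pd₁ h) D := fun _ hx =>
  (W.contDiffAt_pd₁ hD hx (hh.contDiffAt (hD.mem_nhds hx))).contDiffWithinAt

theorem contDiffOn_pd₂ (W : PlanarWeb D) (hD : IsOpen D) {h : ℝ × ℝ → ℝ}
    (hh : ContDiffOn ℝ ∞ h D) : ContDiffOn ℝ ∞ (W.pd₂ h) D := fun _ hx =>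
  (W.contDiffAt_pd₂ hD hx (hh.contDiffAt (hD.mem_nhds hx))).contDiffWithinAt

theorem contDiffOn_formD_frame (W : PlanarWeb D) (hD : IsOpen D) {θ : PlaneForm}
    (hθ : ContDiffOn ℝ ∞ θ D) :
    ContDiffOn ℝ ∞ (fun x => formD θ x (W.frame₁ x) (W.frame₂ x)) D := by
  have h := hθ.fderiv_of_isOpen hD (m := ∞) (by simp)
  have h₁ := W.contDiffOn_frame₁
  have h₂ := W.contDiffOn_frame₂
  exact ((h.clm_apply h₁).clm_apply h₂).sub ((h.clm_apply h₂).clm_apply h₁)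

theorem contDiffOn_g₁ (W : PlanarWeb D) (hD : IsOpen D) : ContDiffOn ℝ ∞ W.g₁ D :=
  (W.contDiffOn_formD_frame hD W.smooth₂).neg

theorem contDiffOn_g₂ (W : PlanarWeb D) (hD : IsOpen D) : ContDiffOn ℝ ∞ W.g₂ D :=
  W.contDiffOn_formD_frame hD W.smooth₁

theorem contDiffOn_γ (W : PlanarWeb D) (hD : IsOpen D) : ContDiffOn ℝ ∞ W.γ D :=
  ((W.contDiffOn_g₁ hD).smul W.smooth₁).add ((W.contDiffOn_g₂ hD).smul W.smooth₂)

theorem contDiffOn_K (W : PlanarWeb D) (hD : IsOpen D) : ContDiffOn ℝ ∞ W.K D :=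
  W.contDiffOn_formD_frame hD (W.contDiffOn_γ hD)

theorem contDiffOn_δ₁ (W : PlanarWeb D) (hD : IsOpen D) (w : ℕ) {h : ℝ × ℝ → ℝ}
    (hh : ContDiffOn ℝ ∞ h D) : ContDiffOn ℝ ∞ (W.δ₁ w h) D :=
  (W.contDiffOn_pd₁ hD hh).sub ((contDiffOn_const.mul (W.contDiffOn_g₁ hD)).mul hh)

theorem contDiffOn_δ₂ (W : PlanarWeb D) (hD : IsOpen D) (w : ℕ) {h : ℝ × ℝ → ℝ}
    (hh : ContDiffOn ℝ ∞ h D) : ContDiffOn ℝ ∞ (W.δ₂ w h) D :=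
  (W.contDiffOn_pd₂ hD hh).sub ((contDiffOn_const.mul (W.contDiffOn_g₂ hD)).mul hh)

theorem contDiffOn_orderedSum (W : PlanarWeb D) (hD : IsOpen D) (w : ℕ) {h : ℝ × ℝ → ℝ}
    (hh : ContDiffOn ℝ ∞ h D) (a b : ℕ) : ContDiffOn ℝ ∞ (W.orderedSum w h a b) D := by
  induction a generalizing b with
  | zero =>
    induction b with
    | zero => simpa only [orderedSum] using hh
    | succ b ih => simpa only [orderedSum] using W.contDiffOn_δ₂ hD _ ih
  | succ a iha =>
    induction b with
    | zero => simpa only [orderedSum] using W.contDiffOn_δ₁ hD _ (iha 0)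
    | succ b ihb =>
      simpa only [orderedSum] using
        (W.contDiffOn_δ₁ hD _ (iha (b + 1))).add (W.contDiffOn_δ₂ hD _ ihb)

theorem contDiffOn_sym (W : PlanarWeb D) (hD : IsOpen D) (w : ℕ) {h : ℝ × ℝ → ℝ}
    (hh : ContDiffOn ℝ ∞ h D) (a b : ℕ) : ContDiffOn ℝ ∞ (W.sym w h a b) D :=
  (W.contDiffOn_orderedSum hD w hh a b).div_const _

theorem differentiableAt_of_contDiffOn (hD : IsOpen D) {h : ℝ × ℝ → ℝ}
    (hh : ContDiffOn ℝ ∞ h D) {x : ℝ × ℝ} (hx : x ∈ D) : DifferentiableAt ℝ h x :=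
  (hh.contDiffAt (hD.mem_nhds hx)).differentiableAt (by simp)

/-! ### Covariant derivatives at a point -/

/-- The function `h` of weight `w` is differentiable at `x`, with covariant derivatives
`δ₁ h = a` and `δ₂ h = b` there. -/
def HasCovAt (W : PlanarWeb D) (w : ℕ) (h : ℝ × ℝ → ℝ) (a b : ℝ) (x : ℝ × ℝ) : Prop :=
  DifferentiableAt ℝ h x ∧ W.δ₁ w h x = a ∧ W.δ₂ w h x = b

namespace HasCovAt

variable {W : PlanarWeb D} {w v : ℕ} {f g : ℝ × ℝ → ℝ} {a b c d : ℝ} {x : ℝ × ℝ}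

theorem add (hf : W.HasCovAt w f a b x) (hg : W.HasCovAt w g c d x) :
    W.HasCovAt w (fun y => f y + g y) (a + c) (b + d) x := by
  obtain ⟨hf, rfl, rfl⟩ := hf
  obtain ⟨hg, rfl, rfl⟩ := hg
  refine ⟨hf.fun_add hg, ?_, ?_⟩ <;>
    simp only [δ₁, δ₂, pd₁, pd₂, fderiv_fun_add hf hg, add_apply] <;> ring

theorem sub (hf : W.HasCovAt w f a b x) (hg : W.HasCovAt w g c d x) :
    W.HasCovAt w (fun y => f y - g y) (a - c) (b - d) x := by
  obtain ⟨hf, rfl, rfl⟩ := hf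
  obtain ⟨hg, rfl, rfl⟩ := hg
  refine ⟨hf.fun_sub hg, ?_, ?_⟩ <;>
    simp only [δ₁, δ₂, pd₁, pd₂, fderiv_fun_sub hf hg, sub_apply] <;> ring

/-- The Leibniz rule; weights are additive. -/
theorem mul (hf : W.HasCovAt w f a b x) (hg : W.HasCovAt v g c d x) :
    W.HasCovAt (w + v) (fun y => f y * g y) (a * g x + f x * c) (b * g x + f x * d) x := by
  obtain ⟨hf, rfl, rfl⟩ := hf
  obtain ⟨hg, rfl, rfl⟩ := hg
  refine ⟨hf.fun_mul hg, ?_, ?_⟩ <;>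
    simp only [δ₁, δ₂, pd₁, pd₂, fderiv_fun_mul hf hg, add_apply, smul_apply, smul_eq_mul] <;>
    push_cast <;> ring

theorem const_mul (r : ℝ) (hf : W.HasCovAt w f a b x) :
    W.HasCovAt w (fun y => r * f y) (r * a) (r * b) x := by
  obtain ⟨hf, rfl, rfl⟩ := hf
  refine ⟨hf.const_mul r, ?_, ?_⟩ <;>
    simp only [δ₁, δ₂, pd₁, pd₂, fderiv_const_mul hf, smul_apply, smul_eq_mul] <;> ring

theorem congr (hf : W.HasCovAt w f a b x) (hfg : g =ᶠ[nhds x] f) :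
    W.HasCovAt w g a b x := by
  obtain ⟨hf, rfl, rfl⟩ := hf
  refine ⟨hf.congr_of_eventuallyEq hfg, ?_, ?_⟩ <;>
    simp only [δ₁, δ₂, pd₁, pd₂, hfg.fderiv_eq, hfg.eq_of_nhds]

theorem congr_on (hD : IsOpen D) (hx : x ∈ D) (hf : W.HasCovAt w f a b x)
    (hfg : ∀ y ∈ D, g y = f y) : W.HasCovAt w g a b x :=
  hf.congr (Filter.eventually_of_mem (hD.mem_nhds hx) hfg)

theorem congr_val {a' b' : ℝ} (hf : W.HasCovAt w f a b x) (ha : a = a') (hb : b = b') :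
    W.HasCovAt w f a' b' x := ha ▸ hb ▸ hf

end HasCovAt

theorem hasCovAt (W : PlanarWeb D) (hD : IsOpen D) (w : ℕ) {h : ℝ × ℝ → ℝ}
    (hh : ContDiffOn ℝ ∞ h D) {x : ℝ × ℝ} (hx : x ∈ D) :
    W.HasCovAt w h (W.δ₁ w h x) (W.δ₂ w h x) x :=
  ⟨differentiableAt_of_contDiffOn hD hh hx, rfl, rfl⟩

/-! ### The commutator of the covariant derivatives -/

/-- The commutator of the dual frame, `[∂₁, ∂₂] = -g₂ ∂₁ + g₁ ∂₂`: this is the dual form of the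
structure equations `dωᵢ = ωᵢ ∧ γ`. -/
theorem fderiv_frame_sub (W : PlanarWeb D) (hD : IsOpen D) {x : ℝ × ℝ} (hx : x ∈ D) :
    fderiv ℝ W.frame₂ x (W.frame₁ x) - fderiv ℝ W.frame₁ x (W.frame₂ x) =
      -W.g₂ x • W.frame₁ x + W.g₁ x • W.frame₂ x := by
  have hn := hD.mem_nhds hx
  have d₁ : DifferentiableAt ℝ W.frame₁ x :=
    (W.contDiffOn_frame₁.contDiffAt hn).differentiableAt (by simp)
  have d₂ : DifferentiableAt ℝ W.frame₂ x :=
    (W.contDiffOn_frame₂.contDiffAt hn).differentiableAt (by simp)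
  have e₁ : DifferentiableAt ℝ W.ω₁ x := (W.smooth₁.contDiffAt hn).differentiableAt (by simp)
  have e₂ : DifferentiableAt ℝ W.ω₂ x := (W.smooth₂.contDiffAt hn).differentiableAt (by simp)
  have key : ∀ (θ : PlaneForm) (X : ℝ × ℝ → ℝ × ℝ) (c : ℝ), DifferentiableAt ℝ θ x →
      DifferentiableAt ℝ X x → (∀ y ∈ D, θ y (X y) = c) → ∀ v,
      fderiv ℝ θ x v (X x) + θ x (fderiv ℝ X x v) = 0 := by
    intro θ X c hθ hX hc v
    have h := (hθ.hasFDerivAt.clm_apply hX.hasFDerivAt).fderiv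
    have h0 : fderiv ℝ (fun y => θ y (X y)) x = 0 := by
      have hE : (fun y => θ y (X y)) =ᶠ[nhds x] fun _ => c := Filter.eventually_of_mem hn hc
      rw [hE.fderiv_eq]
      simp
    rw [h0] at h
    have := congrArg (fun L => L v) h
    simp at this
    linarith
  have a₁ := key W.ω₁ W.frame₁ 1 e₁ d₁ (fun y hy => (W.frame_dual hy).1) (W.frame₂ x)
  have a₂ := key W.ω₁ W.frame₂ 0 e₁ d₂ (fun y hy => (W.frame_dual hy).2.1) (W.frame₁ x)
  have b₁ := key W.ω₂ W.frame₁ 0 e₂ d₁ (fun y hy => (W.frame_dual hy).2.2.1) (W.frame₂ x)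
  have b₂ := key W.ω₂ W.frame₂ 1 e₂ d₂ (fun y hy => (W.frame_dual hy).2.2.2) (W.frame₁ x)
  rw [W.decompose hx (fderiv ℝ W.frame₂ x (W.frame₁ x) - fderiv ℝ W.frame₁ x (W.frame₂ x))]
  congr 2
  · simp only [map_sub, g₂, formD]; linarith
  · simp only [map_sub, g₁, formD]; linarith

theorem pd_comm (W : PlanarWeb D) (hD : IsOpen D) {h : ℝ × ℝ → ℝ} {x : ℝ × ℝ}
    (hx : x ∈ D) (hh : ContDiffAt ℝ ∞ h x) :
    W.pd₁ (W.pd₂ h) x - W.pd₂ (W.pd₁ h) x = -W.g₂ x * W.pd₁ h x + W.g₁ x * W.pd₂ h x := by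
  have hn := hD.mem_nhds hx
  have d₁ : DifferentiableAt ℝ W.frame₁ x :=
    (W.contDiffOn_frame₁.contDiffAt hn).differentiableAt (by simp)
  have d₂ : DifferentiableAt ℝ W.frame₂ x :=
    (W.contDiffOn_frame₂.contDiffAt hn).differentiableAt (by simp)
  have dh : DifferentiableAt ℝ (fderiv ℝ h) x :=
    (hh.fderiv_right (m := ∞) (by simp)).differentiableAt (by simp)
  have hs : fderiv ℝ (fderiv ℝ h) x (W.frame₁ x) (W.frame₂ x) =
      fderiv ℝ (fderiv ℝ h) x (W.frame₂ x) (W.frame₁ x) :=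
    (contDiffAt_infty.1 hh 2).isSymmSndFDerivAt (by simp) _ _
  have k₁ := congrArg (fun L => L (W.frame₂ x)) (dh.hasFDerivAt.clm_apply d₁.hasFDerivAt).fderiv
  have k₂ := congrArg (fun L => L (W.frame₁ x)) (dh.hasFDerivAt.clm_apply d₂.hasFDerivAt).fderiv
  have k₃ := congrArg (fderiv ℝ h x) (W.fderiv_frame_sub hD hx)
  simp only [map_sub, map_add, map_smul, smul_eq_mul] at k₃
  simp at k₁ k₂
  change fderiv ℝ (fun y => fderiv ℝ h y (W.frame₂ y)) x (W.frame₁ x) -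
    fderiv ℝ (fun y => fderiv ℝ h y (W.frame₁ y)) x (W.frame₂ x) = _
  rw [k₁, k₂]
  simp only [pd₁, pd₂]
  linarith

/-- The exterior derivative of a one-form `f₁ ω₁ + f₂ ω₂`, in terms of its components. -/
theorem formD_combination (W : PlanarWeb D) (hD : IsOpen D) {f₁ f₂ : ℝ × ℝ → ℝ} {x : ℝ × ℝ}
    (hx : x ∈ D) (h₁ : DifferentiableAt ℝ f₁ x) (h₂ : DifferentiableAt ℝ f₂ x) :
    formD (fun y => f₁ y • W.ω₁ y + f₂ y • W.ω₂ y) x (W.frame₁ x) (W.frame₂ x) =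
      W.pd₁ f₂ x - W.pd₂ f₁ x + f₁ x * W.g₂ x - f₂ x * W.g₁ x := by
  have hn := hD.mem_nhds hx
  have e₁ : DifferentiableAt ℝ W.ω₁ x := (W.smooth₁.contDiffAt hn).differentiableAt (by simp)
  have e₂ : DifferentiableAt ℝ W.ω₂ x := (W.smooth₂.contDiffAt hn).differentiableAt (by simp)
  obtain ⟨f11, f12, f21, f22⟩ := W.frame_dual hx
  simp only [formD, g₁, g₂, pd₁, pd₂]
  have h : fderiv ℝ (fun y => f₁ y • W.ω₁ y + f₂ y • W.ω₂ y) x = _ :=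
    ((h₁.hasFDerivAt.smul e₁.hasFDerivAt).add (h₂.hasFDerivAt.smul e₂.hasFDerivAt)).fderiv
  rw [h]
  simp [f11, f12, f21, f22]
  ring

theorem K_eq (W : PlanarWeb D) (hD : IsOpen D) {x : ℝ × ℝ} (hx : x ∈ D) :
    W.K x = W.pd₁ W.g₂ x - W.pd₂ W.g₁ x := by
  have h := W.formD_combination hD hx (differentiableAt_of_contDiffOn hD (W.contDiffOn_g₁ hD) hx)
    (differentiableAt_of_contDiffOn hD (W.contDiffOn_g₂ hD) hx)
  rw [K]
  exact h.trans (by ring)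

/-- The Ricci identity: `δ₁ δ₂ h - δ₂ δ₁ h = -w K h` for a function `h` of weight `w`. -/
theorem δ_comm (W : PlanarWeb D) (hD : IsOpen D) (w : ℕ) {h : ℝ × ℝ → ℝ} {x : ℝ × ℝ}
    (hx : x ∈ D) (hh : ContDiffAt ℝ ∞ h x) :
    W.δ₁ (w + 1) (W.δ₂ w h) x - W.δ₂ (w + 1) (W.δ₁ w h) x = -(w * W.K x * h x) := by
  have dh : DifferentiableAt ℝ h x := hh.differentiableAt (by simp)
  have d1 : DifferentiableAt ℝ (W.pd₁ h) x :=
    (W.contDiffAt_pd₁ hD hx hh).differentiableAt (by simp)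
  have d2 : DifferentiableAt ℝ (W.pd₂ h) x :=
    (W.contDiffAt_pd₂ hD hx hh).differentiableAt (by simp)
  have dg1 := differentiableAt_of_contDiffOn hD (W.contDiffOn_g₁ hD) hx
  have dg2 := differentiableAt_of_contDiffOn hD (W.contDiffOn_g₂ hD) hx
  have e₁ : W.pd₁ (W.δ₂ w h) x = W.pd₁ (W.pd₂ h) x -
      w * (W.pd₁ W.g₂ x * h x + W.g₂ x * W.pd₁ h x) := by
    have := (d2.hasFDerivAt.sub ((dg2.hasFDerivAt.const_mul (w : ℝ)).mul dh.hasFDerivAt)).fderiv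
    have := congrArg (fun L => L (W.frame₁ x)) this
    simp at this
    simp only [pd₁] at *
    refine this.trans ?_
    ring
  have e₂ : W.pd₂ (W.δ₁ w h) x = W.pd₂ (W.pd₁ h) x -
      w * (W.pd₂ W.g₁ x * h x + W.g₁ x * W.pd₂ h x) := by
    have := (d1.hasFDerivAt.sub ((dg1.hasFDerivAt.const_mul (w : ℝ)).mul dh.hasFDerivAt)).fderiv
    have := congrArg (fun L => L (W.frame₂ x)) this
    simp at this
    simp only [pd₁, pd₂] at *
    refine this.trans ?_
    ring
  have hc := W.pd_comm hD hx hh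
  have hK := W.K_eq hD hx
  unfold δ₁ δ₂ at *
  rw [hK]
  push_cast
  linear_combination e₁ - e₂ + hc

/-- The Ricci identity for a function whose covariant derivatives `A`, `B` near `x` are known. -/
theorem HasCovAt.comm {W : PlanarWeb D} (hD : IsOpen D) {x : ℝ × ℝ} (hx : x ∈ D) {w : ℕ}
    {h A B : ℝ × ℝ → ℝ} (hh : ContDiffAt ℝ ∞ h x)
    (hAB : ∀ᶠ y in nhds x, W.HasCovAt w h (A y) (B y) y)
    {a₁ a₂ b₁ b₂ : ℝ} (hA : W.HasCovAt (w + 1) A a₁ a₂ x) (hB : W.HasCovAt (w + 1) B b₁ b₂ x) :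
    b₁ - a₂ = -(w * W.K x * h x) := by
  have h₁ := hA.congr (g := W.δ₁ w h) (hAB.mono fun y hy => hy.2.1)
  have h₂ := hB.congr (g := W.δ₂ w h) (hAB.mono fun y hy => hy.2.2)
  rw [← W.δ_comm hD w hx hh, h₁.2.2, h₂.2.1]

/-! ### Covariant derivatives in symmetrized coordinates -/

theorem orderedSum_eq_mul_sym (W : PlanarWeb D) (w : ℕ) (h : ℝ × ℝ → ℝ) (a b : ℕ) :
    W.orderedSum w h a b = fun x => ((a + b).choose a : ℝ) * W.sym w h a b x := by
  funext x
  have : ((a + b).choose a : ℝ) ≠ 0 := by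
    exact_mod_cast (Nat.choose_pos (Nat.le_add_right a b)).ne'
  simp only [sym]
  field_simp

theorem sym_zero_zero (W : PlanarWeb D) (w : ℕ) (h : ℝ × ℝ → ℝ) : W.sym w h 0 0 = h := by
  funext x
  simp [sym, orderedSum]

theorem sym_succ_zero (W : PlanarWeb D) (w : ℕ) (h : ℝ × ℝ → ℝ) (a : ℕ) :
    W.sym w h (a + 1) 0 = W.δ₁ (w + a) (W.sym w h a 0) := by
  have e : ∀ n, W.sym w h n 0 = W.orderedSum w h n 0 := fun n => by
    funext x; simp [sym]
  rw [e, e]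
  simp only [orderedSum]

theorem sym_zero_succ (W : PlanarWeb D) (w : ℕ) (h : ℝ × ℝ → ℝ) (b : ℕ) :
    W.sym w h 0 (b + 1) = W.δ₂ (w + b) (W.sym w h 0 b) := by
  have e : ∀ n, W.sym w h 0 n = W.orderedSum w h 0 n := fun n => by
    funext x; simp [sym]
  rw [e, e]
  simp only [orderedSum]

/-- The last derivative applied in a mixed symmetrized derivative is either `δ₁` or `δ₂`. -/
theorem sym_succ_succ (W : PlanarWeb D) (hD : IsOpen D) (w : ℕ) {h : ℝ × ℝ → ℝ}
    (hh : ContDiffOn ℝ ∞ h D) (a b : ℕ) {x : ℝ × ℝ} (hx : x ∈ D) :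
    ((a + 1 + (b + 1)).choose (a + 1) : ℝ) * W.sym w h (a + 1) (b + 1) x =
      ((a + (b + 1)).choose a : ℝ) * W.δ₁ (w + a + (b + 1)) (W.sym w h a (b + 1)) x +
        ((a + 1 + b).choose (a + 1) : ℝ) * W.δ₂ (w + (a + 1) + b) (W.sym w h (a + 1) b) x := by
  have h₁ := (W.hasCovAt hD (w + a + (b + 1)) (W.contDiffOn_sym hD w hh a (b + 1)) hx).const_mul
    ((a + (b + 1)).choose a : ℝ)
  have h₂ := (W.hasCovAt hD (w + (a + 1) + b) (W.contDiffOn_sym hD w hh (a + 1) b) hx).const_mul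
    ((a + 1 + b).choose (a + 1) : ℝ)
  rw [← orderedSum_eq_mul_sym] at h₁ h₂
  rw [← h₁.2.1, ← h₂.2.2]
  have := congrFun (W.orderedSum_eq_mul_sym w h (a + 1) (b + 1)) x
  rw [← this]
  simp only [orderedSum]

theorem hasCovAt_sym_zero (W : PlanarWeb D) (w : ℕ) (hD : IsOpen D) {h : ℝ × ℝ → ℝ}
    (hh : ContDiffOn ℝ ∞ h D) {x : ℝ × ℝ} (hx : x ∈ D) :
    W.HasCovAt w h (W.sym w h 1 0 x) (W.sym w h 0 1 x) x := by
  have h₁ := W.sym_succ_zero w h 0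
  have h₂ := W.sym_zero_succ w h 0
  simp only [sym_zero_zero] at h₁ h₂
  rw [h₁, h₂]
  exact W.hasCovAt hD w hh hx

/-- The covariant derivatives of the first jet coordinates: by the Ricci identity, `δ₁` and `δ₂`
of them are the symmetrized second derivatives up to a curvature term of order zero. -/
theorem hasCovAt_sym_one (W : PlanarWeb D) (w : ℕ) (hD : IsOpen D) {h : ℝ × ℝ → ℝ}
    (hh : ContDiffOn ℝ ∞ h D) {x : ℝ × ℝ} (hx : x ∈ D) :
    W.HasCovAt (w + 1) (W.sym w h 1 0) (W.sym w h 2 0 x)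
        (W.sym w h 1 1 x + w / 2 * W.K x * h x) x ∧
      W.HasCovAt (w + 1) (W.sym w h 0 1) (W.sym w h 1 1 x - w / 2 * W.K x * h x)
        (W.sym w h 0 2 x) x := by
  have A := W.hasCovAt hD (w + 1) (W.contDiffOn_sym hD w hh 1 0) hx
  have B := W.hasCovAt hD (w + 1) (W.contDiffOn_sym hD w hh 0 1) hx
  have c := HasCovAt.comm hD hx (hh.contDiffAt (hD.mem_nhds hx))
    (Filter.eventually_of_mem (hD.mem_nhds hx) fun y hy => W.hasCovAt_sym_zero w hD hh hy) A B
  have s := W.sym_succ_succ hD w hh 0 0 hx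
  simp [Nat.choose] at s
  refine ⟨A.congr_val ?_ ?_, B.congr_val ?_ ?_⟩
  · rw [W.sym_succ_zero w h 1]
  · linarith
  · linarith
  · rw [W.sym_zero_succ w h 1]

/-- The covariant derivatives of the second jet coordinates, obtained from `hasCovAt_sym_one` and
the Ricci identities of the first jet coordinates. -/
theorem hasCovAt_sym_two (W : PlanarWeb D) (w : ℕ) (hD : IsOpen D) {h : ℝ × ℝ → ℝ}
    (hh : ContDiffOn ℝ ∞ h D) {x : ℝ × ℝ} (hx : x ∈ D) :
    W.HasCovAt (w + 2) (W.sym w h 2 0) (W.sym w h 3 0 x)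
        (W.sym w h 2 1 x + (3 * w + 2) / 3 * W.K x * W.sym w h 1 0 x +
          w / 3 * W.sym 2 W.K 1 0 x * h x) x ∧
      W.HasCovAt (w + 2) (W.sym w h 1 1)
        (W.sym w h 2 1 x - (3 * w + 2) / 6 * W.K x * W.sym w h 1 0 x -
          w / 6 * W.sym 2 W.K 1 0 x * h x)
        (W.sym w h 1 2 x + (3 * w + 2) / 6 * W.K x * W.sym w h 0 1 x +
          w / 6 * W.sym 2 W.K 0 1 x * h x) x ∧
      W.HasCovAt (w + 2) (W.sym w h 0 2)
        (W.sym w h 1 2 x - (3 * w + 2) / 3 * W.K x * W.sym w h 0 1 x -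
          w / 3 * W.sym 2 W.K 0 1 x * h x) (W.sym w h 0 3 x) x := by
  have A := W.hasCovAt hD (w + 2) (W.contDiffOn_sym hD w hh 2 0) hx
  have B := W.hasCovAt hD (w + 2) (W.contDiffOn_sym hD w hh 1 1) hx
  have C := W.hasCovAt hD (w + 2) (W.contDiffOn_sym hD w hh 0 2) hx
  have Kh := (((W.hasCovAt_sym_zero 2 hD (W.contDiffOn_K hD) hx).const_mul (w / 2 : ℝ)).mul
    (W.hasCovAt_sym_zero w hD hh hx)).congr_val rfl rfl
  rw [show 2 + w = w + 2 by ring] at Kh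
  have n := hD.mem_nhds hx
  have c₁ := HasCovAt.comm hD hx ((W.contDiffOn_sym hD w hh 1 0).contDiffAt n)
    (Filter.eventually_of_mem n fun y hy => (W.hasCovAt_sym_one w hD hh hy).1) A (B.add Kh)
  have c₂ := HasCovAt.comm hD hx ((W.contDiffOn_sym hD w hh 0 1).contDiffAt n)
    (Filter.eventually_of_mem n fun y hy => (W.hasCovAt_sym_one w hD hh hy).2) (B.sub Kh) C
  have s₁ := W.sym_succ_succ hD w hh 1 0 hx
  have s₂ := W.sym_succ_succ hD w hh 0 1 hx
  simp [Nat.choose, add_assoc] at s₁ s₂ c₁ c₂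
  refine ⟨A.congr_val ?_ ?_, B.congr_val ?_ ?_, C.congr_val ?_ ?_⟩
  · rw [W.sym_succ_zero w h 2]
  · linear_combination -s₁ / 3 - 2 / 3 * c₁
  · linear_combination -s₁ / 3 + 1 / 3 * c₁
  · linear_combination -s₂ / 3 - 1 / 3 * c₂
  · linear_combination -s₂ / 3 + 2 / 3 * c₂
  · rw [W.sym_zero_succ w h 2]

/-- The covariant derivatives of the third jet coordinates, obtained from `hasCovAt_sym_two` and
the Ricci identities of the second jet coordinates. -/
theorem hasCovAt_sym_three (W : PlanarWeb D) (w : ℕ) (hD : IsOpen D) {h : ℝ × ℝ → ℝ}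
    (hh : ContDiffOn ℝ ∞ h D) {x : ℝ × ℝ} (hx : x ∈ D) :
    W.HasCovAt (w + 3) (W.sym w h 3 0) (W.sym w h 4 0 x)
        (W.sym w h 3 1 x + ((3 * w + 4) / 2 * W.K x * W.sym w h 2 0 x +
          (2 * w + 1) / 2 * W.sym 2 W.K 1 0 x * W.sym w h 1 0 x +
          w / 4 * W.sym 2 W.K 2 0 x * h x)) x ∧
      W.HasCovAt (w + 3) (W.sym w h 2 1)
        (W.sym w h 3 1 x - ((3 * w + 4) / 2 * W.K x * W.sym w h 2 0 x +
          (2 * w + 1) / 2 * W.sym 2 W.K 1 0 x * W.sym w h 1 0 x +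
          w / 4 * W.sym 2 W.K 2 0 x * h x) / 3)
        (W.sym w h 2 2 x + ((3 * w + 4) / 3 * W.K x * W.sym w h 1 1 x +
          (2 * w + 1) / 6 * (W.sym 2 W.K 0 1 x * W.sym w h 1 0 x +
            W.sym 2 W.K 1 0 x * W.sym w h 0 1 x) + w / 6 * W.sym 2 W.K 1 1 x * h x)) x ∧
      W.HasCovAt (w + 3) (W.sym w h 1 2)
        (W.sym w h 2 2 x - ((3 * w + 4) / 3 * W.K x * W.sym w h 1 1 x +
          (2 * w + 1) / 6 * (W.sym 2 W.K 0 1 x * W.sym w h 1 0 x +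
            W.sym 2 W.K 1 0 x * W.sym w h 0 1 x) + w / 6 * W.sym 2 W.K 1 1 x * h x))
        (W.sym w h 1 3 x + ((3 * w + 4) / 2 * W.K x * W.sym w h 0 2 x +
          (2 * w + 1) / 2 * W.sym 2 W.K 0 1 x * W.sym w h 0 1 x +
          w / 4 * W.sym 2 W.K 0 2 x * h x) / 3) x ∧
      W.HasCovAt (w + 3) (W.sym w h 0 3)
        (W.sym w h 1 3 x - ((3 * w + 4) / 2 * W.K x * W.sym w h 0 2 x +
          (2 * w + 1) / 2 * W.sym 2 W.K 0 1 x * W.sym w h 0 1 x +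
          w / 4 * W.sym 2 W.K 0 2 x * h x)) (W.sym w h 0 4 x) x := by
  have A := W.hasCovAt hD (w + 3) (W.contDiffOn_sym hD w hh 3 0) hx
  have B := W.hasCovAt hD (w + 3) (W.contDiffOn_sym hD w hh 2 1) hx
  have C := W.hasCovAt hD (w + 3) (W.contDiffOn_sym hD w hh 1 2) hx
  have E := W.hasCovAt hD (w + 3) (W.contDiffOn_sym hD w hh 0 3) hx
  have h0 := W.hasCovAt_sym_zero w hD hh hx
  obtain ⟨h1, h2⟩ := W.hasCovAt_sym_one w hD hh hx
  have k0 := W.hasCovAt_sym_zero 2 hD (W.contDiffOn_K hD) hx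
  obtain ⟨k1, k2⟩ := W.hasCovAt_sym_one 2 hD (W.contDiffOn_K hD) hx
  have Kh1 := k0.mul h1
  have Kh2 := k0.mul h2
  have K1h := k1.mul h0
  have K2h := k2.mul h0
  rw [show 2 + (w + 1) = w + 3 by ring] at Kh1 Kh2
  rw [show 2 + 1 + w = w + 3 by ring] at K1h K2h
  have n := hD.mem_nhds hx
  have c₁ := HasCovAt.comm hD hx ((W.contDiffOn_sym hD w hh 2 0).contDiffAt n)
    (Filter.eventually_of_mem n fun y hy => (W.hasCovAt_sym_two w hD hh hy).1) A
    (((B.add (Kh1.const_mul ((3 * w + 2) / 3 : ℝ))).add (K1h.const_mul (w / 3 : ℝ))).congr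
      (.of_forall fun y => by ring))
  have c₂ := HasCovAt.comm hD hx ((W.contDiffOn_sym hD w hh 1 1).contDiffAt n)
    (Filter.eventually_of_mem n fun y hy => (W.hasCovAt_sym_two w hD hh hy).2.1)
    (((B.sub (Kh1.const_mul ((3 * w + 2) / 6 : ℝ))).sub (K1h.const_mul (w / 6 : ℝ))).congr
      (.of_forall fun y => by ring))
    (((C.add (Kh2.const_mul ((3 * w + 2) / 6 : ℝ))).add (K2h.const_mul (w / 6 : ℝ))).congr
      (.of_forall fun y => by ring))
  have c₃ := HasCovAt.comm hD hx ((W.contDiffOn_sym hD w hh 0 2).contDiffAt n)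
    (Filter.eventually_of_mem n fun y hy => (W.hasCovAt_sym_two w hD hh hy).2.2)
    (((C.sub (Kh2.const_mul ((3 * w + 2) / 3 : ℝ))).sub (K2h.const_mul (w / 3 : ℝ))).congr
      (.of_forall fun y => by ring)) E
  have s₁ := W.sym_succ_succ hD w hh 2 0 hx
  have s₂ := W.sym_succ_succ hD w hh 1 1 hx
  have s₃ := W.sym_succ_succ hD w hh 0 2 hx
  simp [Nat.choose, add_assoc] at s₁ s₂ s₃ c₁ c₂ c₃
  refine ⟨A.congr_val ?_ ?_, B.congr_val ?_ ?_, C.congr_val ?_ ?_, E.congr_val ?_ ?_⟩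
  · rw [W.sym_succ_zero w h 3]
  · linear_combination -s₁ / 4 - 3 / 4 * c₁
  · linear_combination -s₁ / 4 + 1 / 4 * c₁
  · linear_combination -s₂ / 6 - 1 / 2 * c₂
  · linear_combination -s₂ / 6 + 1 / 2 * c₂
  · linear_combination -s₃ / 4 - 1 / 4 * c₃
  · linear_combination -s₃ / 4 + 3 / 4 * c₃
  · rw [W.sym_zero_succ w h 3]

/-! ### Functions with prescribed jets -/

/-- The smooth function `h` vanishes to order `n - 1` at `x`, and its derivatives of order `n`
at `x`, with `a` derivatives `∂₁` and `b` derivatives `∂₂` in any order, have the value `q a b`.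
Only the values of `q` at `a + b = n` matter. -/
def HasSymbolAt (W : PlanarWeb D) (x : ℝ × ℝ) : ℕ → (ℝ × ℝ → ℝ) → (ℕ → ℕ → ℝ) → Prop
  | 0, h, q => ContDiffOn ℝ ∞ h D ∧ h x = q 0 0
  | n + 1, h, q => ContDiffOn ℝ ∞ h D ∧ h x = 0 ∧
      HasSymbolAt W x n (W.pd₁ h) (fun a b => q (a + 1) b) ∧
      HasSymbolAt W x n (W.pd₂ h) (fun a b => q a (b + 1))

namespace HasSymbolAt

variable {W : PlanarWeb D} {x : ℝ × ℝ} {n : ℕ} {h f : ℝ × ℝ → ℝ} {q r : ℕ → ℕ → ℝ}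

theorem contDiffOn (H : W.HasSymbolAt x n h q) : ContDiffOn ℝ ∞ h D := by
  cases n <;> exact H.1

theorem congr_symbol (H : W.HasSymbolAt x n h q) (e : ∀ a b, a + b = n → q a b = r a b) :
    W.HasSymbolAt x n h r := by
  induction n generalizing h q r with
  | zero => exact ⟨H.1, H.2.trans (e 0 0 rfl)⟩
  | succ n ih =>
    exact ⟨H.1, H.2.1, ih H.2.2.1 fun a b hab => e _ _ (by omega),
      ih H.2.2.2 fun a b hab => e _ _ (by omega)⟩

theorem congr_on (hD : IsOpen D) (hx : x ∈ D) (H : W.HasSymbolAt x n h q)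
    (e : ∀ y ∈ D, f y = h y) : W.HasSymbolAt x n f q := by
  induction n generalizing h f q with
  | zero => exact ⟨H.1.congr e, (e x hx).trans H.2⟩
  | succ n ih =>
    have e' : ∀ y ∈ D, fderiv ℝ f y = fderiv ℝ h y := fun y hy =>
      (Filter.eventuallyEq_of_mem (hD.mem_nhds hy) e).fderiv_eq
    exact ⟨H.1.congr e, (e x hx).trans H.2.1,
      ih H.2.2.1 fun y hy => by simp only [pd₁, e' y hy],
      ih H.2.2.2 fun y hy => by simp only [pd₂, e' y hy]⟩

theorem add (hD : IsOpen D) (hx : x ∈ D) (H : W.HasSymbolAt x n h q)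
    (F : W.HasSymbolAt x n f r) :
    W.HasSymbolAt x n (fun y => h y + f y) (fun a b => q a b + r a b) := by
  induction n generalizing h f q r with
  | zero => exact ⟨H.1.add F.1, by simp only [H.2, F.2]⟩
  | succ n ih =>
    have e : ∀ y ∈ D, fderiv ℝ (fun y => h y + f y) y = fderiv ℝ h y + fderiv ℝ f y :=
      fun y hy => fderiv_fun_add (differentiableAt_of_contDiffOn hD H.1 hy)
        (differentiableAt_of_contDiffOn hD F.1 hy)
    refine ⟨H.1.add F.1, by simp only [H.2.1, F.2.1, add_zero],
      (ih H.2.2.1 F.2.2.1).congr_on hD hx fun y hy => ?_,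
      (ih H.2.2.2 F.2.2.2).congr_on hD hx fun y hy => ?_⟩
    · simp only [pd₁, e y hy, add_apply]
    · simp only [pd₂, e y hy, add_apply]

theorem weaken (H : W.HasSymbolAt x (n + 1) h q) : W.HasSymbolAt x n h (fun _ _ => 0) := by
  induction n generalizing h q with
  | zero => exact ⟨H.1, H.2.1⟩
  | succ n ih => exact ⟨H.1, H.2.1, ih H.2.2.1, ih H.2.2.2⟩

theorem pd_mul (hD : IsOpen D) (hf : ContDiffOn ℝ ∞ f D) (hh : ContDiffOn ℝ ∞ h D) :
    (∀ y ∈ D, W.pd₁ (fun y => f y * h y) y = W.pd₁ f y * h y + f y * W.pd₁ h y) ∧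
      ∀ y ∈ D, W.pd₂ (fun y => f y * h y) y = W.pd₂ f y * h y + f y * W.pd₂ h y := by
  constructor <;> intro y hy <;>
    simp only [pd₁, pd₂, fderiv_fun_mul (differentiableAt_of_contDiffOn hD hf hy)
      (differentiableAt_of_contDiffOn hD hh hy), add_apply, smul_apply, smul_eq_mul] <;> ring

theorem smooth_mul (hD : IsOpen D) (hx : x ∈ D) (hf : ContDiffOn ℝ ∞ f D)
    (H : W.HasSymbolAt x n h q) :
    W.HasSymbolAt x n (fun y => f y * h y) (fun a b => f x * q a b) := by
  induction n generalizing h f q with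
  | zero => exact ⟨hf.mul H.1, by simp only [H.2]⟩
  | succ n ih =>
    obtain ⟨e₁, e₂⟩ := pd_mul (W := W) hD hf H.1
    refine ⟨hf.mul H.1, by simp only [H.2.1, mul_zero], ?_, ?_⟩
    · exact (((ih (W.contDiffOn_pd₁ hD hf) H.weaken).add hD hx (ih hf H.2.2.1)).congr_on hD hx
        e₁).congr_symbol fun a b _ => by ring
    · exact (((ih (W.contDiffOn_pd₂ hD hf) H.weaken).add hD hx (ih hf H.2.2.2)).congr_on hD hx
        e₂).congr_symbol fun a b _ => by ring

/-- Multiplication by a function that vanishes at `x` multiplies the symbol, read as a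
homogeneous polynomial with divided-power coefficients, by the differential of that function. -/
theorem mul_of_eq_zero (hD : IsOpen D) (hx : x ∈ D) (hf : ContDiffOn ℝ ∞ f D) (hf0 : f x = 0)
    (H : W.HasSymbolAt x n h q) :
    W.HasSymbolAt x (n + 1) (fun y => f y * h y)
      (fun a b => W.pd₁ f x * (a * q (a - 1) b) + W.pd₂ f x * (b * q a (b - 1))) := by
  induction n generalizing h q with
  | zero =>
    obtain ⟨e₁, e₂⟩ := pd_mul (W := W) hD hf H.1
    have hs := hf.mul H.1
    exact ⟨hs, by simp only [hf0, zero_mul],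
      ⟨W.contDiffOn_pd₁ hD hs, by rw [e₁ x hx, H.2, hf0]; simp⟩,
      ⟨W.contDiffOn_pd₂ hD hs, by rw [e₂ x hx, H.2, hf0]; simp⟩⟩
  | succ n ih =>
    obtain ⟨e₁, e₂⟩ := pd_mul (W := W) hD hf H.1
    refine ⟨hf.mul H.1, by simp only [hf0, zero_mul], ?_, ?_⟩
    · refine (((H.smooth_mul hD hx (W.contDiffOn_pd₁ hD hf)).add hD hx (ih H.2.2.1)).congr_on hD hx
        e₁).congr_symbol fun a b _ => ?_
      rcases a with _ | a <;> simp
      ring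
    · refine (((H.smooth_mul hD hx (W.contDiffOn_pd₂ hD hf)).add hD hx (ih H.2.2.2)).congr_on hD hx
        e₂).congr_symbol fun a b _ => ?_
      rcases b with _ | b <;> simp <;> ring

/-- The covariant derivative `δ₁` has the same symbol as `∂₁`, whatever the weight. -/
theorem δ₁ (hD : IsOpen D) (hx : x ∈ D) (w : ℕ) (H : W.HasSymbolAt x (n + 1) h q) :
    W.HasSymbolAt x n (W.δ₁ w h) (fun a b => q (a + 1) b) := by
  have hg : ContDiffOn ℝ ∞ (fun y => -(w * W.g₁ y)) D :=
    (contDiffOn_const.mul (W.contDiffOn_g₁ hD)).neg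
  refine ((H.2.2.1.add hD hx (H.weaken.smooth_mul hD hx hg)).congr_on hD hx
    fun y _ => ?_).congr_symbol fun a b _ => ?_
  · simp only [PlanarWeb.δ₁]; ring
  · ring

/-- The covariant derivative `δ₂` has the same symbol as `∂₂`, whatever the weight. -/
theorem δ₂ (hD : IsOpen D) (hx : x ∈ D) (w : ℕ) (H : W.HasSymbolAt x (n + 1) h q) :
    W.HasSymbolAt x n (W.δ₂ w h) (fun a b => q a (b + 1)) := by
  have hg : ContDiffOn ℝ ∞ (fun y => -(w * W.g₂ y)) D :=
    (contDiffOn_const.mul (W.contDiffOn_g₂ hD)).neg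
  refine ((H.2.2.2.add hD hx (H.weaken.smooth_mul hD hx hg)).congr_on hD hx
    fun y _ => ?_).congr_symbol fun a b _ => ?_
  · simp only [PlanarWeb.δ₂]; ring
  · ring

theorem orderedSum (hD : IsOpen D) (hx : x ∈ D) (w : ℕ) (a b m : ℕ)
    (H : W.HasSymbolAt x (m + a + b) h q) :
    W.HasSymbolAt x m (W.orderedSum w h a b)
      (fun c d => (a + b).choose a * q (c + a) (d + b)) := by
  induction a generalizing b m with
  | zero =>
    induction b generalizing m with
    | zero =>
      simp only [PlanarWeb.orderedSum]
      exact H.congr_symbol fun c d _ => by simp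
    | succ b ih =>
      have h1 := ih (m + 1) (by convert H using 1; ring)
      simp only [PlanarWeb.orderedSum]
      exact (h1.δ₂ hD hx _).congr_symbol fun c d _ => by simp; congr 1; ring
  | succ a iha =>
    induction b generalizing m with
    | zero =>
      have h1 := iha 0 (m + 1) (by convert H using 1; ring)
      simp only [PlanarWeb.orderedSum]
      exact (h1.δ₁ hD hx _).congr_symbol fun c d _ => by simp; congr 1; ring
    | succ b ihb =>
      have h1 := iha (b + 1) (m + 1) (by convert H using 1; ring)
      have h2 := ihb (m + 1) (by convert H using 1; ring)
      simp only [PlanarWeb.orderedSum]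
      refine ((h1.δ₁ hD hx _).add hD hx (h2.δ₂ hD hx _)).congr_symbol fun c d _ => ?_
      rw [show a + 1 + (b + 1) = (a + (b + 1)) + 1 by ring, Nat.choose_succ_succ,
        show a + 1 + b = a + (b + 1) by ring, show c + 1 + a = c + (a + 1) by ring,
        show d + 1 + b = d + (b + 1) by ring]
      push_cast
      ring

theorem sym_eq (hD : IsOpen D) (hx : x ∈ D) (w : ℕ) {a b : ℕ} (hab : a + b = n)
    (H : W.HasSymbolAt x n h q) : W.sym w h a b x = q a b := by
  subst hab
  have h1 := (H.congr_symbol fun _ _ _ => rfl : W.HasSymbolAt x (a + b) h q)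
  have h2 := (HasSymbolAt.orderedSum hD hx w a b 0 (by simpa using h1)).2
  have h3 : ((a + b).choose a : ℝ) ≠ 0 := by
    exact_mod_cast (Nat.choose_pos (Nat.le_add_right a b)).ne'
  rw [sym, h2]
  simp only [zero_add]
  field_simp

theorem sym_eq_zero (hD : IsOpen D) (hx : x ∈ D) (w : ℕ) {a b : ℕ} (hab : a + b < n)
    (H : W.HasSymbolAt x n h q) : W.sym w h a b x = 0 := by
  obtain ⟨m, rfl⟩ : ∃ m, n = (a + b) + (m + 1) := ⟨n - (a + b) - 1, by omega⟩
  have key : ∀ m n q, W.HasSymbolAt x (n + (m + 1)) h q → W.HasSymbolAt x n h fun _ _ => 0 := by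
    intro m
    induction m with
    | zero => exact fun n q H => H.weaken
    | succ m ih => exact fun n q H => ih n _ (H.weaken (n := n + (m + 1)))
  exact (key m _ q H).sym_eq hD hx w rfl

end HasSymbolAt

/-- Every homogeneous symbol is attained: the functions `ωᵢ(x)(y - x)` have differentials dual to
the frame at `x`, and symbols are built up by multiplication by them. -/
theorem exists_hasSymbolAt (W : PlanarWeb D) (hD : IsOpen D) {x : ℝ × ℝ} (hx : x ∈ D) (n : ℕ)
    (q : ℕ → ℕ → ℝ) : ∃ h, W.HasSymbolAt x n h q := by
  have hX : ∀ θ : ℝ × ℝ →L[ℝ] ℝ, ContDiffOn ℝ ∞ (fun y : ℝ × ℝ => θ (y - x)) D ∧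
      θ (x - x) = 0 ∧ W.pd₁ (fun y => θ (y - x)) x = θ (W.frame₁ x) ∧
      W.pd₂ (fun y => θ (y - x)) x = θ (W.frame₂ x) := by
    intro θ
    have hd : HasFDerivAt (fun y : ℝ × ℝ => θ (y - x)) θ x :=
      (θ.hasFDerivAt.comp x ((hasFDerivAt_id x).sub_const x)).congr_fderiv θ.comp_id
    refine ⟨(θ.contDiff.comp (contDiff_id.sub contDiff_const)).contDiffOn, by simp, ?_, ?_⟩ <;>
      simp only [pd₁, pd₂, hd.fderiv]
  obtain ⟨f11, f12, f21, f22⟩ := W.frame_dual hx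
  obtain ⟨s₁, z₁, a₁, b₁⟩ := hX (W.ω₁ x)
  obtain ⟨s₂, z₂, a₂, b₂⟩ := hX (W.ω₂ x)
  -- the pure powers of the second coordinate
  have hpow : ∀ n, ∃ h, W.HasSymbolAt x n h fun a b => if a = 0 then (b.factorial : ℝ) else 0 := by
    intro n
    induction n with
    | zero => exact ⟨fun _ => 1, contDiffOn_const, by simp⟩
    | succ n ih =>
      obtain ⟨h, H⟩ := ih
      refine ⟨_, (H.mul_of_eq_zero hD hx s₂ z₂).congr_symbol fun a b hab => ?_⟩
      rw [a₂, b₂, f21, f22]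
      rcases a with _ | a
      · obtain rfl : b = n + 1 := by omega
        simp [Nat.factorial_succ]
      · simp
  induction n generalizing q with
  | zero => exact ⟨fun _ => q 0 0, contDiffOn_const, rfl⟩
  | succ n ih =>
    obtain ⟨h, H⟩ := ih fun a b => q (a + 1) b / (a + 1)
    obtain ⟨f, F⟩ := hpow (n + 1)
    refine ⟨_, ((H.mul_of_eq_zero hD hx s₁ z₁).add hD hx (F.smooth_mul hD hx (contDiffOn_const
      (c := q 0 (n + 1) / (n + 1).factorial)))).congr_symbol fun a b hab => ?_⟩
    rw [a₁, b₁, f11, f12]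
    rcases a with _ | a
    · obtain rfl : b = n + 1 := by omega
      have : ((n + 1).factorial : ℝ) ≠ 0 := by exact_mod_cast (Nat.factorial_pos _).ne'
      simp [this]
    · have : (a : ℝ) + 1 ≠ 0 := by positivity
      simp
      field_simp

theorem sym_add (W : PlanarWeb D) (hD : IsOpen D) (w : ℕ) {f h : ℝ × ℝ → ℝ}
    (hf : ContDiffOn ℝ ∞ f D) (hh : ContDiffOn ℝ ∞ h D) (a b : ℕ) :
    ∀ x ∈ D, W.sym w (fun y => f y + h y) a b x = W.sym w f a b x + W.sym w h a b x := by
  have key : ∀ x ∈ D, W.orderedSum w (fun y => f y + h y) a b x =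
      W.orderedSum w f a b x + W.orderedSum w h a b x := by
    have step : ∀ (v a b : ℕ), (∀ x ∈ D, W.orderedSum w (fun y => f y + h y) a b x =
        W.orderedSum w f a b x + W.orderedSum w h a b x) → ∀ x ∈ D,
        W.δ₁ v (W.orderedSum w (fun y => f y + h y) a b) x =
          W.δ₁ v (W.orderedSum w f a b) x + W.δ₁ v (W.orderedSum w h a b) x ∧
        W.δ₂ v (W.orderedSum w (fun y => f y + h y) a b) x =
          W.δ₂ v (W.orderedSum w f a b) x + W.δ₂ v (W.orderedSum w h a b) x :=
      fun v a b e x hx => (((W.hasCovAt hD v (W.contDiffOn_orderedSum hD w hf a b) hx).add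
        (W.hasCovAt hD v (W.contDiffOn_orderedSum hD w hh a b) hx)).congr_on hD hx e).2
    induction a generalizing b with
    | zero =>
      induction b with
      | zero => simp [orderedSum]
      | succ b ih =>
        intro x hx
        simp only [orderedSum, (step _ _ _ ih x hx).2]
    | succ a iha =>
      induction b with
      | zero =>
        intro x hx
        simp only [orderedSum, (step _ _ _ (iha 0) x hx).1]
      | succ b ihb =>
        intro x hx
        simp only [orderedSum, (step _ _ _ (iha (b + 1)) x hx).1, (step _ _ _ ihb x hx).2]
        ring
  intro x hx
  simp only [sym, key x hx]
  ring

/-- Every finite jet, given by symmetrized covariant derivatives, is attained by a smooth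
function. -/
theorem exists_sym_eq (W : PlanarWeb D) (hD : IsOpen D) {x : ℝ × ℝ} (hx : x ∈ D) (w N : ℕ)
    (T : ℕ → ℕ → ℝ) : ∃ h : ℝ × ℝ → ℝ, ContDiffOn ℝ ∞ h D ∧
      ∀ a b, a + b ≤ N → W.sym w h a b x = T a b := by
  induction N with
  | zero =>
    refine ⟨fun _ => T 0 0, contDiffOn_const, fun a b hab => ?_⟩
    obtain ⟨rfl, rfl⟩ : a = 0 ∧ b = 0 := by omega
    rw [sym_zero_zero]
  | succ N ih =>
    obtain ⟨f, hf, ef⟩ := ih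
    obtain ⟨h, H⟩ := W.exists_hasSymbolAt hD hx (N + 1) fun a b => T a b - W.sym w f a b x
    refine ⟨_, hf.add H.contDiffOn, fun a b hab => ?_⟩
    rw [W.sym_add hD w hf H.contDiffOn a b x hx]
    rcases Nat.lt_or_ge (a + b) (N + 1) with h1 | h1
    · rw [ef a b (by omega), H.sym_eq_zero hD hx w h1, add_zero]
    · rw [H.sym_eq hD hx w (by omega)]
      ring

/-! ### Total derivatives of the jet coordinates -/

/-- The covariant derivatives of the jet coordinates of a function of weight one, to order three.
Here and below `u a b` and `k a b` stand for the jet coordinates of the function and of the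
curvature with `a` indices `1` and `b` indices `2`. -/
theorem hasCovAt_jet (W : PlanarWeb D) (hD : IsOpen D) {ν : ℝ × ℝ → ℝ}
    (hν : ContDiffOn ℝ ∞ ν D) {x : ℝ × ℝ} (hx : x ∈ D) {u k : ℕ → ℕ → ℝ × ℝ → ℝ}
    (hu : W.sym 1 ν = u) (hk : W.sym 2 W.K = k) :
    W.HasCovAt 1 (u 0 0) (u 1 0 x) (u 0 1 x) x ∧
      W.HasCovAt 2 (u 1 0) (u 2 0 x) (u 1 1 x + 1 / 2 * k 0 0 x * u 0 0 x) x ∧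
      W.HasCovAt 2 (u 0 1) (u 1 1 x - 1 / 2 * k 0 0 x * u 0 0 x) (u 0 2 x) x ∧
      W.HasCovAt 3 (u 2 0) (u 3 0 x)
        (u 2 1 x + 1 / 3 * k 1 0 x * u 0 0 x + 5 / 3 * k 0 0 x * u 1 0 x) x ∧
      W.HasCovAt 3 (u 1 1) (u 2 1 x - 1 / 6 * k 1 0 x * u 0 0 x - 5 / 6 * k 0 0 x * u 1 0 x)
        (u 1 2 x + 1 / 6 * k 0 1 x * u 0 0 x + 5 / 6 * k 0 0 x * u 0 1 x) x ∧
      W.HasCovAt 3 (u 0 2) (u 1 2 x - 1 / 3 * k 0 1 x * u 0 0 x - 5 / 3 * k 0 0 x * u 0 1 x)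
        (u 0 3 x) x ∧
      W.HasCovAt 4 (u 3 0) (u 4 0 x)
        (u 3 1 x + 1 / 4 * k 2 0 x * u 0 0 x + 7 / 2 * k 0 0 x * u 2 0 x +
        3 / 2 * k 1 0 x * u 1 0 x) x ∧
      W.HasCovAt 4 (u 2 1) (u 3 1 x - 1 / 12 * k 2 0 x * u 0 0 x - 7 / 6 * k 0 0 x * u 2 0 x -
        1 / 2 * k 1 0 x * u 1 0 x)
        (u 2 2 x + 1 / 6 * k 1 1 x * u 0 0 x + 7 / 3 * k 0 0 x * u 1 1 x +
        1 / 2 * k 1 0 x * u 0 1 x + 1 / 2 * k 0 1 x * u 1 0 x) x ∧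
      W.HasCovAt 4 (u 1 2) (u 2 2 x - 1 / 6 * k 1 1 x * u 0 0 x - 7 / 3 * k 0 0 x * u 1 1 x -
        1 / 2 * k 1 0 x * u 0 1 x - 1 / 2 * k 0 1 x * u 1 0 x)
        (u 1 3 x + 1 / 12 * k 0 2 x * u 0 0 x + 7 / 6 * k 0 0 x * u 0 2 x +
        1 / 2 * k 0 1 x * u 0 1 x) x ∧
      W.HasCovAt 4 (u 0 3) (u 1 3 x - 1 / 4 * k 0 2 x * u 0 0 x - 7 / 2 * k 0 0 x * u 0 2 x -
        3 / 2 * k 0 1 x * u 0 1 x)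
        (u 0 4 x) x := by
  subst hu hk
  have h0 := W.hasCovAt_sym_zero 1 hD hν hx
  obtain ⟨h10, h01⟩ := W.hasCovAt_sym_one 1 hD hν hx
  obtain ⟨h20, h11, h02⟩ := W.hasCovAt_sym_two 1 hD hν hx
  obtain ⟨h30, h21, h12, h03⟩ := W.hasCovAt_sym_three 1 hD hν hx
  refine ⟨?_, h10.congr_val ?_ ?_, h01.congr_val ?_ ?_, h20.congr_val ?_ ?_, h11.congr_val ?_ ?_,
    h02.congr_val ?_ ?_, h30.congr_val ?_ ?_, h21.congr_val ?_ ?_, h12.congr_val ?_ ?_,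
    h03.congr_val ?_ ?_⟩
  · rwa [sym_zero_zero]
  all_goals
    simp only [sym_zero_zero]
    try ring

/-- The covariant derivatives of the jet coordinates of the curvature, to order three. -/
theorem hasCovAt_curvJet (W : PlanarWeb D) (hD : IsOpen D) {x : ℝ × ℝ} (hx : x ∈ D)
    {k : ℕ → ℕ → ℝ × ℝ → ℝ} (hk : W.sym 2 W.K = k) :
    W.HasCovAt 2 (k 0 0) (k 1 0 x) (k 0 1 x) x ∧
      W.HasCovAt 3 (k 1 0) (k 2 0 x) (k 1 1 x + k 0 0 x ^ 2) x ∧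
      W.HasCovAt 3 (k 0 1) (k 1 1 x - k 0 0 x ^ 2) (k 0 2 x) x ∧
      W.HasCovAt 4 (k 2 0) (k 3 0 x) (k 2 1 x + 10 / 3 * k 1 0 x * k 0 0 x) x ∧
      W.HasCovAt 4 (k 1 1) (k 2 1 x - 5 / 3 * k 1 0 x * k 0 0 x)
        (k 1 2 x + 5 / 3 * k 0 1 x * k 0 0 x) x ∧
      W.HasCovAt 4 (k 0 2) (k 1 2 x - 10 / 3 * k 0 1 x * k 0 0 x) (k 0 3 x) x ∧
      W.HasCovAt 5 (k 3 0) (k 4 0 x)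
        (k 3 1 x + 11 / 2 * k 2 0 x * k 0 0 x + 5 / 2 * k 1 0 x ^ 2) x ∧
      W.HasCovAt 5 (k 2 1) (k 3 1 x - 11 / 6 * k 2 0 x * k 0 0 x - 5 / 6 * k 1 0 x ^ 2)
        (k 2 2 x + 11 / 3 * k 1 1 x * k 0 0 x + 5 / 3 * k 1 0 x * k 0 1 x) x ∧
      W.HasCovAt 5 (k 1 2) (k 2 2 x - 11 / 3 * k 1 1 x * k 0 0 x - 5 / 3 * k 1 0 x * k 0 1 x)
        (k 1 3 x + 11 / 6 * k 0 2 x * k 0 0 x + 5 / 6 * k 0 1 x ^ 2) x ∧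
      W.HasCovAt 5 (k 0 3) (k 1 3 x - 11 / 2 * k 0 2 x * k 0 0 x - 5 / 2 * k 0 1 x ^ 2)
        (k 0 4 x) x := by
  subst hk
  have hK := W.contDiffOn_K hD
  have h0 := W.hasCovAt_sym_zero 2 hD hK hx
  obtain ⟨h10, h01⟩ := W.hasCovAt_sym_one 2 hD hK hx
  obtain ⟨h20, h11, h02⟩ := W.hasCovAt_sym_two 2 hD hK hx
  obtain ⟨h30, h21, h12, h03⟩ := W.hasCovAt_sym_three 2 hD hK hx
  refine ⟨?_, h10.congr_val ?_ ?_, h01.congr_val ?_ ?_, h20.congr_val ?_ ?_, h11.congr_val ?_ ?_,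
    h02.congr_val ?_ ?_, h30.congr_val ?_ ?_, h21.congr_val ?_ ?_, h12.congr_val ?_ ?_,
    h03.congr_val ?_ ?_⟩
  · rwa [sym_zero_zero]
  all_goals
    simp only [sym_zero_zero]
    try ring

/-! ### Prolongation of the equations `I₁ = I₂ = 0` -/

theorem contDiffOn_opI₁ (W : PlanarWeb D) (hD : IsOpen D) {ν : ℝ × ℝ → ℝ}
    (hν : ContDiffOn ℝ ∞ ν D) : ContDiffOn ℝ ∞ (W.opI₁ ν) D := by
  have s := W.contDiffOn_sym hD 1 hν
  have k := W.contDiffOn_sym hD 2 (W.contDiffOn_K hD)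
  exact ((((s 2 0).sub (contDiffOn_const.mul (s 1 1))).sub (hν.mul (s 1 0))).add
    ((contDiffOn_const.mul hν).mul (s 0 1))).add (k 1 0)

theorem contDiffOn_opI₂ (W : PlanarWeb D) (hD : IsOpen D) {ν : ℝ × ℝ → ℝ}
    (hν : ContDiffOn ℝ ∞ ν D) : ContDiffOn ℝ ∞ (W.opI₂ ν) D := by
  have s := W.contDiffOn_sym hD 1 hν
  have k := W.contDiffOn_sym hD 2 (W.contDiffOn_K hD)
  exact ((((s 0 2).sub (contDiffOn_const.mul (s 1 1))).sub
    ((contDiffOn_const.mul hν).mul (s 1 0))).add (hν.mul (s 0 1))).add (k 0 1)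

/-- The first covariant derivatives of `I₁` along the jets of `ν`. -/
theorem hasCovAt_opI₁ (W : PlanarWeb D) (hD : IsOpen D) {ν : ℝ × ℝ → ℝ}
    (hν : ContDiffOn ℝ ∞ ν D) {x : ℝ × ℝ} (hx : x ∈ D) {u k : ℕ → ℕ → ℝ × ℝ → ℝ}
    (hu : W.sym 1 ν = u) (hk : W.sym 2 W.K = k) :
    W.HasCovAt 3 (W.opI₁ ν)
      (u 3 0 x - 2 * u 2 1 x + k 2 0 x - u 2 0 x * u 0 0 x + 2 * u 1 1 x * u 0 0 x +
        1 / 3 * k 1 0 x * u 0 0 x + 5 / 3 * k 0 0 x * u 1 0 x - u 1 0 x ^ 2 +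
        2 * u 1 0 x * u 0 1 x - k 0 0 x * u 0 0 x ^ 2)
      (u 2 1 x - 2 * u 1 2 x + k 1 1 x - u 1 1 x * u 0 0 x + 2 * u 0 2 x * u 0 0 x +
        1 / 3 * k 1 0 x * u 0 0 x - 1 / 3 * k 0 1 x * u 0 0 x +
        5 / 3 * k 0 0 x * u 1 0 x - 5 / 3 * k 0 0 x * u 0 1 x - u 1 0 x * u 0 1 x +
        2 * u 0 1 x ^ 2 - 1 / 2 * k 0 0 x * u 0 0 x ^ 2 + k 0 0 x ^ 2) x := by
  obtain ⟨h00, h10, h01, h20, h11, h02, -⟩ := W.hasCovAt_jet hD hν hx hu hk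
  obtain ⟨k00, k10, k01, -⟩ := W.hasCovAt_curvJet hD hx hk
  refine HasCovAt.congr_val (HasCovAt.congr
    (h20 |>.sub (h11.const_mul 2) |>.add k10 |>.sub (h10.mul h00)
      |>.add ((h01.mul h00).const_mul 2))
    (.of_forall fun y => ?_)) ?_ ?_
  · subst hu hk
    simp only [opI₁, CurvJet.I₁, jet, curvJet, sym_zero_zero]
    ring
  all_goals ring

/-- The second symmetrized covariant derivatives of `I₁` along the jets of `ν`. -/
theorem sym_two_opI₁ (W : PlanarWeb D) (hD : IsOpen D) {ν : ℝ × ℝ → ℝ}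
    (hν : ContDiffOn ℝ ∞ ν D) {x : ℝ × ℝ} (hx : x ∈ D) {u k : ℕ → ℕ → ℝ × ℝ → ℝ}
    (hu : W.sym 1 ν = u) (hk : W.sym 2 W.K = k) :
    W.sym 3 (W.opI₁ ν) 2 0 x =
        u 4 0 x - 2 * u 3 1 x + k 3 0 x - u 3 0 x * u 0 0 x + 2 * u 2 1 x * u 0 0 x +
        1 / 2 * k 2 0 x * u 0 0 x + 4 * k 0 0 x * u 2 0 x - 3 * u 2 0 x * u 1 0 x +
        4 * u 1 1 x * u 1 0 x + 2 * u 2 0 x * u 0 1 x + 3 * k 1 0 x * u 1 0 x -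
        4 / 3 * k 1 0 x * u 0 0 x ^ 2 - 14 / 3 * k 0 0 x * u 1 0 x * u 0 0 x ∧
      W.sym 3 (W.opI₁ ν) 1 1 x =
        u 3 1 x - 2 * u 2 2 x + k 2 1 x - u 2 1 x * u 0 0 x + 2 * u 1 2 x * u 0 0 x +
        1 / 4 * k 2 0 x * u 0 0 x + 2 * k 0 0 x * u 2 0 x + 2 * u 0 2 x * u 1 0 x -
        2 * u 1 1 x * u 1 0 x - u 2 0 x * u 0 1 x + 4 * u 1 1 x * u 0 1 x +
        3 / 2 * k 1 0 x * u 1 0 x - 2 / 3 * k 1 0 x * u 0 1 x -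
        1 / 3 * k 1 0 x * u 0 0 x ^ 2 + 2 / 3 * k 0 1 x * u 1 0 x -
        2 / 3 * k 0 1 x * u 0 0 x ^ 2 + 11 / 6 * k 1 0 x * k 0 0 x -
        7 / 6 * k 0 0 x * u 1 0 x * u 0 0 x - 7 / 3 * k 0 0 x * u 0 1 x * u 0 0 x +
        7 / 6 * k 0 0 x ^ 2 * u 0 0 x ∧
      W.sym 3 (W.opI₁ ν) 0 2 x =
        u 2 2 x - 2 * u 1 3 x + k 1 2 x - u 1 2 x * u 0 0 x + 2 * u 0 3 x * u 0 0 x +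
        1 / 2 * k 1 1 x * u 0 0 x - 1 / 2 * k 0 2 x * u 0 0 x + 4 * k 0 0 x * u 1 1 x -
        4 * k 0 0 x * u 0 2 x - u 0 2 x * u 1 0 x - 2 * u 1 1 x * u 0 1 x +
        6 * u 0 2 x * u 0 1 x + 5 / 6 * k 1 0 x * u 0 1 x + 13 / 6 * k 0 1 x * u 1 0 x -
        3 * k 0 1 x * u 0 1 x - 2 / 3 * k 0 1 x * u 0 0 x ^ 2 +
        11 / 3 * k 0 1 x * k 0 0 x - 7 / 3 * k 0 0 x * u 0 1 x * u 0 0 x +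
        7 / 6 * k 0 0 x ^ 2 * u 0 0 x := by
  obtain ⟨h00, h10, h01, h20, h11, h02, h30, h21, h12, h03⟩ := W.hasCovAt_jet hD hν hx hu hk
  obtain ⟨k00, k10, k01, k20, k11, k02, -⟩ := W.hasCovAt_curvJet hD hx hk
  have hI := W.contDiffOn_opI₁ hD hν
  have e : ∀ y ∈ D, _ ∧ _ := fun y hy => (W.hasCovAt_opI₁ hD hν hy hu hk).2
  have z : ∀ y ∈ D, _ ∧ _ := fun y hy => (W.hasCovAt_sym_zero 3 hD hI hy).2
  obtain ⟨a, b⟩ := W.hasCovAt_sym_one 3 hD hI hx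
  -- `δ₁ I₁` and `δ₂ I₁` are polynomials in the jet coordinates, differentiated by the Leibniz rule
  have A := HasCovAt.congr_on (g := W.sym 3 (W.opI₁ ν) 1 0) hD hx
    (h30 |>.sub (h21.const_mul 2) |>.add k20 |>.sub (h20.mul h00)
      |>.add ((h11.mul h00).const_mul 2) |>.add ((k10.mul h00).const_mul (1 / 3))
      |>.add ((k00.mul h10).const_mul (5 / 3)) |>.sub (h10.mul h10)
      |>.add ((h10.mul h01).const_mul 2) |>.sub ((k00.mul h00).mul h00))
    fun y hy => (((z y hy).1.symm.trans (e y hy).1).trans (by ring))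
  have B := HasCovAt.congr_on (g := W.sym 3 (W.opI₁ ν) 0 1) hD hx
    (h21 |>.sub (h12.const_mul 2) |>.add k11 |>.sub (h11.mul h00)
      |>.add ((h02.mul h00).const_mul 2) |>.add ((k10.mul h00).const_mul (1 / 3))
      |>.sub ((k01.mul h00).const_mul (1 / 3)) |>.add ((k00.mul h10).const_mul (5 / 3))
      |>.sub ((k00.mul h01).const_mul (5 / 3)) |>.sub (h10.mul h01)
      |>.add ((h01.mul h01).const_mul 2) |>.sub (((k00.mul h00).mul h00).const_mul (1 / 2))
      |>.add (k00.mul k00))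
    fun y hy => (((z y hy).2.symm.trans (e y hy).2).trans (by ring))
  refine ⟨a.2.1.symm.trans (A.2.1.trans (by ring)), ?_, b.2.2.symm.trans (B.2.2.trans (by ring))⟩
  have c₁ := a.2.2.symm.trans A.2.2
  have c₂ := b.2.1.symm.trans B.2.1
  linear_combination c₁ / 2 + c₂ / 2

/-- The first covariant derivatives of `I₂` along the jets of `ν`. -/
theorem hasCovAt_opI₂ (W : PlanarWeb D) (hD : IsOpen D) {ν : ℝ × ℝ → ℝ}
    (hν : ContDiffOn ℝ ∞ ν D) {x : ℝ × ℝ} (hx : x ∈ D) {u k : ℕ → ℕ → ℝ × ℝ → ℝ}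
    (hu : W.sym 1 ν = u) (hk : W.sym 2 W.K = k) :
    W.HasCovAt 3 (W.opI₂ ν)
      (-(2 * u 2 1 x) + u 1 2 x + k 1 1 x - 2 * u 2 0 x * u 0 0 x + u 1 1 x * u 0 0 x +
        1 / 3 * k 1 0 x * u 0 0 x - 1 / 3 * k 0 1 x * u 0 0 x +
        5 / 3 * k 0 0 x * u 1 0 x - 5 / 3 * k 0 0 x * u 0 1 x - 2 * u 1 0 x ^ 2 +
        u 1 0 x * u 0 1 x - 1 / 2 * k 0 0 x * u 0 0 x ^ 2 - k 0 0 x ^ 2)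
      (-(2 * u 1 2 x) + u 0 3 x + k 0 2 x - 2 * u 1 1 x * u 0 0 x + u 0 2 x * u 0 0 x -
        1 / 3 * k 0 1 x * u 0 0 x - 5 / 3 * k 0 0 x * u 0 1 x - 2 * u 1 0 x * u 0 1 x +
        u 0 1 x ^ 2 - k 0 0 x * u 0 0 x ^ 2) x := by
  obtain ⟨h00, h10, h01, h20, h11, h02, -⟩ := W.hasCovAt_jet hD hν hx hu hk
  obtain ⟨k00, k10, k01, -⟩ := W.hasCovAt_curvJet hD hx hk
  refine HasCovAt.congr_val (HasCovAt.congr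
    ((h11.const_mul 2).const_mul (-1) |>.add h02 |>.add k01 |>.sub ((h10.mul h00).const_mul 2)
      |>.add (h01.mul h00))
    (.of_forall fun y => ?_)) ?_ ?_
  · subst hu hk
    simp only [opI₂, CurvJet.I₂, jet, curvJet, sym_zero_zero]
    ring
  all_goals ring

/-- The second symmetrized covariant derivatives of `I₂` along the jets of `ν`. -/
theorem sym_two_opI₂ (W : PlanarWeb D) (hD : IsOpen D) {ν : ℝ × ℝ → ℝ}
    (hν : ContDiffOn ℝ ∞ ν D) {x : ℝ × ℝ} (hx : x ∈ D) {u k : ℕ → ℕ → ℝ × ℝ → ℝ}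
    (hu : W.sym 1 ν = u) (hk : W.sym 2 W.K = k) :
    W.sym 3 (W.opI₂ ν) 2 0 x =
        -(2 * u 3 1 x) + u 2 2 x + k 2 1 x - 2 * u 3 0 x * u 0 0 x + u 2 1 x * u 0 0 x +
        1 / 2 * k 2 0 x * u 0 0 x - 1 / 2 * k 1 1 x * u 0 0 x + 4 * k 0 0 x * u 2 0 x -
        4 * k 0 0 x * u 1 1 x - 6 * u 2 0 x * u 1 0 x + 2 * u 1 1 x * u 1 0 x +
        u 2 0 x * u 0 1 x + 3 * k 1 0 x * u 1 0 x - 13 / 6 * k 1 0 x * u 0 1 x -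
        2 / 3 * k 1 0 x * u 0 0 x ^ 2 - 5 / 6 * k 0 1 x * u 1 0 x -
        11 / 3 * k 1 0 x * k 0 0 x - 7 / 3 * k 0 0 x * u 1 0 x * u 0 0 x +
        7 / 6 * k 0 0 x ^ 2 * u 0 0 x ∧
      W.sym 3 (W.opI₂ ν) 1 1 x =
        -(2 * u 2 2 x) + u 1 3 x + k 1 2 x - 2 * u 2 1 x * u 0 0 x + u 1 2 x * u 0 0 x -
        1 / 4 * k 0 2 x * u 0 0 x - 2 * k 0 0 x * u 0 2 x + u 0 2 x * u 1 0 x -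
        4 * u 1 1 x * u 1 0 x - 2 * u 2 0 x * u 0 1 x + 2 * u 1 1 x * u 0 1 x -
        2 / 3 * k 1 0 x * u 0 1 x - 2 / 3 * k 1 0 x * u 0 0 x ^ 2 +
        2 / 3 * k 0 1 x * u 1 0 x - 3 / 2 * k 0 1 x * u 0 1 x -
        1 / 3 * k 0 1 x * u 0 0 x ^ 2 - 11 / 6 * k 0 1 x * k 0 0 x -
        7 / 3 * k 0 0 x * u 1 0 x * u 0 0 x - 7 / 6 * k 0 0 x * u 0 1 x * u 0 0 x +
        7 / 6 * k 0 0 x ^ 2 * u 0 0 x ∧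
      W.sym 3 (W.opI₂ ν) 0 2 x =
        -(2 * u 1 3 x) + u 0 4 x + k 0 3 x - 2 * u 1 2 x * u 0 0 x + u 0 3 x * u 0 0 x -
        1 / 2 * k 0 2 x * u 0 0 x - 4 * k 0 0 x * u 0 2 x - 2 * u 0 2 x * u 1 0 x -
        4 * u 1 1 x * u 0 1 x + 3 * u 0 2 x * u 0 1 x - 3 * k 0 1 x * u 0 1 x -
        4 / 3 * k 0 1 x * u 0 0 x ^ 2 - 14 / 3 * k 0 0 x * u 0 1 x * u 0 0 x := by
  obtain ⟨h00, h10, h01, h20, h11, h02, h30, h21, h12, h03⟩ := W.hasCovAt_jet hD hν hx hu hk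
  obtain ⟨k00, k10, k01, k20, k11, k02, -⟩ := W.hasCovAt_curvJet hD hx hk
  have hI := W.contDiffOn_opI₂ hD hν
  have e : ∀ y ∈ D, _ ∧ _ := fun y hy => (W.hasCovAt_opI₂ hD hν hy hu hk).2
  have z : ∀ y ∈ D, _ ∧ _ := fun y hy => (W.hasCovAt_sym_zero 3 hD hI hy).2
  obtain ⟨a, b⟩ := W.hasCovAt_sym_one 3 hD hI hx
  have A := HasCovAt.congr_on (g := W.sym 3 (W.opI₂ ν) 1 0) hD hx
    ((h21.const_mul 2).const_mul (-1) |>.add h12 |>.add k11 |>.sub ((h20.mul h00).const_mul 2)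
      |>.add (h11.mul h00) |>.add ((k10.mul h00).const_mul (1 / 3))
      |>.sub ((k01.mul h00).const_mul (1 / 3)) |>.add ((k00.mul h10).const_mul (5 / 3))
      |>.sub ((k00.mul h01).const_mul (5 / 3)) |>.sub ((h10.mul h10).const_mul 2)
      |>.add (h10.mul h01) |>.sub (((k00.mul h00).mul h00).const_mul (1 / 2)) |>.sub (k00.mul k00))
    fun y hy => (((z y hy).1.symm.trans (e y hy).1).trans (by ring))
  have B := HasCovAt.congr_on (g := W.sym 3 (W.opI₂ ν) 0 1) hD hx
    ((h12.const_mul 2).const_mul (-1) |>.add h03 |>.add k02 |>.sub ((h11.mul h00).const_mul 2)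
      |>.add (h02.mul h00) |>.sub ((k01.mul h00).const_mul (1 / 3))
      |>.sub ((k00.mul h01).const_mul (5 / 3)) |>.sub ((h10.mul h01).const_mul 2)
      |>.add (h01.mul h01) |>.sub ((k00.mul h00).mul h00))
    fun y hy => (((z y hy).2.symm.trans (e y hy).2).trans (by ring))
  refine ⟨a.2.1.symm.trans (A.2.1.trans (by ring)), ?_, b.2.2.symm.trans (B.2.2.trans (by ring))⟩
  have c₁ := a.2.2.symm.trans A.2.2
  have c₂ := b.2.1.symm.trans B.2.1
  linear_combination c₁ / 2 + c₂ / 2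

/-! ### Vanishing to finite order -/

theorem vanishesToOrder_one_iff (W : PlanarWeb D) (w : ℕ) (h : ℝ × ℝ → ℝ) (x : ℝ × ℝ) :
    W.VanishesToOrder w h 1 x ↔ h x = 0 ∧ W.sym w h 1 0 x = 0 ∧ W.sym w h 0 1 x = 0 := by
  constructor
  · intro H
    exact ⟨by simpa only [sym_zero_zero] using H 0 0 (by simp), H 1 0 (by simp), H 0 1 (by simp)⟩
  · rintro ⟨h0, h1, h2⟩ a b hab
    rcases a with _ | _ | a
    · rcases b with _ | _ | b
      · rwa [sym_zero_zero]
      · exact h2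
      · omega
    · obtain rfl : b = 0 := by omega
      exact h1
    · omega

theorem vanishesToOrder_two_iff (W : PlanarWeb D) (w : ℕ) (h : ℝ × ℝ → ℝ) (x : ℝ × ℝ) :
    W.VanishesToOrder w h 2 x ↔ W.VanishesToOrder w h 1 x ∧
      W.sym w h 2 0 x = 0 ∧ W.sym w h 1 1 x = 0 ∧ W.sym w h 0 2 x = 0 := by
  constructor
  · intro H
    exact ⟨fun a b hab => H a b (by omega), H 2 0 (by simp), H 1 1 (by simp), H 0 2 (by simp)⟩
  · rintro ⟨H, h1, h2, h3⟩ a b hab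
    rcases Nat.lt_or_ge (a + b) 2 with hlt | hge
    · exact H a b (by omega)
    · obtain ⟨rfl, rfl⟩ | ⟨rfl, rfl⟩ | ⟨rfl, rfl⟩ :
        (a = 2 ∧ b = 0) ∨ (a = 1 ∧ b = 1) ∨ (a = 0 ∧ b = 2) := by omega
      exacts [h1, h2, h3]

theorem vanishesToOrder_of_eq_zero (W : PlanarWeb D) (hD : IsOpen D) (w : ℕ) {h : ℝ × ℝ → ℝ}
    (h0 : ∀ y ∈ D, h y = 0) (n : ℕ) {x : ℝ × ℝ} (hx : x ∈ D) : W.VanishesToOrder w h n x := by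
  have step : ∀ (v : ℕ) (f : ℝ × ℝ → ℝ), (∀ y ∈ D, f y = 0) →
      ∀ y ∈ D, W.δ₁ v f y = 0 ∧ W.δ₂ v f y = 0 := by
    intro v f hf y hy
    have e : f =ᶠ[nhds y] fun _ => 0 := Filter.eventuallyEq_of_mem (hD.mem_nhds hy) hf
    simp [δ₁, δ₂, pd₁, pd₂, e.fderiv_eq, hf y hy]
  have key : ∀ a b, ∀ y ∈ D, W.orderedSum w h a b y = 0 := by
    intro a
    induction a with
    | zero =>
      intro b
      induction b with
      | zero => simpa only [orderedSum] using h0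
      | succ b ih => intro y hy; simp only [orderedSum, (step _ _ ih y hy).2]
    | succ a iha =>
      intro b
      induction b with
      | zero => intro y hy; simp only [orderedSum, (step _ _ (iha 0) y hy).1]
      | succ b ihb =>
        intro y hy
        simp only [orderedSum, (step _ _ (iha (b + 1)) y hy).1, (step _ _ ihb y hy).2, add_zero]
  intro a b _
  simp only [sym, key a b x hx, zero_div]

/-! ### The Mayer bracket of `I₁` and `I₂` -/

theorem opMayer_eq (W : PlanarWeb D) (ν : ℝ × ℝ → ℝ) (x : ℝ × ℝ) :
    W.opMayer ν x = W.sym 3 (W.opI₂ ν) 2 0 x - 2 * W.sym 3 (W.opI₂ ν) 1 1 x -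
      (W.sym 3 (W.opI₁ ν) 0 2 x - 2 * W.sym 3 (W.opI₁ ν) 1 1 x) := by
  have e₁ : W.opI₁ ν = fun y => (W.curvJet y).I₁ (W.jet ν y) := rfl
  have e₂ : W.opI₂ ν = fun y => (W.curvJet y).I₂ (W.jet ν y) := rfl
  simp only [opMayer, mayerBracket, ← e₁, ← e₂]
  simp [CurvJet.I₁, CurvJet.I₂, sub_eq_add_neg]
  ring

/-- The reduction of the Mayer bracket: `[I₁, I₂] - I₁₂` is a combination of `I₁`, `I₂` and
their first covariant derivatives. -/
theorem opMayer_sub (W : PlanarWeb D) (hD : IsOpen D) {ν : ℝ × ℝ → ℝ}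
    (hν : ContDiffOn ℝ ∞ ν D) {x : ℝ × ℝ} (hx : x ∈ D) :
    W.opMayer ν x - (W.curvJet x).I₁₂ (W.jet ν x) =
      ν x * (-2 * W.sym 3 (W.opI₁ ν) 1 0 x + W.sym 3 (W.opI₁ ν) 0 1 x +
        W.sym 3 (W.opI₂ ν) 1 0 x - 2 * W.sym 3 (W.opI₂ ν) 0 1 x) +
      (8 * W.K x - 6 * W.sym 1 ν 1 0 x + 3 * W.sym 1 ν 0 1 x) * W.opI₁ ν x +
      (8 * W.K x + 3 * W.sym 1 ν 1 0 x - 6 * W.sym 1 ν 0 1 x) * W.opI₂ ν x := by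
  obtain ⟨a₁, b₁⟩ := (W.hasCovAt_sym_zero 3 hD (W.contDiffOn_opI₁ hD hν) hx).2
  obtain ⟨a₂, b₂⟩ := (W.hasCovAt_sym_zero 3 hD (W.contDiffOn_opI₂ hD hν) hx).2
  obtain ⟨c₁, d₁⟩ := (W.hasCovAt_opI₁ hD hν hx rfl rfl).2
  obtain ⟨c₂, d₂⟩ := (W.hasCovAt_opI₂ hD hν hx rfl rfl).2
  obtain ⟨-, s₁, s₂⟩ := W.sym_two_opI₁ hD hν hx rfl rfl
  obtain ⟨t₁, t₂, -⟩ := W.sym_two_opI₂ hD hν hx rfl rfl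
  rw [opMayer_eq, ← a₁, ← b₁, ← a₂, ← b₂, c₁, d₁, c₂, d₂, s₁, s₂, t₁, t₂]
  simp only [opI₁, opI₂, CurvJet.I₁, CurvJet.I₂, CurvJet.I₁₂, jet, curvJet, sym_zero_zero]
  ring

theorem opMayer_eq_I₁₂ (W : PlanarWeb D) (hD : IsOpen D) {ν : ℝ × ℝ → ℝ}
    (hν : ContDiffOn ℝ ∞ ν D) {x : ℝ × ℝ} (hx : x ∈ D) (H : W.SolvesIToOrder ν 1 x) :
    W.opMayer ν x = (W.curvJet x).I₁₂ (W.jet ν x) := by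
  have h := W.opMayer_sub hD hν hx
  obtain ⟨H₁, H₂⟩ := H
  rw [vanishesToOrder_one_iff] at H₁ H₂
  rw [H₁.1, H₁.2.1, H₁.2.2, H₂.1, H₂.2.1, H₂.2.2] at h
  linarith

theorem I₁₂_eq_zero_of_solvesIToOrder_two (W : PlanarWeb D) (hD : IsOpen D) {ν : ℝ × ℝ → ℝ}
    (hν : ContDiffOn ℝ ∞ ν D) {x : ℝ × ℝ} (hx : x ∈ D) (H : W.SolvesIToOrder ν 2 x) :
    W.opMayer ν x = 0 ∧ (W.curvJet x).I₁₂ (W.jet ν x) = 0 := by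
  obtain ⟨H₁, H₂⟩ := H
  rw [vanishesToOrder_two_iff] at H₁ H₂
  have h0 : W.opMayer ν x = 0 := by
    rw [opMayer_eq, H₁.2.2.1, H₁.2.2.2, H₂.2.1, H₂.2.2.1]
    ring
  exact ⟨h0, by rw [← W.opMayer_eq_I₁₂ hD hν hx ⟨H₁.1, H₂.1⟩, h0]⟩

/-! ### Formal solvability of `I₁ = I₂ = 0` -/

theorem jet_eq_of_sym (W : PlanarWeb D) {ν : ℝ × ℝ → ℝ} {x : ℝ × ℝ} {T : ℕ → ℕ → ℝ}
    (h : ∀ a b, a + b ≤ 2 → W.sym 1 ν a b x = T a b) :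
    W.jet ν x = ⟨T 0 0, T 1 0, T 0 1, T 2 0, T 1 1, T 0 2⟩ := by
  have h00 := h 0 0 (by simp)
  rw [sym_zero_zero] at h00
  simp only [jet, h00, h 1 0 (by simp), h 0 1 (by simp), h 2 0 (by simp), h 1 1 (by simp),
    h 0 2 (by simp)]

/-- A two-jet annihilated by `I₁` and `I₂` extends to a three-jet all of whose representatives
satisfy `I₁ = I₂ = 0` to first order: the four equations `δᵢ Iⱼ = 0` determine the four third
derivatives. -/
theorem exists_threeJet (W : PlanarWeb D) (hD : IsOpen D) {x : ℝ × ℝ} (hx : x ∈ D) {j : Jet2}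
    (h₁ : (W.curvJet x).I₁ j = 0) (h₂ : (W.curvJet x).I₂ j = 0) :
    ∃ T : ℕ → ℕ → ℝ, ∀ ν : ℝ × ℝ → ℝ, ContDiffOn ℝ ∞ ν D →
      (∀ a b, a + b ≤ 3 → W.sym 1 ν a b x = T a b) →
      W.jet ν x = j ∧ W.SolvesIToOrder ν 1 x := by
  -- the lower order terms of `δᵢ Iⱼ` are read off from a function with vanishing third derivatives
  obtain ⟨ν₀, s₀, e₀⟩ := W.exists_sym_eq hD hx 1 3 fun a b => match a, b with
    | 0, 0 => j.u | 1, 0 => j.p₁ | 0, 1 => j.p₂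
    | 2, 0 => j.p₁₁ | 1, 1 => j.p₁₂ | 0, 2 => j.p₂₂
    | _, _ => 0
  obtain ⟨A, hA⟩ : ∃ A, A = W.δ₁ 3 (W.opI₁ ν₀) x := ⟨_, rfl⟩
  obtain ⟨B, hB⟩ : ∃ B, B = W.δ₂ 3 (W.opI₁ ν₀) x := ⟨_, rfl⟩
  obtain ⟨C, hC⟩ : ∃ C, C = W.δ₁ 3 (W.opI₂ ν₀) x := ⟨_, rfl⟩
  obtain ⟨E, hE⟩ : ∃ E, E = W.δ₂ 3 (W.opI₂ ν₀) x := ⟨_, rfl⟩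
  rw [(W.hasCovAt_opI₁ hD s₀ hx rfl rfl).2.1] at hA
  rw [(W.hasCovAt_opI₁ hD s₀ hx rfl rfl).2.2] at hB
  rw [(W.hasCovAt_opI₂ hD s₀ hx rfl rfl).2.1] at hC
  rw [(W.hasCovAt_opI₂ hD s₀ hx rfl rfl).2.2] at hE
  simp only [e₀ 0 0 (by simp), e₀ 1 0 (by simp), e₀ 0 1 (by simp), e₀ 2 0 (by simp),
    e₀ 1 1 (by simp), e₀ 0 2 (by simp), e₀ 3 0 (by simp), e₀ 2 1 (by simp), e₀ 1 2 (by simp),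
    e₀ 0 3 (by simp)] at hA hB hC hE
  -- the solution of `δ₂ I₁ = δ₁ I₂ = 0` for the mixed third derivatives, then of the other two
  refine ⟨fun a b => match a, b with
    | 0, 0 => j.u | 1, 0 => j.p₁ | 0, 1 => j.p₂
    | 2, 0 => j.p₁₁ | 1, 1 => j.p₁₂ | 0, 2 => j.p₂₂
    | 3, 0 => 2 * ((B + 2 * C) / 3) - A | 2, 1 => (B + 2 * C) / 3
    | 1, 2 => (2 * B + C) / 3 | 0, 3 => 2 * ((2 * B + C) / 3) - E
    | _, _ => 0, fun ν s e => ?_⟩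
  have hj : W.jet ν x = j := W.jet_eq_of_sym fun a b hab => e a b (by omega)
  refine ⟨hj, ?_, ?_⟩ <;> rw [vanishesToOrder_one_iff]
  · refine ⟨by rw [opI₁, hj, h₁], ?_, ?_⟩
    · rw [← (W.hasCovAt_sym_zero 3 hD (W.contDiffOn_opI₁ hD s) hx).2.1,
        (W.hasCovAt_opI₁ hD s hx rfl rfl).2.1]
      simp only [e 0 0 (by simp), e 1 0 (by simp), e 0 1 (by simp), e 2 0 (by simp),
        e 1 1 (by simp), e 3 0 (by simp), e 2 1 (by simp)]
      linear_combination -hA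
    · rw [← (W.hasCovAt_sym_zero 3 hD (W.contDiffOn_opI₁ hD s) hx).2.2,
        (W.hasCovAt_opI₁ hD s hx rfl rfl).2.2]
      simp only [e 0 0 (by simp), e 1 0 (by simp), e 0 1 (by simp), e 1 1 (by simp),
        e 0 2 (by simp), e 2 1 (by simp), e 1 2 (by simp)]
      linear_combination -hB
  · refine ⟨by rw [opI₂, hj, h₂], ?_, ?_⟩
    · rw [← (W.hasCovAt_sym_zero 3 hD (W.contDiffOn_opI₂ hD s) hx).2.1,
        (W.hasCovAt_opI₂ hD s hx rfl rfl).2.1]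
      simp only [e 0 0 (by simp), e 1 0 (by simp), e 0 1 (by simp), e 2 0 (by simp),
        e 1 1 (by simp), e 2 1 (by simp), e 1 2 (by simp)]
      linear_combination -hC
    · rw [← (W.hasCovAt_sym_zero 3 hD (W.contDiffOn_opI₂ hD s) hx).2.2,
        (W.hasCovAt_opI₂ hD s hx rfl rfl).2.2]
      simp only [e 0 0 (by simp), e 1 0 (by simp), e 0 1 (by simp), e 1 1 (by simp),
        e 0 2 (by simp), e 1 2 (by simp), e 0 3 (by simp)]
      linear_combination -hE

theorem exists_solvesIToOrder_one (W : PlanarWeb D) (hD : IsOpen D) {x : ℝ × ℝ} (hx : x ∈ D)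
    (j : Jet2) :
    (∃ ν : ℝ × ℝ → ℝ, ContDiffOn ℝ ∞ ν D ∧ W.jet ν x = j ∧ W.SolvesIToOrder ν 1 x) ↔
      (W.curvJet x).I₁ j = 0 ∧ (W.curvJet x).I₂ j = 0 := by
  constructor
  · rintro ⟨ν, -, rfl, H₁, H₂⟩
    exact ⟨((W.vanishesToOrder_one_iff 3 _ x).1 H₁).1, ((W.vanishesToOrder_one_iff 3 _ x).1 H₂).1⟩
  · rintro ⟨h₁, h₂⟩
    obtain ⟨T, hT⟩ := W.exists_threeJet hD hx h₁ h₂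
    obtain ⟨ν, s, e⟩ := W.exists_sym_eq hD hx 1 3 T
    exact ⟨ν, s, hT ν s e⟩

/-- The six second-order equations involve five fourth derivatives; their single linear relation
is the Mayer bracket, so that `I₁₂ = 0` is the only obstruction. -/
theorem exists_solvesIToOrder_two (W : PlanarWeb D) (hD : IsOpen D) {x : ℝ × ℝ} (hx : x ∈ D)
    (j : Jet2) :
    (∃ ν : ℝ × ℝ → ℝ, ContDiffOn ℝ ∞ ν D ∧ W.jet ν x = j ∧ W.SolvesIToOrder ν 2 x) ↔
      (W.curvJet x).I₁ j = 0 ∧ (W.curvJet x).I₂ j = 0 ∧ (W.curvJet x).I₁₂ j = 0 := by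
  constructor
  · rintro ⟨ν, s, rfl, H⟩
    have h := (W.I₁₂_eq_zero_of_solvesIToOrder_two hD s hx H).2
    obtain ⟨H₁, H₂⟩ := H
    rw [vanishesToOrder_two_iff, vanishesToOrder_one_iff] at H₁ H₂
    exact ⟨H₁.1.1, H₂.1.1, h⟩
  · rintro ⟨h₁, h₂, h₃⟩
    obtain ⟨T, hT⟩ := W.exists_threeJet hD hx h₁ h₂
    obtain ⟨ν₀, s₀, e₀⟩ := W.exists_sym_eq hD hx 1 4 fun a b => if a + b = 4 then 0 else T a b
    obtain ⟨j₀, H₀⟩ := hT ν₀ s₀ fun a b hab => by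
      rw [e₀ a b (by omega), if_neg (by omega)]
    have hM := W.opMayer_eq_I₁₂ hD s₀ hx H₀
    rw [j₀, h₃, opMayer_eq] at hM
    -- the values of the six second-order equations on a jet with vanishing fourth derivatives
    obtain ⟨R₁, r₁⟩ : ∃ R, R = W.sym 3 (W.opI₁ ν₀) 2 0 x := ⟨_, rfl⟩
    obtain ⟨R₂, r₂⟩ : ∃ R, R = W.sym 3 (W.opI₁ ν₀) 1 1 x := ⟨_, rfl⟩
    obtain ⟨R₃, r₃⟩ : ∃ R, R = W.sym 3 (W.opI₁ ν₀) 0 2 x := ⟨_, rfl⟩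
    obtain ⟨R₄, r₄⟩ : ∃ R, R = W.sym 3 (W.opI₂ ν₀) 2 0 x := ⟨_, rfl⟩
    obtain ⟨R₅, r₅⟩ : ∃ R, R = W.sym 3 (W.opI₂ ν₀) 1 1 x := ⟨_, rfl⟩
    obtain ⟨R₆, r₆⟩ : ∃ R, R = W.sym 3 (W.opI₂ ν₀) 0 2 x := ⟨_, rfl⟩
    rw [← r₂, ← r₃, ← r₄, ← r₅] at hM
    obtain ⟨a₁, a₂, a₃⟩ := W.sym_two_opI₁ hD s₀ hx rfl rfl
    obtain ⟨a₄, a₅, a₆⟩ := W.sym_two_opI₂ hD s₀ hx rfl rfl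
    rw [a₁] at r₁; rw [a₂] at r₂; rw [a₃] at r₃; rw [a₄] at r₄; rw [a₅] at r₅; rw [a₆] at r₆
    simp [e₀] at r₁ r₂ r₃ r₄ r₅ r₆
    -- `c` is chosen to make `δ₁₁ I₂` vanish; the four equations other than `δ₁₁ I₂ = δ₂₂ I₁ = 0`
    -- determine the remaining fourth derivatives, and `δ₂₂ I₁ = 0` follows from the bracket
    obtain ⟨c, hc⟩ : ∃ c, c = (2 * R₂ + R₄) / 3 := ⟨_, rfl⟩
    obtain ⟨ν, s, e⟩ := W.exists_sym_eq hD hx 1 4 fun a b => match a, b with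
      | 4, 0 => 2 * (2 * c - R₂) - R₁ | 3, 1 => 2 * c - R₂ | 2, 2 => c
      | 1, 3 => 2 * c - R₅ | 0, 4 => 2 * (2 * c - R₅) - R₆
      | a, b => T a b
    have e' : ∀ a b, a + b ≤ 3 → W.sym 1 ν a b x = T a b := by
      intro a b hab
      rw [e a b (by omega)]
      split <;> first | rfl | omega
    obtain ⟨hj, H₁, H₂⟩ := hT ν s e'
    have e40 := e 4 0 (by simp)
    have e31 := e 3 1 (by simp)
    have e22 := e 2 2 (by simp)
    have e13 := e 1 3 (by simp)
    have e04 := e 0 4 (by simp)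
    simp only at e40 e31 e22 e13 e04
    obtain ⟨b₁, b₂, b₃⟩ := W.sym_two_opI₁ hD s hx rfl rfl
    obtain ⟨b₄, b₅, b₆⟩ := W.sym_two_opI₂ hD s hx rfl rfl
    refine ⟨ν, s, hj, (W.vanishesToOrder_two_iff 3 _ x).2 ⟨H₁, ?_, ?_, ?_⟩,
      (W.vanishesToOrder_two_iff 3 _ x).2 ⟨H₂, ?_, ?_, ?_⟩⟩
    · rw [b₁]; simp [e', e40, e31]; linear_combination -r₁
    · rw [b₂]; simp [e', e31, e22]; linear_combination -r₂
    · rw [b₃]; simp [e', e22, e13]; linear_combination -r₃ - hM - 3 * hc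
    · rw [b₄]; simp [e', e31, e22]; linear_combination -r₄ - 3 * hc
    · rw [b₅]; simp [e', e22, e13]; linear_combination -r₅
    · rw [b₆]; simp [e', e13, e04]; linear_combination -r₆

/-! ### The equivalent system `p_{ij} = P_{ij}` -/

theorem PSystem_iff (c : CurvJet) (hc : c.k ≠ 0) (j : Jet2) :
    (c.I₁ j = 0 ∧ c.I₂ j = 0 ∧ c.I₁₂ j = 0) ↔ c.PSystem j := by
  have h12 : (12 : ℝ) * c.k ≠ 0 := by positivity
  have h24 : (24 : ℝ) * c.k ≠ 0 := by positivity
  simp only [CurvJet.PSystem, CurvJet.P₁₁, CurvJet.P₁₂, CurvJet.P₂₂, CurvJet.I₁, CurvJet.I₂,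
    CurvJet.I₁₂]
  rw [eq_div_iff h12, eq_div_iff h24, eq_div_iff h12]
  constructor
  · rintro ⟨h₁, h₂, h₃⟩
    refine ⟨?_, ?_, ?_⟩
    · linear_combination 12 * c.k * h₁ + h₃
    · linear_combination h₃
    · linear_combination 12 * c.k * h₂ + h₃
  · rintro ⟨h₁, h₂, h₃⟩
    refine ⟨mul_left_cancel₀ h12 ?_, mul_left_cancel₀ h12 ?_, ?_⟩
    · linear_combination h₁ - h₂
    · linear_combination h₃ - h₂
    · linear_combination h₂

theorem solutions_iff_PSystem (W : PlanarWeb D) (hD : IsOpen D) (hK : ∀ x ∈ D, W.K x ≠ 0)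
    {μ : ℝ × ℝ → ℝ} (hμ : ContDiffOn ℝ ∞ μ D) :
    (∀ x ∈ D, W.opI₁ μ x = 0 ∧ W.opI₂ μ x = 0) ↔
      ∀ x ∈ D, (W.curvJet x).PSystem (W.jet μ x) := by
  constructor
  · intro H x hx
    have h := (W.I₁₂_eq_zero_of_solvesIToOrder_two hD hμ hx
      ⟨W.vanishesToOrder_of_eq_zero hD 3 (fun y hy => (H y hy).1) 2 hx,
        W.vanishesToOrder_of_eq_zero hD 3 (fun y hy => (H y hy).2) 2 hx⟩).2
    exact (PSystem_iff _ (hK x hx) _).1 ⟨(H x hx).1, (H x hx).2, h⟩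
  · intro H x hx
    have h := (PSystem_iff _ (hK x hx) _).2 (H x hx)
    exact ⟨h.1, h.2.1⟩

/-! ### Compatibility of the system `p_{ij} = P_{ij}` -/

/-- The quotient rule; weights are subtracted. -/
theorem HasCovAt.div {W : PlanarWeb D} {w v : ℕ} {f g : ℝ × ℝ → ℝ} {a b c d : ℝ} {x : ℝ × ℝ}
    (hf : W.HasCovAt (w + v) f a b x) (hg : W.HasCovAt v g c d x) (h0 : g x ≠ 0) :
    W.HasCovAt w (fun y => f y / g y) ((a - c * (f x / g x)) / g x)
      ((b - d * (f x / g x)) / g x) x := by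
  have hq : DifferentiableAt ℝ (fun y => f y / g y) x := by
    simpa only [div_eq_mul_inv] using hf.1.fun_mul (hg.1.fun_inv h0)
  have H := HasCovAt.mul (⟨hq, rfl, rfl⟩ : W.HasCovAt w _ _ _ x) hg
  have H' := H.congr (g := f) ((hg.1.continuousAt.eventually_ne h0).mono fun y hy =>
    (div_mul_cancel₀ _ hy).symm)
  refine ⟨hq, ?_, ?_⟩
  · rw [eq_div_iff h0]
    linear_combination -hf.2.1.symm.trans H'.2.1
  · rw [eq_div_iff h0]
    linear_combination -hf.2.2.symm.trans H'.2.2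

theorem δ₁_eq_sym (W : PlanarWeb D) (w : ℕ) (h : ℝ × ℝ → ℝ) : W.δ₁ w h = W.sym w h 1 0 := by
  rw [sym_succ_zero, sym_zero_zero, add_zero]

theorem δ₂_eq_sym (W : PlanarWeb D) (w : ℕ) (h : ℝ × ℝ → ℝ) : W.δ₂ w h = W.sym w h 0 1 := by
  rw [sym_zero_succ, sym_zero_zero, add_zero]

/-- The first covariant derivatives of `P₁₁` along the jets of `ν`. The quotient rule leaves the
value of `P₁₁` itself in the numerators. -/
theorem hasCovAt_opP₁₁ (W : PlanarWeb D) (hD : IsOpen D) {ν : ℝ × ℝ → ℝ}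
    (hν : ContDiffOn ℝ ∞ ν D) {x : ℝ × ℝ} (hx : x ∈ D) (hK : W.K x ≠ 0)
    {u k : ℕ → ℕ → ℝ × ℝ → ℝ} (hu : W.sym 1 ν = u) (hk : W.sym 2 W.K = k) :
    W.HasCovAt 3 (W.opP₁₁ ν)
      ((-(3 * k 3 1 x) + 3 * k 2 2 x - 3 * k 3 0 x * u 0 0 x + 3 * k 2 1 x * u 0 0 x -
        3 * k 1 2 x * u 0 0 x - 15 * k 2 0 x * u 1 0 x + 6 * k 2 0 x * u 0 1 x +
        9 * k 1 1 x * u 1 0 x - 12 * k 1 1 x * u 0 1 x - 3 * k 0 2 x * u 1 0 x -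
        12 * k 1 0 x * u 2 0 x + 6 * k 1 0 x * u 1 1 x + 6 * k 0 1 x * u 2 0 x -
        12 * k 0 1 x * u 1 1 x + 3 / 2 * k 2 0 x * k 0 0 x - 3 * k 1 1 x * k 0 0 x -
        12 * k 0 0 x * u 2 0 x * u 0 0 x - 12 * k 1 0 x * u 1 0 x * u 0 0 x +
        3 * k 1 0 x * u 0 0 x ^ 3 - 3 / 2 * k 1 0 x ^ 2 + 3 * k 1 0 x * k 0 1 x -
        8 * k 1 0 x * k 0 0 x * u 0 0 x + 16 * k 0 1 x * k 0 0 x * u 0 0 x -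
        12 * k 0 0 x * u 1 0 x ^ 2 + 9 * k 0 0 x * u 1 0 x * u 0 0 x ^ 2 -
        6 * k 0 0 x ^ 2 * u 1 0 x + 12 * k 0 0 x ^ 2 * u 0 1 x - 8 * k 0 0 x ^ 3 -
        12 * k 1 0 x * W.opP₁₁ ν x) / (12 * W.K x))
      ((-(3 * k 2 2 x) + 3 * k 1 3 x - 3 * k 2 1 x * u 0 0 x + 3 * k 1 2 x * u 0 0 x -
        3 * k 0 3 x * u 0 0 x - 3 * k 2 0 x * u 0 1 x - 12 * k 1 1 x * u 1 0 x +
        9 * k 1 1 x * u 0 1 x + 6 * k 0 2 x * u 1 0 x - 15 * k 0 2 x * u 0 1 x -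
        12 * k 1 0 x * u 1 1 x + 6 * k 1 0 x * u 0 2 x + 6 * k 0 1 x * u 1 1 x -
        12 * k 0 1 x * u 0 2 x - 15 * k 1 1 x * k 0 0 x + 27 / 2 * k 0 2 x * k 0 0 x -
        12 * k 0 0 x * u 1 1 x * u 0 0 x - 9 * k 1 0 x * k 0 1 x -
        12 * k 0 1 x * u 1 0 x * u 0 0 x + 3 * k 0 1 x * u 0 0 x ^ 3 +
        21 / 2 * k 0 1 x ^ 2 - 16 * k 1 0 x * k 0 0 x * u 0 0 x +
        8 * k 0 1 x * k 0 0 x * u 0 0 x - 12 * k 0 0 x * u 1 0 x * u 0 1 x +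
        9 * k 0 0 x * u 0 1 x * u 0 0 x ^ 2 - 12 * k 0 0 x ^ 2 * u 1 0 x +
        6 * k 0 0 x ^ 2 * u 0 1 x - 6 * k 0 0 x ^ 2 * u 0 0 x ^ 2 - 4 * k 0 0 x ^ 3 -
        12 * k 0 1 x * W.opP₁₁ ν x) / (12 * W.K x)) x := by
  obtain ⟨h00, h10, h01, h20, h11, h02, -⟩ := W.hasCovAt_jet hD hν hx hu hk
  obtain ⟨k00, k10, k01, k20, k11, k02, k30, k21, k12, k03⟩ := W.hasCovAt_curvJet hD hx hk
  have e : ∀ y, W.opP₁₁ ν y =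
      (-(3 * k 2 1 y) + 3 * k 1 2 y - 3 * k 2 0 y * u 0 0 y + 3 * k 1 1 y * u 0 0 y -
        3 * k 0 2 y * u 0 0 y - 12 * k 1 0 y * u 1 0 y + 6 * k 1 0 y * u 0 1 y +
        6 * k 0 1 y * u 1 0 y - 12 * k 0 1 y * u 0 1 y - 4 * k 1 0 y * k 0 0 y +
        8 * k 0 1 y * k 0 0 y - 12 * k 0 0 y * u 1 0 y * u 0 0 y +
        3 * k 0 0 y * u 0 0 y ^ 3) / (12 * k 0 0 y) := fun y => by
    subst hu hk
    simp only [opP₁₁, CurvJet.P₁₁, curvJet, δ₁_eq_sym, δ₂_eq_sym, sym_zero_zero]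
    ring
  have h0 : (12 : ℝ) * k 0 0 x ≠ 0 := by
    subst hk
    rw [sym_zero_zero]
    exact mul_ne_zero (by norm_num) hK
  have H := (HasCovAt.div (w := 3) (v := 2)
    ((k21.const_mul 3).const_mul (-1) |>.add (k12.const_mul 3) |>.sub ((k20.mul h00).const_mul 3)
      |>.add ((k11.mul h00).const_mul 3) |>.sub ((k02.mul h00).const_mul 3)
      |>.sub ((k10.mul h10).const_mul 12) |>.add ((k10.mul h01).const_mul 6)
      |>.add ((k01.mul h10).const_mul 6) |>.sub ((k01.mul h01).const_mul 12)
      |>.sub ((k10.mul k00).const_mul 4) |>.add ((k01.mul k00).const_mul 8)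
      |>.sub (((k00.mul h10).mul h00).const_mul 12)
      |>.add ((((k00.mul h00).mul h00).mul h00).const_mul 3))
    (k00.const_mul 12) h0).congr
    (g := W.opP₁₁ ν) (.of_forall fun y => by rw [e]; congr 1; ring)
  refine H.congr_val ?_ ?_
  all_goals
    rw [show W.K x = k 0 0 x by subst hk; rw [sym_zero_zero], e]
    ring

/-- The first covariant derivatives of `P₁₂` along the jets of `ν`. The quotient rule leaves the
value of `P₁₂` itself in the numerators. -/
theorem hasCovAt_opP₁₂ (W : PlanarWeb D) (hD : IsOpen D) {ν : ℝ × ℝ → ℝ}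
    (hν : ContDiffOn ℝ ∞ ν D) {x : ℝ × ℝ} (hx : x ∈ D) (hK : W.K x ≠ 0)
    {u k : ℕ → ℕ → ℝ × ℝ → ℝ} (hu : W.sym 1 ν = u) (hk : W.sym 2 W.K = k) :
    W.HasCovAt 3 (W.opP₁₂ ν)
      ((-(3 * k 3 1 x) + 3 * k 2 2 x - 3 * k 3 0 x * u 0 0 x + 3 * k 2 1 x * u 0 0 x -
        3 * k 1 2 x * u 0 0 x - 15 * k 2 0 x * u 1 0 x + 6 * k 2 0 x * u 0 1 x +
        9 * k 1 1 x * u 1 0 x - 12 * k 1 1 x * u 0 1 x - 3 * k 0 2 x * u 1 0 x -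
        12 * k 1 0 x * u 2 0 x + 6 * k 1 0 x * u 1 1 x + 6 * k 0 1 x * u 2 0 x -
        12 * k 0 1 x * u 1 1 x + 27 / 2 * k 2 0 x * k 0 0 x - 3 * k 1 1 x * k 0 0 x -
        24 * k 0 0 x * u 2 0 x * u 0 0 x + 24 * k 0 0 x * u 1 1 x * u 0 0 x -
        24 * k 1 0 x * u 1 0 x * u 0 0 x + 24 * k 1 0 x * u 0 1 x * u 0 0 x +
        3 * k 1 0 x * u 0 0 x ^ 3 + 21 / 2 * k 1 0 x ^ 2 + 3 * k 1 0 x * k 0 1 x -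
        8 * k 1 0 x * k 0 0 x * u 0 0 x + 16 * k 0 1 x * k 0 0 x * u 0 0 x -
        24 * k 0 0 x * u 1 0 x ^ 2 + 24 * k 0 0 x * u 1 0 x * u 0 1 x +
        9 * k 0 0 x * u 1 0 x * u 0 0 x ^ 2 - 6 * k 0 0 x ^ 2 * u 1 0 x +
        12 * k 0 0 x ^ 2 * u 0 1 x - 12 * k 0 0 x ^ 2 * u 0 0 x ^ 2 - 8 * k 0 0 x ^ 3 -
        24 * k 1 0 x * W.opP₁₂ ν x) / (24 * W.K x))
      ((-(3 * k 2 2 x) + 3 * k 1 3 x - 3 * k 2 1 x * u 0 0 x + 3 * k 1 2 x * u 0 0 x -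
        3 * k 0 3 x * u 0 0 x - 3 * k 2 0 x * u 0 1 x - 12 * k 1 1 x * u 1 0 x +
        9 * k 1 1 x * u 0 1 x + 6 * k 0 2 x * u 1 0 x - 15 * k 0 2 x * u 0 1 x -
        12 * k 1 0 x * u 1 1 x + 6 * k 1 0 x * u 0 2 x + 6 * k 0 1 x * u 1 1 x -
        12 * k 0 1 x * u 0 2 x - 3 * k 1 1 x * k 0 0 x + 27 / 2 * k 0 2 x * k 0 0 x -
        24 * k 0 0 x * u 1 1 x * u 0 0 x + 24 * k 0 0 x * u 0 2 x * u 0 0 x +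
        3 * k 1 0 x * k 0 1 x - 24 * k 0 1 x * u 1 0 x * u 0 0 x +
        24 * k 0 1 x * u 0 1 x * u 0 0 x + 3 * k 0 1 x * u 0 0 x ^ 3 +
        21 / 2 * k 0 1 x ^ 2 - 16 * k 1 0 x * k 0 0 x * u 0 0 x +
        8 * k 0 1 x * k 0 0 x * u 0 0 x - 24 * k 0 0 x * u 1 0 x * u 0 1 x +
        24 * k 0 0 x * u 0 1 x ^ 2 + 9 * k 0 0 x * u 0 1 x * u 0 0 x ^ 2 -
        12 * k 0 0 x ^ 2 * u 1 0 x + 6 * k 0 0 x ^ 2 * u 0 1 x -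
        12 * k 0 0 x ^ 2 * u 0 0 x ^ 2 + 8 * k 0 0 x ^ 3 -
        24 * k 0 1 x * W.opP₁₂ ν x) / (24 * W.K x)) x := by
  obtain ⟨h00, h10, h01, h20, h11, h02, -⟩ := W.hasCovAt_jet hD hν hx hu hk
  obtain ⟨k00, k10, k01, k20, k11, k02, k30, k21, k12, k03⟩ := W.hasCovAt_curvJet hD hx hk
  have e : ∀ y, W.opP₁₂ ν y =
      (-(3 * k 2 1 y) + 3 * k 1 2 y - 3 * k 2 0 y * u 0 0 y + 3 * k 1 1 y * u 0 0 y -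
        3 * k 0 2 y * u 0 0 y - 12 * k 1 0 y * u 1 0 y + 6 * k 1 0 y * u 0 1 y +
        6 * k 0 1 y * u 1 0 y - 12 * k 0 1 y * u 0 1 y + 8 * k 1 0 y * k 0 0 y +
        8 * k 0 1 y * k 0 0 y - 24 * k 0 0 y * u 1 0 y * u 0 0 y +
        24 * k 0 0 y * u 0 1 y * u 0 0 y + 3 * k 0 0 y * u 0 0 y ^ 3) /
        (24 * k 0 0 y) := fun y => by
    subst hu hk
    simp only [opP₁₂, CurvJet.P₁₂, curvJet, δ₁_eq_sym, δ₂_eq_sym, sym_zero_zero]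
    ring
  have h0 : (24 : ℝ) * k 0 0 x ≠ 0 := by
    subst hk
    rw [sym_zero_zero]
    exact mul_ne_zero (by norm_num) hK
  have H := (HasCovAt.div (w := 3) (v := 2)
    ((k21.const_mul 3).const_mul (-1) |>.add (k12.const_mul 3) |>.sub ((k20.mul h00).const_mul 3)
      |>.add ((k11.mul h00).const_mul 3) |>.sub ((k02.mul h00).const_mul 3)
      |>.sub ((k10.mul h10).const_mul 12) |>.add ((k10.mul h01).const_mul 6)
      |>.add ((k01.mul h10).const_mul 6) |>.sub ((k01.mul h01).const_mul 12)
      |>.add ((k10.mul k00).const_mul 8) |>.add ((k01.mul k00).const_mul 8)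
      |>.sub (((k00.mul h10).mul h00).const_mul 24) |>.add (((k00.mul h01).mul h00).const_mul 24)
      |>.add ((((k00.mul h00).mul h00).mul h00).const_mul 3))
    (k00.const_mul 24) h0).congr
    (g := W.opP₁₂ ν) (.of_forall fun y => by rw [e]; congr 1; ring)
  refine H.congr_val ?_ ?_
  all_goals
    rw [show W.K x = k 0 0 x by subst hk; rw [sym_zero_zero], e]
    ring

/-- The first covariant derivatives of `P₂₂` along the jets of `ν`. The quotient rule leaves the
value of `P₂₂` itself in the numerators. -/
theorem hasCovAt_opP₂₂ (W : PlanarWeb D) (hD : IsOpen D) {ν : ℝ × ℝ → ℝ}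
    (hν : ContDiffOn ℝ ∞ ν D) {x : ℝ × ℝ} (hx : x ∈ D) (hK : W.K x ≠ 0)
    {u k : ℕ → ℕ → ℝ × ℝ → ℝ} (hu : W.sym 1 ν = u) (hk : W.sym 2 W.K = k) :
    W.HasCovAt 3 (W.opP₂₂ ν)
      ((-(3 * k 3 1 x) + 3 * k 2 2 x - 3 * k 3 0 x * u 0 0 x + 3 * k 2 1 x * u 0 0 x -
        3 * k 1 2 x * u 0 0 x - 15 * k 2 0 x * u 1 0 x + 6 * k 2 0 x * u 0 1 x +
        9 * k 1 1 x * u 1 0 x - 12 * k 1 1 x * u 0 1 x - 3 * k 0 2 x * u 1 0 x -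
        12 * k 1 0 x * u 2 0 x + 6 * k 1 0 x * u 1 1 x + 6 * k 0 1 x * u 2 0 x -
        12 * k 0 1 x * u 1 1 x + 27 / 2 * k 2 0 x * k 0 0 x - 15 * k 1 1 x * k 0 0 x +
        12 * k 0 0 x * u 1 1 x * u 0 0 x + 12 * k 1 0 x * u 0 1 x * u 0 0 x +
        3 * k 1 0 x * u 0 0 x ^ 3 + 21 / 2 * k 1 0 x ^ 2 - 9 * k 1 0 x * k 0 1 x -
        8 * k 1 0 x * k 0 0 x * u 0 0 x + 16 * k 0 1 x * k 0 0 x * u 0 0 x +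
        12 * k 0 0 x * u 1 0 x * u 0 1 x + 9 * k 0 0 x * u 1 0 x * u 0 0 x ^ 2 -
        6 * k 0 0 x ^ 2 * u 1 0 x + 12 * k 0 0 x ^ 2 * u 0 1 x -
        6 * k 0 0 x ^ 2 * u 0 0 x ^ 2 + 4 * k 0 0 x ^ 3 -
        12 * k 1 0 x * W.opP₂₂ ν x) / (12 * W.K x))
      ((-(3 * k 2 2 x) + 3 * k 1 3 x - 3 * k 2 1 x * u 0 0 x + 3 * k 1 2 x * u 0 0 x -
        3 * k 0 3 x * u 0 0 x - 3 * k 2 0 x * u 0 1 x - 12 * k 1 1 x * u 1 0 x +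
        9 * k 1 1 x * u 0 1 x + 6 * k 0 2 x * u 1 0 x - 15 * k 0 2 x * u 0 1 x -
        12 * k 1 0 x * u 1 1 x + 6 * k 1 0 x * u 0 2 x + 6 * k 0 1 x * u 1 1 x -
        12 * k 0 1 x * u 0 2 x - 3 * k 1 1 x * k 0 0 x + 3 / 2 * k 0 2 x * k 0 0 x +
        12 * k 0 0 x * u 0 2 x * u 0 0 x + 3 * k 1 0 x * k 0 1 x +
        12 * k 0 1 x * u 0 1 x * u 0 0 x + 3 * k 0 1 x * u 0 0 x ^ 3 -
        3 / 2 * k 0 1 x ^ 2 - 16 * k 1 0 x * k 0 0 x * u 0 0 x +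
        8 * k 0 1 x * k 0 0 x * u 0 0 x + 12 * k 0 0 x * u 0 1 x ^ 2 +
        9 * k 0 0 x * u 0 1 x * u 0 0 x ^ 2 - 12 * k 0 0 x ^ 2 * u 1 0 x +
        6 * k 0 0 x ^ 2 * u 0 1 x + 8 * k 0 0 x ^ 3 -
        12 * k 0 1 x * W.opP₂₂ ν x) / (12 * W.K x)) x := by
  obtain ⟨h00, h10, h01, h20, h11, h02, -⟩ := W.hasCovAt_jet hD hν hx hu hk
  obtain ⟨k00, k10, k01, k20, k11, k02, k30, k21, k12, k03⟩ := W.hasCovAt_curvJet hD hx hk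
  have e : ∀ y, W.opP₂₂ ν y =
      (-(3 * k 2 1 y) + 3 * k 1 2 y - 3 * k 2 0 y * u 0 0 y + 3 * k 1 1 y * u 0 0 y -
        3 * k 0 2 y * u 0 0 y - 12 * k 1 0 y * u 1 0 y + 6 * k 1 0 y * u 0 1 y +
        6 * k 0 1 y * u 1 0 y - 12 * k 0 1 y * u 0 1 y + 8 * k 1 0 y * k 0 0 y -
        4 * k 0 1 y * k 0 0 y + 12 * k 0 0 y * u 0 1 y * u 0 0 y +
        3 * k 0 0 y * u 0 0 y ^ 3) / (12 * k 0 0 y) := fun y => by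
    subst hu hk
    simp only [opP₂₂, CurvJet.P₂₂, curvJet, δ₁_eq_sym, δ₂_eq_sym, sym_zero_zero]
    ring
  have h0 : (12 : ℝ) * k 0 0 x ≠ 0 := by
    subst hk
    rw [sym_zero_zero]
    exact mul_ne_zero (by norm_num) hK
  have H := (HasCovAt.div (w := 3) (v := 2)
    ((k21.const_mul 3).const_mul (-1) |>.add (k12.const_mul 3) |>.sub ((k20.mul h00).const_mul 3)
      |>.add ((k11.mul h00).const_mul 3) |>.sub ((k02.mul h00).const_mul 3)
      |>.sub ((k10.mul h10).const_mul 12) |>.add ((k10.mul h01).const_mul 6)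
      |>.add ((k01.mul h10).const_mul 6) |>.sub ((k01.mul h01).const_mul 12)
      |>.add ((k10.mul k00).const_mul 8) |>.sub ((k01.mul k00).const_mul 4)
      |>.add (((k00.mul h01).mul h00).const_mul 12)
      |>.add ((((k00.mul h00).mul h00).mul h00).const_mul 3))
    (k00.const_mul 12) h0).congr
    (g := W.opP₂₂ ν) (.of_forall fun y => by rw [e]; congr 1; ring)
  refine H.congr_val ?_ ?_
  all_goals
    rw [show W.K x = k 0 0 x by subst hk; rw [sym_zero_zero], e]
    ring

/-- The compatibility conditions of `p_{ij} = P_{ij}`: the failure of `δ₂ P₁₁ - δ₁ P₁₂` and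
`δ₂ P₁₂ - δ₁ P₂₂` to satisfy the Ricci identities is measured by `G₁` and `G₂`. -/
theorem δ_opP_sub (W : PlanarWeb D) (hD : IsOpen D) {μ : ℝ × ℝ → ℝ}
    (hμ : ContDiffOn ℝ ∞ μ D) {x : ℝ × ℝ} (hx : x ∈ D) (hK : W.K x ≠ 0)
    (H : (W.curvJet x).PSystem (W.jet μ x)) :
    W.δ₂ 3 (W.opP₁₁ μ) x - W.δ₁ 3 (W.opP₁₂ μ) x - 5 / 2 * W.K x * W.δ₁ 1 μ x -
        1 / 2 * W.δ₁ 2 W.K x * μ x =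
      (W.curvJet x).G₁ (μ x) (W.δ₁ 1 μ x) (W.δ₂ 1 μ x) ∧
    W.δ₂ 3 (W.opP₁₂ μ) x - W.δ₁ 3 (W.opP₂₂ μ) x - 5 / 2 * W.K x * W.δ₂ 1 μ x -
        1 / 2 * W.δ₂ 2 W.K x * μ x =
      (W.curvJet x).G₂ (μ x) (W.δ₁ 1 μ x) (W.δ₂ 1 μ x) := by
  have a₁ := (W.hasCovAt_opP₁₁ hD hμ hx hK rfl rfl).2.2
  have a₂ := (W.hasCovAt_opP₁₂ hD hμ hx hK rfl rfl).2.1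
  have a₃ := (W.hasCovAt_opP₁₂ hD hμ hx hK rfl rfl).2.2
  have a₄ := (W.hasCovAt_opP₂₂ hD hμ hx hK rfl rfl).2.1
  obtain ⟨h₁, h₂, h₃⟩ := H
  simp only [jet] at h₁ h₂ h₃
  rw [a₁, a₂, a₃, a₄]
  simp only [opP₁₁, opP₁₂, opP₂₂, δ₁_eq_sym, δ₂_eq_sym, h₁, h₂, h₃, sym_zero_zero]
  simp only [CurvJet.P₁₁, CurvJet.P₁₂, CurvJet.P₂₂, CurvJet.G₁, CurvJet.G₂, CurvJet.A₁₁,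
    CurvJet.A₁₂, CurvJet.A₁₀, CurvJet.tau, curvJet]
  generalize W.K x = k at *
  clear a₁ a₂ a₃ a₄ h₁ h₂ h₃
  generalize W.sym 1 μ 1 0 x = p₁
  generalize W.sym 1 μ 0 1 x = p₂
  generalize W.sym 2 W.K 1 0 x = k₁
  generalize W.sym 2 W.K 0 1 x = k₂
  generalize W.sym 2 W.K 2 0 x = k₁₁
  generalize W.sym 2 W.K 1 1 x = k₁₂
  generalize W.sym 2 W.K 0 2 x = k₂₂
  generalize W.sym 2 W.K 2 1 x = k₁₁₂
  generalize W.sym 2 W.K 1 2 x = k₁₂₂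
  constructor <;> field_simp <;> ring

/-- The Ricci identities for the second derivatives of a function of weight one. -/
theorem ricci_two (W : PlanarWeb D) (hD : IsOpen D) {ν : ℝ × ℝ → ℝ}
    (hν : ContDiffOn ℝ ∞ ν D) {x : ℝ × ℝ} (hx : x ∈ D) :
    W.δ₂ 3 (W.sym 1 ν 2 0) x - W.δ₁ 3 (W.sym 1 ν 1 1) x =
        5 / 2 * W.K x * W.δ₁ 1 ν x + 1 / 2 * W.δ₁ 2 W.K x * ν x ∧
      W.δ₂ 3 (W.sym 1 ν 1 1) x - W.δ₁ 3 (W.sym 1 ν 0 2) x =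
        5 / 2 * W.K x * W.δ₂ 1 ν x + 1 / 2 * W.δ₂ 2 W.K x * ν x := by
  obtain ⟨-, -, -, h20, h11, h02, -⟩ := W.hasCovAt_jet hD hν hx rfl rfl
  rw [h20.2.2, h11.2.1, h11.2.2, h02.2.1]
  simp only [δ₁_eq_sym, δ₂_eq_sym, sym_zero_zero]
  constructor <;> ring

/-- The covariant derivatives of `P_{ij}` along the jets of a function depend on its two-jet
only. -/
theorem δ_opP_congr (W : PlanarWeb D) (hD : IsOpen D) {ν μ : ℝ × ℝ → ℝ}
    (hν : ContDiffOn ℝ ∞ ν D) (hμ : ContDiffOn ℝ ∞ μ D) {x : ℝ × ℝ} (hx : x ∈ D)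
    (hK : W.K x ≠ 0) (h : W.jet ν x = W.jet μ x) :
    (W.δ₁ 3 (W.opP₁₁ ν) x = W.δ₁ 3 (W.opP₁₁ μ) x ∧
      W.δ₂ 3 (W.opP₁₁ ν) x = W.δ₂ 3 (W.opP₁₁ μ) x) ∧
    (W.δ₁ 3 (W.opP₁₂ ν) x = W.δ₁ 3 (W.opP₁₂ μ) x ∧
      W.δ₂ 3 (W.opP₁₂ ν) x = W.δ₂ 3 (W.opP₁₂ μ) x) ∧
    (W.δ₁ 3 (W.opP₂₂ ν) x = W.δ₁ 3 (W.opP₂₂ μ) x ∧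
      W.δ₂ 3 (W.opP₂₂ ν) x = W.δ₂ 3 (W.opP₂₂ μ) x) := by
  simp only [jet, Jet2.mk.injEq] at h
  obtain ⟨e, e₁, e₂, e₁₁, e₁₂, e₂₂⟩ := h
  have a₁ := W.hasCovAt_opP₁₁ hD hν hx hK rfl rfl
  have a₂ := W.hasCovAt_opP₁₂ hD hν hx hK rfl rfl
  have a₃ := W.hasCovAt_opP₂₂ hD hν hx hK rfl rfl
  have b₁ := W.hasCovAt_opP₁₁ hD hμ hx hK rfl rfl
  have b₂ := W.hasCovAt_opP₁₂ hD hμ hx hK rfl rfl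
  have b₃ := W.hasCovAt_opP₂₂ hD hμ hx hK rfl rfl
  rw [a₁.2.1, a₁.2.2, a₂.2.1, a₂.2.2, a₃.2.1, a₃.2.2, b₁.2.1, b₁.2.2, b₂.2.1, b₂.2.2, b₃.2.1,
    b₃.2.2]
  simp only [opP₁₁, opP₁₂, opP₂₂, δ₁_eq_sym, δ₂_eq_sym, sym_zero_zero, e, e₁, e₂, e₁₁, e₁₂, e₂₂,
    and_self]

theorem hasCovAt_opP (W : PlanarWeb D) (hD : IsOpen D) {ν : ℝ × ℝ → ℝ}
    (hν : ContDiffOn ℝ ∞ ν D) {x : ℝ × ℝ} (hx : x ∈ D) (hK : W.K x ≠ 0) :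
    W.HasCovAt 3 (W.opP₁₁ ν) (W.δ₁ 3 (W.opP₁₁ ν) x) (W.δ₂ 3 (W.opP₁₁ ν) x) x ∧
      W.HasCovAt 3 (W.opP₁₂ ν) (W.δ₁ 3 (W.opP₁₂ ν) x) (W.δ₂ 3 (W.opP₁₂ ν) x) x ∧
      W.HasCovAt 3 (W.opP₂₂ ν) (W.δ₁ 3 (W.opP₂₂ ν) x) (W.δ₂ 3 (W.opP₂₂ ν) x) x :=
  ⟨⟨(W.hasCovAt_opP₁₁ hD hν hx hK rfl rfl).1, rfl, rfl⟩,
    ⟨(W.hasCovAt_opP₁₂ hD hν hx hK rfl rfl).1, rfl, rfl⟩,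
    ⟨(W.hasCovAt_opP₂₂ hD hν hx hK rfl rfl).1, rfl, rfl⟩⟩

/-- The equations `p_{ij} = P_{ij}` to first order, in terms of first covariant derivatives. -/
theorem solvesPToOrder_one_iff (W : PlanarWeb D) (hD : IsOpen D) {ν : ℝ × ℝ → ℝ}
    (hν : ContDiffOn ℝ ∞ ν D) {x : ℝ × ℝ} (hx : x ∈ D) (hK : W.K x ≠ 0) :
    W.SolvesPToOrder ν 1 x ↔ (W.curvJet x).PSystem (W.jet ν x) ∧
      (W.δ₁ 3 (W.sym 1 ν 2 0) x = W.δ₁ 3 (W.opP₁₁ ν) x ∧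
        W.δ₂ 3 (W.sym 1 ν 2 0) x = W.δ₂ 3 (W.opP₁₁ ν) x) ∧
      (W.δ₁ 3 (W.sym 1 ν 1 1) x = W.δ₁ 3 (W.opP₁₂ ν) x ∧
        W.δ₂ 3 (W.sym 1 ν 1 1) x = W.δ₂ 3 (W.opP₁₂ ν) x) ∧
      (W.δ₁ 3 (W.sym 1 ν 0 2) x = W.δ₁ 3 (W.opP₂₂ ν) x ∧
        W.δ₂ 3 (W.sym 1 ν 0 2) x = W.δ₂ 3 (W.opP₂₂ ν) x) := by
  have key : ∀ f g : ℝ × ℝ → ℝ, ContDiffOn ℝ ∞ f D →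
      W.HasCovAt 3 g (W.δ₁ 3 g x) (W.δ₂ 3 g x) x →
      (W.VanishesToOrder 3 (fun y => f y - g y) 1 x ↔
        f x = g x ∧ W.δ₁ 3 f x = W.δ₁ 3 g x ∧ W.δ₂ 3 f x = W.δ₂ 3 g x) := by
    intro f g hf hg
    have h := (W.hasCovAt hD 3 hf hx).sub hg
    rw [vanishesToOrder_one_iff, ← δ₁_eq_sym, ← δ₂_eq_sym, h.2.1, h.2.2]
    simp only [sub_eq_zero]
  obtain ⟨c₁, c₂, c₃⟩ := W.hasCovAt_opP hD hν hx hK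
  rw [SolvesPToOrder, key _ _ (W.contDiffOn_sym hD 1 hν 2 0) c₁,
    key _ _ (W.contDiffOn_sym hD 1 hν 1 1) c₂, key _ _ (W.contDiffOn_sym hD 1 hν 0 2) c₃]
  have e : (W.curvJet x).PSystem (W.jet ν x) ↔ W.sym 1 ν 2 0 x = W.opP₁₁ ν x ∧
      W.sym 1 ν 1 1 x = W.opP₁₂ ν x ∧ W.sym 1 ν 0 2 x = W.opP₂₂ ν x := by
    simp only [CurvJet.PSystem, jet, opP₁₁, opP₁₂, opP₂₂, δ₁_eq_sym, δ₂_eq_sym]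
  rw [e]
  tauto

theorem exists_solvesPToOrder_one (W : PlanarWeb D) (hD : IsOpen D) {x : ℝ × ℝ} (hx : x ∈ D)
    (hK : W.K x ≠ 0) (u p₁ p₂ : ℝ) :
    (∃ ν : ℝ × ℝ → ℝ, ContDiffOn ℝ ∞ ν D ∧ ν x = u ∧ W.δ₁ 1 ν x = p₁ ∧ W.δ₂ 1 ν x = p₂ ∧
        W.SolvesPToOrder ν 1 x) ↔
      (W.curvJet x).G₁ u p₁ p₂ = 0 ∧ (W.curvJet x).G₂ u p₁ p₂ = 0 := by
  constructor
  · rintro ⟨ν, s, rfl, rfl, rfl, H⟩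
    obtain ⟨hP, ⟨-, a⟩, ⟨b, c⟩, ⟨d, -⟩⟩ := (W.solvesPToOrder_one_iff hD s hx hK).1 H
    obtain ⟨g₁, g₂⟩ := W.δ_opP_sub hD s hx hK hP
    obtain ⟨r₁, r₂⟩ := W.ricci_two hD s hx
    rw [a, b] at r₁
    rw [c, d] at r₂
    rw [← g₁, ← g₂]
    constructor <;> linarith
  · rintro ⟨h₁, h₂⟩
    -- the prescribed one-jet, completed to a two-jet by the equations
    obtain ⟨ν₀, s₀, e₀⟩ := W.exists_sym_eq hD hx 1 2 fun a b => match a, b with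
      | 0, 0 => u | 1, 0 => p₁ | 0, 1 => p₂
      | 2, 0 => (W.curvJet x).P₁₁ u p₁ p₂ | 1, 1 => (W.curvJet x).P₁₂ u p₁ p₂
      | _, _ => (W.curvJet x).P₂₂ u p₁ p₂
    have j₀ := W.jet_eq_of_sym e₀
    simp only at j₀
    have hP₀ : (W.curvJet x).PSystem (W.jet ν₀ x) := by
      rw [j₀]; exact ⟨rfl, rfl, rfl⟩
    have u₀ : ν₀ x = u := congrArg Jet2.u j₀
    have v₀ : W.δ₁ 1 ν₀ x = p₁ := by rw [δ₁_eq_sym]; exact congrArg Jet2.p₁ j₀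
    have w₀ : W.δ₂ 1 ν₀ x = p₂ := by rw [δ₂_eq_sym]; exact congrArg Jet2.p₂ j₀
    obtain ⟨g₁, g₂⟩ := W.δ_opP_sub hD s₀ hx hK hP₀
    rw [u₀, v₀, w₀, h₁] at g₁
    rw [u₀, v₀, w₀, h₂] at g₂
    -- the third derivatives are then prescribed by the prolonged equations
    obtain ⟨ν, s, e⟩ := W.exists_sym_eq hD hx 1 3 fun a b => match a, b with
      | 0, 0 => u | 1, 0 => p₁ | 0, 1 => p₂
      | 2, 0 => (W.curvJet x).P₁₁ u p₁ p₂ | 1, 1 => (W.curvJet x).P₁₂ u p₁ p₂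
      | 0, 2 => (W.curvJet x).P₂₂ u p₁ p₂
      | 3, 0 => W.δ₁ 3 (W.opP₁₁ ν₀) x
      | 2, 1 => W.δ₁ 3 (W.opP₁₂ ν₀) x + 1 / 6 * W.sym 2 W.K 1 0 x * u + 5 / 6 * W.K x * p₁
      | 1, 2 => W.δ₂ 3 (W.opP₁₂ ν₀) x - 1 / 6 * W.sym 2 W.K 0 1 x * u - 5 / 6 * W.K x * p₂
      | _, _ => W.δ₂ 3 (W.opP₂₂ ν₀) x
    have j : W.jet ν x = _ := W.jet_eq_of_sym fun a b hab => e a b (by omega)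
    simp only at j
    have hj : W.jet ν x = W.jet ν₀ x := j.trans j₀.symm
    have e00 := e 0 0 (by simp)
    have e10 := e 1 0 (by simp)
    have e01 := e 0 1 (by simp)
    have e30 := e 3 0 (by simp)
    have e21 := e 2 1 (by simp)
    have e12 := e 1 2 (by simp)
    have e03 := e 0 3 (by simp)
    simp only at e00 e10 e01 e30 e21 e12 e03
    obtain ⟨⟨q₁, q₂⟩, ⟨q₃, q₄⟩, ⟨q₅, q₆⟩⟩ := W.δ_opP_congr hD s s₀ hx hK hj
    obtain ⟨-, -, -, h20, h11, h02, -⟩ := W.hasCovAt_jet hD s hx rfl rfl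
    have hk1 : W.δ₁ 2 W.K x = W.sym 2 W.K 1 0 x := by rw [δ₁_eq_sym]
    have hk2 : W.δ₂ 2 W.K x = W.sym 2 W.K 0 1 x := by rw [δ₂_eq_sym]
    rw [hk1] at g₁
    rw [hk2] at g₂
    refine ⟨ν, s, congrArg Jet2.u j, ?_, ?_, (W.solvesPToOrder_one_iff hD s hx hK).2
      ⟨hj ▸ hP₀, ⟨?_, ?_⟩, ⟨?_, ?_⟩, ⟨?_, ?_⟩⟩⟩
    · rw [δ₁_eq_sym]; exact e10
    · rw [δ₂_eq_sym]; exact e01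
    · rw [q₁, h20.2.1, e30]
    · rw [q₂, h20.2.2, e21, e00, e10, sym_zero_zero]
      linear_combination -g₁
    · rw [q₃, h11.2.1, e21, e00, e10, sym_zero_zero]
      ring
    · rw [q₄, h11.2.2, e12, e00, e01, sym_zero_zero]
      ring
    · rw [q₅, h02.2.1, e12, e00, e01, sym_zero_zero]
      linear_combination g₂
    · rw [q₆, h02.2.2, e03]

theorem G_eq_zero_of_PSystem (W : PlanarWeb D) (hD : IsOpen D) (hK : ∀ x ∈ D, W.K x ≠ 0)
    {μ : ℝ × ℝ → ℝ} (hμ : ContDiffOn ℝ ∞ μ D)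
    (H : ∀ x ∈ D, (W.curvJet x).PSystem (W.jet μ x)) {x : ℝ × ℝ} (hx : x ∈ D) :
    (W.curvJet x).G₁ (μ x) (W.δ₁ 1 μ x) (W.δ₂ 1 μ x) = 0 ∧
      (W.curvJet x).G₂ (μ x) (W.δ₁ 1 μ x) (W.δ₂ 1 μ x) = 0 := by
  refine (W.exists_solvesPToOrder_one hD hx (hK x hx) _ _ _).1 ⟨μ, hμ, rfl, rfl, rfl, ?_⟩
  have e : ∀ y ∈ D, W.sym 1 μ 2 0 y = W.opP₁₁ μ y ∧ W.sym 1 μ 1 1 y = W.opP₁₂ μ y ∧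
      W.sym 1 μ 0 2 y = W.opP₂₂ μ y := fun y hy => by
    simpa only [CurvJet.PSystem, jet, opP₁₁, opP₁₂, opP₂₂, δ₁_eq_sym, δ₂_eq_sym] using H y hy
  exact ⟨W.vanishesToOrder_of_eq_zero hD 3 (fun y hy => sub_eq_zero.2 (e y hy).1) 1 hx,
    W.vanishesToOrder_of_eq_zero hD 3 (fun y hy => sub_eq_zero.2 (e y hy).2.1) 1 hx,
    W.vanishesToOrder_of_eq_zero hD 3 (fun y hy => sub_eq_zero.2 (e y hy).2.2) 1 hx⟩

end PlanarWeb

/-! ### The Frobenius theorem for total differential equations -/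

namespace TotalDifferential

open Set Metric Filter Topology

variable {E V : Type*} [NormedAddCommGroup E] [NormedSpace ℝ E] [NormedAddCommGroup V]
  [NormedSpace ℝ V]

/-- Uniform bounds near a point for a `C²` function, its derivative and its first-order Taylor
remainder. -/
theorem exists_bounds {F G : Type*} [NormedAddCommGroup F] [NormedSpace ℝ F]
    [NormedAddCommGroup G] [NormedSpace ℝ G] {Φ : F → G} {z₀ : F} (hΦ : ContDiffAt ℝ 2 Φ z₀) :
    ∃ r C : ℝ, 0 < r ∧ r ≤ 1 ∧ 1 ≤ C ∧ ∀ z ∈ ball z₀ r, DifferentiableAt ℝ Φ z ∧ ‖Φ z‖ ≤ C ∧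
      ‖fderiv ℝ Φ z‖ ≤ C ∧ ∀ z' ∈ ball z₀ r, ‖Φ z' - Φ z - fderiv ℝ Φ z (z' - z)‖ ≤
        C * ‖z' - z‖ ^ 2 := by
  have hd : ContDiffAt ℝ 1 (fderiv ℝ Φ) z₀ := hΦ.fderiv_right (by norm_num)
  obtain ⟨K, t, ht, hK⟩ := hd.exists_lipschitzOnWith
  have e₁ : ∀ᶠ z in 𝓝 z₀, DifferentiableAt ℝ Φ z :=
    (hΦ.eventually (by simp)).mono fun z hz => hz.differentiableAt (by simp)
  have e₂ : ∀ᶠ z in 𝓝 z₀, ‖Φ z‖ < ‖Φ z₀‖ + 1 :=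
    hΦ.continuousAt.norm.eventually_lt_const (lt_add_one _)
  have e₃ : ∀ᶠ z in 𝓝 z₀, ‖fderiv ℝ Φ z‖ < ‖fderiv ℝ Φ z₀‖ + 1 :=
    hd.continuousAt.norm.eventually_lt_const (lt_add_one _)
  obtain ⟨r, hr, hB⟩ := eventually_nhds_iff_ball.1 (e₁.and (e₂.and (e₃.and ht)))
  have hsub : ball z₀ (min r 1) ⊆ ball z₀ r := ball_subset_ball (min_le_left _ _)
  refine ⟨min r 1, max 1 (max (‖Φ z₀‖ + 1) (max (‖fderiv ℝ Φ z₀‖ + 1) K)), by positivity,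
    min_le_right _ _, le_max_left _ _, fun z hz => ?_⟩
  obtain ⟨h₁, h₂, h₃, h₄⟩ := hB z (hsub hz)
  refine ⟨h₁, h₂.le.trans (by simp), h₃.le.trans (by simp), fun z' hz' => ?_⟩
  have hconv : Convex ℝ (ball z₀ (min r 1) ∩ closedBall z ‖z' - z‖) :=
    (convex_ball _ _).inter (convex_closedBall _ _)
  have key := hconv.norm_image_sub_le_of_norm_fderiv_le' (f := Φ) (φ := fderiv ℝ Φ z)
    (C := K * ‖z' - z‖) (x := z) (y := z') (fun y hy => (hB y (hsub hy.1)).1) (fun y hy => ?_)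
    ⟨hz, by simp⟩ ⟨hz', by simp [dist_eq_norm]⟩
  · refine key.trans ?_
    rw [mul_assoc, ← pow_two]
    gcongr
    simp
  · have h := hK.norm_sub_le (hB y (hsub hy.1)).2.2.2 h₄
    refine h.trans ?_
    have := hy.2
    rw [mem_closedBall, dist_eq_norm] at this
    gcongr

section Ray

variable {Φ : E × V → E →L[ℝ] V} {x₀ : E} {y₀ : V} {r C : ℝ}

/-- Along the segment from `x₀` to `x₀ + v` the equation `df = Φ(x, f)` is an ordinary
differential equation, solvable up to time one for small `v`. -/
theorem exists_ray [CompleteSpace V] (hC : 1 ≤ C)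
    (hB : ∀ z ∈ ball (x₀, y₀) r, DifferentiableAt ℝ Φ z ∧ ‖Φ z‖ ≤ C ∧ ‖fderiv ℝ Φ z‖ ≤ C)
    {v : E} (hv : C * ‖v‖ < r / 2) :
    ∃ y : ℝ → V, y 0 = y₀ ∧ ∀ t ∈ Icc (0 : ℝ) 1, ‖y t - y₀‖ ≤ C * ‖v‖ ∧
      HasDerivWithinAt y (Φ (x₀ + t • v, y t) v) (Icc 0 1) t := by
  have hC0 : 0 ≤ C := by linarith
  have hr : 0 < r := by have := mul_nonneg hC0 (norm_nonneg v); linarith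
  have hvr : ‖v‖ < r := by nlinarith [norm_nonneg v]
  have hmem : ∀ t ∈ Icc (0 : ℝ) 1, ∀ y ∈ closedBall y₀ (C * ‖v‖),
      (x₀ + t • v, y) ∈ ball (x₀, y₀) r := by
    intro t ht y hy
    rw [← ball_prod_same, mem_prod]
    constructor
    · simp only [mem_ball, dist_eq_norm, add_sub_cancel_left, norm_smul, Real.norm_eq_abs,
        abs_of_nonneg ht.1]
      nlinarith [norm_nonneg v, ht.2]
    · exact mem_ball.2 (lt_of_le_of_lt (mem_closedBall.1 hy) (by linarith))
  let a : NNReal := ⟨C * ‖v‖, by positivity⟩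
  have hPL : IsPicardLindelof (fun t y => Φ (x₀ + t • v, y) v) (tmin := 0) (tmax := 1)
      ⟨0, by simp⟩ y₀ a 0 a a := by
    refine ⟨fun t ht => ?_, fun y hy => ?_, fun t ht y hy => ?_, ?_⟩
    · refine LipschitzOnWith.of_dist_le_mul fun y hy y' hy' => ?_
      have h := (convex_ball (x₀, y₀) r).norm_image_sub_le_of_norm_fderiv_le
        (fun z hz => (hB z hz).1) (fun z hz => (hB z hz).2.2) (hmem t ht y' hy') (hmem t ht y hy)
      have e : ‖((x₀ + t • v, y) : E × V) - (x₀ + t • v, y')‖ = ‖y - y'‖ := by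
        simp [Prod.norm_def]
      rw [e] at h
      rw [dist_eq_norm, dist_eq_norm, ← sub_apply]
      calc _ ≤ ‖Φ (x₀ + t • v, y) - Φ (x₀ + t • v, y')‖ * ‖v‖ :=
            ContinuousLinearMap.le_opNorm _ _
        _ ≤ (C * ‖y - y'‖) * ‖v‖ := by gcongr
        _ = (C * ‖v‖) * ‖y - y'‖ := by ring
    · have hc : ContinuousOn (fun t : ℝ => ((x₀ + t • v, y) : E × V)) (Icc 0 1) := by fun_prop
      exact (ContinuousOn.comp (t := ball (x₀, y₀) r)
        (fun z hz => (hB z hz).1.continuousAt.continuousWithinAt) hc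
        fun t ht => hmem t ht y hy).clm_apply continuousOn_const
    · calc _ ≤ ‖Φ (x₀ + t • v, y)‖ * ‖v‖ := ContinuousLinearMap.le_opNorm _ _
        _ ≤ C * ‖v‖ := by gcongr; exact (hB _ (hmem t ht y hy)).2.1
    · simp
  obtain ⟨α, hα⟩ := ODE.FunSpace.exists_isFixedPt_next hPL (mem_closedBall_self le_rfl)
  have hb : ∀ t, α.compProj t ∈ closedBall y₀ a := fun t =>
    α.compProj_mem_closedBall hPL.mul_max_le
  refine ⟨α.compProj, ?_, fun t ht => ⟨mem_closedBall_iff_norm.1 (hb t), ?_⟩⟩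
  · have h := ODE.FunSpace.next_apply₀ hPL (mem_closedBall_self le_rfl) α
    rw [hα] at h
    simpa using (ODE.FunSpace.compProj_val (α := α) (t := (⟨0, by simp⟩ : Icc (0 : ℝ) 1))).trans h
  · refine (ODE.hasDerivWithinAt_picard_Icc (by simp : (0 : ℝ) ∈ Icc (0 : ℝ) 1)
      hPL.continuousOn_uncurry α.continuous_compProj.continuousOn (fun t _ => hb t) y₀
      ht).congr_of_mem (fun t' ht' => ?_) ht
    nth_rw 1 [← hα]
    rw [ODE.FunSpace.compProj_of_mem ht', ODE.FunSpace.next_apply]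

/-- The deviation of a neighbouring ray solution from its expected linearization is quadratic.
Its derivative along the ray is controlled because the integrability condition exchanges the
variation direction with the direction of the ray. -/
theorem norm_ray_sub_le (hC : 1 ≤ C) (hr1 : r ≤ 1)
    (hB : ∀ z ∈ ball (x₀, y₀) r, DifferentiableAt ℝ Φ z ∧ ‖Φ z‖ ≤ C ∧ ‖fderiv ℝ Φ z‖ ≤ C ∧
      ∀ z' ∈ ball (x₀, y₀) r, ‖Φ z' - Φ z - fderiv ℝ Φ z (z' - z)‖ ≤ C * ‖z' - z‖ ^ 2)
    (hcompat : ∀ z ∈ ball (x₀, y₀) r, ∀ v h : E,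
      fderiv ℝ Φ z (v, Φ z v) h = fderiv ℝ Φ z (h, Φ z h) v)
    {v v' : E} (hv : C * ‖v‖ < r / 2) (hv' : C * ‖v'‖ < r / 2) {y y' : ℝ → V}
    (h0 : y 0 = y₀) (h0' : y' 0 = y₀)
    (hy : ∀ t ∈ Icc (0 : ℝ) 1, ‖y t - y₀‖ ≤ C * ‖v‖ ∧
      HasDerivWithinAt y (Φ (x₀ + t • v, y t) v) (Icc 0 1) t)
    (hy' : ∀ t ∈ Icc (0 : ℝ) 1, ‖y' t - y₀‖ ≤ C * ‖v'‖ ∧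
      HasDerivWithinAt y' (Φ (x₀ + t • v', y' t) v') (Icc 0 1) t) :
    ‖y' 1 - y 1 - Φ (x₀ + v, y 1) (v' - v)‖ ≤
      (2 * C ^ 3 + C ^ 2) / (2 * C * (1 + C) + C) *
        (Real.exp (2 * C * (1 + C) + C) - 1) * ‖v' - v‖ ^ 2 := by
  have hC0 : 0 < C := by linarith
  have mem : ∀ (u : E) (η : ℝ → V), C * ‖u‖ < r / 2 →
      (∀ t ∈ Icc (0 : ℝ) 1, ‖η t - y₀‖ ≤ C * ‖u‖) → ∀ t ∈ Icc (0 : ℝ) 1,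
      (x₀ + t • u, η t) ∈ ball (x₀, y₀) r := by
    intro u η hu hη t ht
    have := hη t ht
    rw [← ball_prod_same, mem_prod]
    constructor
    · simp only [mem_ball, dist_eq_norm, add_sub_cancel_left, norm_smul, Real.norm_eq_abs,
        abs_of_nonneg ht.1]
      nlinarith [norm_nonneg u, ht.2, mul_nonneg hC0.le (norm_nonneg u)]
    · rw [mem_ball, dist_eq_norm]
      nlinarith [mul_nonneg hC0.le (norm_nonneg u)]
  have hm := mem v y hv fun t ht => (hy t ht).1
  have hm' := mem v' y' hv' fun t ht => (hy' t ht).1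
  set h := v' - v with hh
  let w : ℝ → V := fun t => y' t - y t - t • Φ (x₀ + t • v, y t) h
  let w' : ℝ → V := fun t => Φ (x₀ + t • v', y' t) v' - Φ (x₀ + t • v, y t) v -
    (t • fderiv ℝ Φ (x₀ + t • v, y t) (v, Φ (x₀ + t • v, y t) v) h + Φ (x₀ + t • v, y t) h)
  have hw : ∀ t ∈ Icc (0 : ℝ) 1, HasDerivWithinAt w (w' t) (Icc 0 1) t := by
    intro t ht
    have hz : HasDerivWithinAt (fun t : ℝ => ((x₀ + t • v, y t) : E × V))
        (v, Φ (x₀ + t • v, y t) v) (Icc 0 1) t := by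
      refine HasDerivWithinAt.prodMk ?_ (hy t ht).2
      simpa using (((hasDerivAt_id t).smul_const v).const_add x₀).hasDerivWithinAt
    have hΦz := ((hB _ (hm t ht)).1.hasFDerivAt.comp_hasDerivWithinAt t hz)
    have h1 := ((hasDerivAt_id t).hasDerivWithinAt (s := Icc 0 1)).smul
      (hΦz.clm_apply (hasDerivWithinAt_const t _ h))
    have h2 := ((hy' t ht).2.sub (hy t ht).2).sub h1
    refine h2.congr_deriv ?_
    simp [w']
  have hbound : ∀ t ∈ Icc (0 : ℝ) 1,
      ‖w' t‖ ≤ (2 * C * (1 + C) + C) * ‖w t‖ + (2 * C ^ 3 + C ^ 2) * ‖h‖ ^ 2 := by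
    intro t ht
    obtain ⟨-, b₁, b₂, b₃⟩ := hB _ (hm t ht)
    have b₄ := b₃ _ (hm' t ht)
    have hc := hcompat _ (hm t ht) v h
    have n₁ : ‖h‖ ≤ 1 := by
      have := norm_sub_le v' v
      nlinarith [norm_nonneg v, norm_nonneg v']
    have n₂ : ‖v'‖ ≤ 1 := by nlinarith [norm_nonneg v']
    have n₃ : ‖y' t - y t‖ ≤ 1 := by
      have := norm_sub_le (y' t - y₀) (y t - y₀)
      rw [sub_sub_sub_cancel_right] at this
      linarith [(hy t ht).1, (hy' t ht).1]
    have wdef : y' t - y t = w t + t • Φ (x₀ + t • v, y t) h := by simp [w]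
    simp only [w']
    rw [hc]
    generalize Φ (x₀ + t • v, y t) = A at *
    generalize fderiv ℝ Φ (x₀ + t • v, y t) = A' at *
    generalize Φ (x₀ + t • v', y' t) = A'' at *
    have n₄ : ‖A h‖ ≤ C * ‖h‖ := (A.le_opNorm h).trans (by gcongr)
    have n₅ : ‖w t‖ ≤ 1 + C := by
      have e : w t = (y' t - y t) - t • A h := by rw [wdef]; abel
      rw [e]
      refine (norm_sub_le _ _).trans (add_le_add n₃ ?_)
      rw [norm_smul, Real.norm_eq_abs, abs_of_nonneg ht.1]
      calc t * ‖A h‖ ≤ 1 * (C * 1) := by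
            gcongr
            · exact ht.2
            · exact n₄.trans (by gcongr)
        _ = C := by ring
    have dz : ((x₀ + t • v', y' t) : E × V) - (x₀ + t • v, y t) = t • (h, A h) + (0, w t) := by
      ext
      · simp [hh, smul_sub]
      · simp [wdef]; abel
    have n₆ : ‖((h, A h) : E × V)‖ ≤ C * ‖h‖ := by
      rw [Prod.norm_def]
      exact max_le (by nlinarith [norm_nonneg h]) n₄
    have n₇ : ‖((0, w t) : E × V)‖ = ‖w t‖ := by simp [Prod.norm_def]
    have n₈ : ‖t • ((h, A h) : E × V) + (0, w t)‖ ≤ C * ‖h‖ + ‖w t‖ := by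
      refine (norm_add_le _ _).trans (add_le_add ?_ n₇.le)
      rw [norm_smul, Real.norm_eq_abs, abs_of_nonneg ht.1]
      nlinarith [ht.2, norm_nonneg ((h, A h) : E × V)]
    have hsq : ‖t • ((h, A h) : E × V) + (0, w t)‖ ^ 2 ≤
        2 * C ^ 2 * ‖h‖ ^ 2 + 2 * (1 + C) * ‖w t‖ := by
      calc _ ≤ (C * ‖h‖ + ‖w t‖) ^ 2 := by gcongr
        _ ≤ 2 * C ^ 2 * ‖h‖ ^ 2 + 2 * (‖w t‖ * ‖w t‖) := by
            nlinarith [sq_nonneg (C * ‖h‖ - ‖w t‖)]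
        _ ≤ _ := by
            have := mul_le_mul_of_nonneg_right n₅ (norm_nonneg (w t))
            linarith
    rw [dz] at b₄
    have split : A'' v' - A v - (t • A' (h, A h) v + A h) =
        (A'' - A - A' (t • (h, A h) + (0, w t))) v' + A' (0, w t) v' + t • A' (h, A h) h := by
      have e : v' = v + h := by simp [hh]
      rw [e]
      simp only [map_add, map_smul, sub_apply, add_apply, smul_apply]
      abel
    rw [split]
    have m₁ : ‖(A'' - A - A' (t • (h, A h) + (0, w t))) v'‖ ≤
        C * (2 * C ^ 2 * ‖h‖ ^ 2 + 2 * (1 + C) * ‖w t‖) :=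
      calc _ ≤ ‖A'' - A - A' (t • (h, A h) + (0, w t))‖ * ‖v'‖ :=
            ContinuousLinearMap.le_opNorm _ _
        _ ≤ (C * (2 * C ^ 2 * ‖h‖ ^ 2 + 2 * (1 + C) * ‖w t‖)) * 1 := by
            gcongr
            exact b₄.trans (by gcongr)
        _ = _ := mul_one _
    have m₂ : ‖A' (0, w t) v'‖ ≤ C * ‖w t‖ :=
      calc _ ≤ ‖A' (0, w t)‖ * ‖v'‖ := ContinuousLinearMap.le_opNorm _ _
        _ ≤ (‖A'‖ * ‖((0, w t) : E × V)‖) * ‖v'‖ := by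
            gcongr; exact ContinuousLinearMap.le_opNorm _ _
        _ ≤ (C * ‖w t‖) * 1 := by rw [n₇]; gcongr
        _ = _ := mul_one _
    have m₃ : ‖t • A' (h, A h) h‖ ≤ C ^ 2 * ‖h‖ ^ 2 := by
      rw [norm_smul, Real.norm_eq_abs, abs_of_nonneg ht.1]
      calc _ ≤ 1 * (‖A' (h, A h)‖ * ‖h‖) := by
            gcongr
            · exact ht.2
            · exact ContinuousLinearMap.le_opNorm _ _
        _ ≤ 1 * ((‖A'‖ * ‖((h, A h) : E × V)‖) * ‖h‖) := by
            gcongr; exact ContinuousLinearMap.le_opNorm _ _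
        _ ≤ 1 * ((C * (C * ‖h‖)) * ‖h‖) := by gcongr
        _ = _ := by ring
    refine (norm_add₃_le).trans ((add_le_add (add_le_add m₁ m₂) m₃).trans (le_of_eq ?_))
    ring
  have hG := norm_le_gronwallBound_of_norm_deriv_right_le (f := w) (f' := w') (a := 0) (b := 1)
    (δ := 0) (K := 2 * C * (1 + C) + C) (ε := (2 * C ^ 3 + C ^ 2) * ‖h‖ ^ 2)
    (fun t ht => (hw t ht).continuousWithinAt)
    (fun t ht => (hw t ⟨ht.1, ht.2.le⟩).mono_of_mem_nhdsWithin (Icc_mem_nhdsGE_of_mem ht))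
    (by simp [w, h0, h0']) (fun t ht => hbound t ⟨ht.1, ht.2.le⟩) 1 (by simp)
  have hK : 2 * C * (1 + C) + C ≠ 0 := by positivity
  rw [gronwallBound_of_K_ne_0 hK] at hG
  simp only [w, one_smul, sub_zero, mul_one, zero_mul, zero_add] at hG
  refine hG.trans (le_of_eq ?_)
  ring

end Ray

/-- **Frobenius theorem**: the total differential equation `df = Φ(x, f)` with a `C²` right-hand
side satisfying the integrability condition has a local solution through every initial value. -/
theorem exists_hasFDerivAt [CompleteSpace V] {Φ : E × V → E →L[ℝ] V} {x₀ : E} {y₀ : V}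
    (hΦ : ContDiffAt ℝ 2 Φ (x₀, y₀))
    (hcompat : ∀ᶠ z in 𝓝 (x₀, y₀), ∀ v h : E,
      fderiv ℝ Φ z (v, Φ z v) h = fderiv ℝ Φ z (h, Φ z h) v) :
    ∃ f : E → V, f x₀ = y₀ ∧ ∀ᶠ x in 𝓝 x₀, HasFDerivAt f (Φ (x, f x)) x := by
  obtain ⟨r₁, C, hr₁, hr₁1, hC, hB₁⟩ := exists_bounds hΦ
  obtain ⟨r₂, hr₂, hc₂⟩ := eventually_nhds_iff_ball.1 hcompat
  obtain ⟨r, hr, hr1, hB, hc⟩ : ∃ r, 0 < r ∧ r ≤ 1 ∧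
      (∀ z ∈ ball (x₀, y₀) r, DifferentiableAt ℝ Φ z ∧ ‖Φ z‖ ≤ C ∧ ‖fderiv ℝ Φ z‖ ≤ C ∧
        ∀ z' ∈ ball (x₀, y₀) r, ‖Φ z' - Φ z - fderiv ℝ Φ z (z' - z)‖ ≤ C * ‖z' - z‖ ^ 2) ∧
      ∀ z ∈ ball (x₀, y₀) r, ∀ v h : E,
        fderiv ℝ Φ z (v, Φ z v) h = fderiv ℝ Φ z (h, Φ z h) v := by
    have s₁ : ball (x₀, y₀) (min r₁ r₂) ⊆ ball (x₀, y₀) r₁ := ball_subset_ball (min_le_left _ _)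
    have s₂ : ball (x₀, y₀) (min r₁ r₂) ⊆ ball (x₀, y₀) r₂ := ball_subset_ball (min_le_right _ _)
    refine ⟨min r₁ r₂, lt_min hr₁ hr₂, (min_le_left _ _).trans hr₁1, fun z hz => ?_,
      fun z hz => hc₂ z (s₂ hz)⟩
    obtain ⟨h₁, h₂, h₃, h₄⟩ := hB₁ z (s₁ hz)
    exact ⟨h₁, h₂, h₃, fun z' hz' => h₄ z' (s₁ hz')⟩
  have hC0 : 0 < C := by linarith
  have hray : ∀ v : E, ∃ y : ℝ → V, C * ‖v‖ < r / 2 → y 0 = y₀ ∧ ∀ t ∈ Icc (0 : ℝ) 1,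
      ‖y t - y₀‖ ≤ C * ‖v‖ ∧ HasDerivWithinAt y (Φ (x₀ + t • v, y t) v) (Icc 0 1) t := by
    intro v
    by_cases hv : C * ‖v‖ < r / 2
    · obtain ⟨y, hy⟩ := exists_ray hC (fun z hz => ⟨(hB z hz).1, (hB z hz).2.1, (hB z hz).2.2.1⟩) hv
      exact ⟨y, fun _ => hy⟩
    · exact ⟨fun _ => y₀, fun h => absurd h hv⟩
  choose y hy using hray
  have hopen : IsOpen {x : E | C * ‖x - x₀‖ < r / 2} :=
    isOpen_lt (by fun_prop) continuous_const
  refine ⟨fun x => y (x - x₀) 1, ?_, ?_⟩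
  · have h := ((hy (x₀ - x₀) (by simp; linarith)).2 1 (by simp)).1
    simpa [sub_eq_zero] using h
  · filter_upwards [hopen.mem_nhds (show C * ‖x₀ - x₀‖ < r / 2 by simp; linarith)] with x hx
    rw [hasFDerivAt_iff_isLittleO]
    refine Asymptotics.IsBigO.trans_isLittleO (Asymptotics.IsBigO.of_bound
      ((2 * C ^ 3 + C ^ 2) / (2 * C * (1 + C) + C) * (Real.exp (2 * C * (1 + C) + C) - 1)) ?_)
      (Asymptotics.isLittleO_pow_sub_sub x one_lt_two)
    filter_upwards [hopen.mem_nhds hx] with x' hx'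
    have h := norm_ray_sub_le hC hr1 hB hc hx hx' (hy _ hx).1 (hy _ hx').1 (hy _ hx).2 (hy _ hx').2
    simpa using h

/-- A solution of a total differential equation with smooth right-hand side is smooth. -/
theorem contDiffOn_of_hasFDerivAt {Φ : E × V → E →L[ℝ] V} {Ω : Set (E × V)}
    (hΦ : ContDiffOn ℝ ∞ Φ Ω) {U : Set E} (hU : IsOpen U) {f : E → V}
    (hf : ∀ x ∈ U, HasFDerivAt f (Φ (x, f x)) x) (hmem : ∀ x ∈ U, (x, f x) ∈ Ω) :
    ContDiffOn ℝ ∞ f U := by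
  rw [contDiffOn_infty]
  intro n
  induction n with
  | zero =>
    exact contDiffOn_zero.2 fun x hx => (hf x hx).continuousAt.continuousWithinAt
  | succ n ih =>
    rw [Nat.cast_add, Nat.cast_one, contDiffOn_succ_iff_fderiv_of_isOpen hU]
    refine ⟨fun x hx => (hf x hx).differentiableAt.differentiableWithinAt, by simp, ?_⟩
    exact ((hΦ.of_le (mod_cast le_top)).comp (contDiffOn_id.prodMk ih) hmem).congr
      fun x hx => (hf x hx).fderiv

/-- Two solutions of a total differential equation that agree at one point of a preconnected open
set agree on it. -/
theorem eqOn_of_hasFDerivAt {Φ : E × V → E →L[ℝ] V} {U : Set E} (hU : IsOpen U)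
    (hU' : IsPreconnected U) {f g : E → V} (hΦ : ∀ x ∈ U, ContDiffAt ℝ 1 Φ (x, f x))
    (hf : ∀ x ∈ U, HasFDerivAt f (Φ (x, f x)) x) (hg : ∀ x ∈ U, HasFDerivAt g (Φ (x, g x)) x)
    {x₀ : E} (hx₀ : x₀ ∈ U) (h0 : f x₀ = g x₀) : EqOn f g U := by
  have loc : ∀ x ∈ U, f x = g x → ∀ᶠ y in 𝓝 x, f y = g y := by
    intro x hx hfg
    obtain ⟨K, t, ht, hK⟩ := (hΦ x hx).exists_lipschitzOnWith
    have cf : ContinuousAt (fun y => (y, f y)) x :=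
      continuousAt_id.prodMk (hf x hx).continuousAt
    have cg : ContinuousAt (fun y => (y, g y)) x :=
      continuousAt_id.prodMk (hg x hx).continuousAt
    have tg : t ∈ 𝓝 (x, g x) := hfg ▸ ht
    obtain ⟨ε, hε, hball⟩ := eventually_nhds_iff_ball.1
      ((hU.eventually_mem hx).and ((cf.eventually_mem ht).and (cg.eventually_mem tg)))
    filter_upwards [ball_mem_nhds x hε] with y hy
    have hseg : ∀ s ∈ Icc (0 : ℝ) 1, x + s • (y - x) ∈ ball x ε := fun s hs =>
      (convex_ball x ε).add_smul_sub_mem (mem_ball_self hε) hy hs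
    have hd : ∀ (k : E → V), (∀ z ∈ U, HasFDerivAt k (Φ (z, k z)) z) → ∀ s ∈ Icc (0 : ℝ) 1,
        HasDerivAt (fun s : ℝ => k (x + s • (y - x)))
          (Φ (x + s • (y - x), k (x + s • (y - x))) (y - x)) s := by
      intro k hk s hs
      have h1 : HasDerivAt (fun s : ℝ => x + s • (y - x)) (y - x) s := by
        simpa using ((hasDerivAt_id s).smul_const (y - x)).const_add x
      exact (hk _ (hball _ (hseg s hs)).1).comp_hasDerivAt s h1
    have hz := eq_zero_of_abs_deriv_le_mul_abs_self_of_eq_zero_right (a := 0) (b := 1)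
      (f := fun s : ℝ => f (x + s • (y - x)) - g (x + s • (y - x)))
      (f' := fun s => Φ (x + s • (y - x), f (x + s • (y - x))) (y - x) -
        Φ (x + s • (y - x), g (x + s • (y - x))) (y - x)) (K := K * ‖y - x‖)
      (fun s hs => ((hd f hf s hs).sub (hd g hg s hs)).continuousAt.continuousWithinAt)
      (fun s hs => ((hd f hf s ⟨hs.1, hs.2.le⟩).sub
        (hd g hg s ⟨hs.1, hs.2.le⟩)).hasDerivWithinAt)
      (by simp [hfg]) (fun s hs => ?_) 1 (by simp)
    · simpa [sub_eq_zero] using hz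
    · have hs' : s ∈ Icc (0 : ℝ) 1 := ⟨hs.1, hs.2.le⟩
      obtain ⟨-, mf, mg⟩ := hball _ (hseg s hs')
      have hl := hK.norm_sub_le mf mg
      rw [← sub_apply]
      refine (ContinuousLinearMap.le_opNorm _ _).trans ?_
      have e : ‖((x + s • (y - x), f (x + s • (y - x))) : E × V) -
          (x + s • (y - x), g (x + s • (y - x)))‖ =
          ‖f (x + s • (y - x)) - g (x + s • (y - x))‖ := by simp [Prod.norm_def]
      rw [e] at hl
      calc _ ≤ (K * ‖f (x + s • (y - x)) - g (x + s • (y - x))‖) * ‖y - x‖ := by gcongr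
        _ = _ := by ring
  have cont : ContinuousOn (fun x => f x - g x) U := fun x hx =>
    ((hf x hx).continuousAt.sub (hg x hx).continuousAt).continuousWithinAt
  have hv : IsOpen (U ∩ (fun x => f x - g x) ⁻¹' {0}ᶜ) :=
    cont.isOpen_inter_preimage hU isOpen_compl_singleton
  have hu : IsOpen {x | ∀ᶠ y in 𝓝 x, f y = g y} := isOpen_setOfPred_eventually_nhds
  have hsub := hU'.subset_left_of_subset_union hu hv ?_ ?_ ⟨x₀, hx₀, loc x₀ hx₀ h0⟩
  · exact fun x hx => (hsub hx).self_of_nhds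
  · rw [Set.disjoint_left]
    rintro x hx ⟨-, hx'⟩
    exact hx' (sub_eq_zero.2 hx.self_of_nhds)
  · intro x hx
    by_cases h : f x = g x
    · exact Or.inl (loc x hx h)
    · exact Or.inr ⟨hx, fun h' => h (sub_eq_zero.1 h')⟩

end TotalDifferential

namespace PlanarWeb

variable {D : Set (ℝ × ℝ)}

/-! ### The Akivis–Goldberg equations as a total differential equation -/

/-- The covariant derivative `δ₁ λ₁` prescribed by the Akivis–Goldberg equations, as a function of
the point and of the values `a = λ₁`, `b = λ₂`. -/
def agF₁₁ (_W : PlanarWeb D) (μ : ℝ × ℝ → ℝ) (x : ℝ × ℝ) (a _b : ℝ) : ℝ := a * (a + μ x)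

/-- The covariant derivative `δ₂ λ₁` prescribed by the Akivis–Goldberg equations. -/
def agF₁₂ (W : PlanarWeb D) (μ : ℝ × ℝ → ℝ) (x : ℝ × ℝ) (a b : ℝ) : ℝ :=
  1 / 3 * (W.K x + 3 * (a * b) - 2 * W.δ₂ 1 μ x + W.δ₁ 1 μ x)

/-- The covariant derivative `δ₁ λ₂` prescribed by the Akivis–Goldberg equations. -/
def agF₂₁ (W : PlanarWeb D) (μ : ℝ × ℝ → ℝ) (x : ℝ × ℝ) (a b : ℝ) : ℝ :=
  1 / 3 * (3 * (a * b) - W.K x - W.δ₂ 1 μ x + 2 * W.δ₁ 1 μ x)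

/-- The covariant derivative `δ₂ λ₂` prescribed by the Akivis–Goldberg equations. -/
def agF₂₂ (_W : PlanarWeb D) (μ : ℝ × ℝ → ℝ) (x : ℝ × ℝ) (_a b : ℝ) : ℝ := b * (b - μ x)

/-- The Akivis–Goldberg equations at a point, solved for the covariant derivatives. -/
theorem ag_equations_iff (W : PlanarWeb D) (μ l₁ l₂ : ℝ × ℝ → ℝ) (x : ℝ × ℝ) :
    (2 * W.pd₂ l₁ x - W.pd₁ l₂ x + W.pd₂ μ x =
        W.K x + l₁ x * l₂ x + W.g₂ x * (2 * l₁ x + μ x) - W.g₁ x * l₂ x ∧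
      W.pd₂ l₂ x = l₂ x * (W.g₂ x + l₂ x - μ x) ∧
      W.pd₁ l₁ x = l₁ x * (W.g₁ x + l₁ x + μ x) ∧
      W.pd₂ l₁ x - 2 * W.pd₁ l₂ x + W.pd₁ μ x =
        W.K x - l₁ x * l₂ x + l₁ x * W.g₂ x - W.g₁ x * (2 * l₂ x - μ x)) ↔
    (W.δ₁ 1 l₁ x = W.agF₁₁ μ x (l₁ x) (l₂ x) ∧ W.δ₂ 1 l₁ x = W.agF₁₂ μ x (l₁ x) (l₂ x)) ∧
      W.δ₁ 1 l₂ x = W.agF₂₁ μ x (l₁ x) (l₂ x) ∧ W.δ₂ 1 l₂ x = W.agF₂₂ μ x (l₁ x) (l₂ x) := by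
  simp only [agF₁₁, agF₁₂, agF₂₁, agF₂₂, δ₁, δ₂, Nat.cast_one, one_mul]
  constructor
  · rintro ⟨h₁, h₂, h₃, h₄⟩
    refine ⟨⟨?_, ?_⟩, ?_, ?_⟩
    · linear_combination h₃
    · linear_combination 2 / 3 * h₁ - 1 / 3 * h₄
    · linear_combination 1 / 3 * h₁ - 2 / 3 * h₄
    · linear_combination h₂
  · rintro ⟨⟨h₁, h₂⟩, h₃, h₄⟩
    refine ⟨?_, ?_, ?_, ?_⟩
    · linear_combination 2 * h₂ - h₃
    · linear_combination h₄
    · linear_combination h₁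
    · linear_combination h₂ - 2 * h₃

/-- The integrability conditions of the Akivis–Goldberg equations: if `λ₁`, `λ₂` satisfy the
equations at the point `x`, then the Ricci identities for the prescribed derivatives of `λ₁` and
`λ₂` fail at `x` exactly by `I₁ / 3` and `I₂ / 3`. -/
theorem ag_integrability (W : PlanarWeb D) (hD : IsOpen D) {μ : ℝ × ℝ → ℝ}
    (hμ : ContDiffOn ℝ ∞ μ D) {x : ℝ × ℝ} (hx : x ∈ D) {l₁ l₂ : ℝ × ℝ → ℝ}
    (h₁ : W.HasCovAt 1 l₁ (W.agF₁₁ μ x (l₁ x) (l₂ x)) (W.agF₁₂ μ x (l₁ x) (l₂ x)) x)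
    (h₂ : W.HasCovAt 1 l₂ (W.agF₂₁ μ x (l₁ x) (l₂ x)) (W.agF₂₂ μ x (l₁ x) (l₂ x)) x) :
    (∃ a₁ a₂ b₁ b₂, W.HasCovAt 2 (fun y => W.agF₁₁ μ y (l₁ y) (l₂ y)) a₁ a₂ x ∧
      W.HasCovAt 2 (fun y => W.agF₁₂ μ y (l₁ y) (l₂ y)) b₁ b₂ x ∧
      b₁ - a₂ = -(W.K x * l₁ x) + W.opI₁ μ x / 3) ∧
    (∃ a₁ a₂ b₁ b₂, W.HasCovAt 2 (fun y => W.agF₂₁ μ y (l₁ y) (l₂ y)) a₁ a₂ x ∧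
      W.HasCovAt 2 (fun y => W.agF₂₂ μ y (l₁ y) (l₂ y)) b₁ b₂ x ∧
      b₁ - a₂ = -(W.K x * l₂ x) + W.opI₂ μ x / 3) := by
  obtain ⟨m, m₁, m₂, -⟩ := W.hasCovAt_jet hD hμ hx rfl rfl
  obtain ⟨k, -⟩ := W.hasCovAt_curvJet hD hx rfl
  rw [sym_zero_zero] at m k
  have hm₁ : W.δ₁ 1 μ = W.sym 1 μ 1 0 := W.δ₁_eq_sym 1 μ
  have hm₂ : W.δ₂ 1 μ = W.sym 1 μ 0 1 := W.δ₂_eq_sym 1 μ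
  rw [← hm₁] at m₁
  rw [← hm₂] at m₂
  refine ⟨⟨_, _, _, _, h₁.mul (h₁.add m), ((((k.add ((h₁.mul h₂).const_mul 3)).sub
      (m₂.const_mul 2)).add m₁).const_mul (1 / 3)), ?_⟩,
    ⟨_, _, _, _, ((((((h₁.mul h₂).const_mul 3).sub k).sub m₂).add
      (m₁.const_mul 2)).const_mul (1 / 3)), h₂.mul (h₂.sub m), ?_⟩⟩
  all_goals
    simp only [agF₁₁, agF₁₂, agF₂₁, agF₂₂, opI₁, opI₂, CurvJet.I₁, CurvJet.I₂, jet, curvJet,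
      sym_zero_zero, hm₁, hm₂]
    ring

/-- The right-hand side of the Akivis–Goldberg equations, written as a total differential equation
`d(λ₁, λ₂) = agForm (x, (λ₁, λ₂))`. -/
def agForm (W : PlanarWeb D) (μ : ℝ × ℝ → ℝ) (z : (ℝ × ℝ) × (ℝ × ℝ)) : ℝ × ℝ →L[ℝ] ℝ × ℝ :=
  ((W.agF₁₁ μ z.1 z.2.1 z.2.2 + W.g₁ z.1 * z.2.1) • W.ω₁ z.1 +
      (W.agF₁₂ μ z.1 z.2.1 z.2.2 + W.g₂ z.1 * z.2.1) • W.ω₂ z.1).smulRight (1, 0) +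
    ((W.agF₂₁ μ z.1 z.2.1 z.2.2 + W.g₁ z.1 * z.2.2) • W.ω₁ z.1 +
      (W.agF₂₂ μ z.1 z.2.1 z.2.2 + W.g₂ z.1 * z.2.2) • W.ω₂ z.1).smulRight (0, 1)

theorem contDiffOn_agForm (W : PlanarWeb D) (hD : IsOpen D) {μ : ℝ × ℝ → ℝ}
    (hμ : ContDiffOn ℝ ∞ μ D) : ContDiffOn ℝ ∞ (W.agForm μ) (D ×ˢ Set.univ) := by
  have lift : ∀ {F : Type} [NormedAddCommGroup F] [NormedSpace ℝ F] {f : ℝ × ℝ → F},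
      ContDiffOn ℝ ∞ f D →
      ContDiffOn ℝ ∞ (fun z : (ℝ × ℝ) × (ℝ × ℝ) => f z.1) (D ×ˢ Set.univ) :=
    fun hf => hf.comp contDiffOn_fst fun z hz => hz.1
  have a : ContDiffOn ℝ ∞ (fun z : (ℝ × ℝ) × (ℝ × ℝ) => z.2.1) (D ×ˢ Set.univ) :=
    (contDiff_fst.comp contDiff_snd).contDiffOn
  have b : ContDiffOn ℝ ∞ (fun z : (ℝ × ℝ) × (ℝ × ℝ) => z.2.2) (D ×ˢ Set.univ) :=
    (contDiff_snd.comp contDiff_snd).contDiffOn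
  have m := lift hμ
  have m₁ := lift (W.contDiffOn_δ₁ hD 1 hμ)
  have m₂ := lift (W.contDiffOn_δ₂ hD 1 hμ)
  have k := lift (W.contDiffOn_K hD)
  have g₁ := lift (W.contDiffOn_g₁ hD)
  have g₂ := lift (W.contDiffOn_g₂ hD)
  have o₁ := lift W.smooth₁
  have o₂ := lift W.smooth₂
  have c : ∀ r : ℝ, ContDiffOn ℝ ∞ (fun _ : (ℝ × ℝ) × (ℝ × ℝ) => r) (D ×ˢ Set.univ) :=
    fun r => contDiffOn_const
  exact (((((a.mul (a.add m)).add (g₁.mul a)).smul o₁).add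
    ((((c (1 / 3)).mul (((k.add ((c 3).mul (a.mul b))).sub ((c 2).mul m₂)).add m₁)).add
      (g₂.mul a)).smul o₂)).smulRight contDiffOn_const).add
    ((((((c (1 / 3)).mul (((((c 3).mul (a.mul b)).sub k).sub m₂).add ((c 2).mul m₁))).add
      (g₁.mul b)).smul o₁).add
      (((b.mul (b.sub m)).add (g₂.mul b)).smul o₂)).smulRight contDiffOn_const)

theorem fderiv_apply_eq (W : PlanarWeb D) {x : ℝ × ℝ} (hx : x ∈ D) (h : ℝ × ℝ → ℝ)
    (v : ℝ × ℝ) : fderiv ℝ h x v = W.pd₁ h x * W.ω₁ x v + W.pd₂ h x * W.ω₂ x v := by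
  conv_lhs => rw [W.decompose hx v]
  simp only [map_add, map_smul, smul_eq_mul, pd₁, pd₂]
  ring

/-- The Akivis–Goldberg equations at a point are the total differential equation given by
`agForm`. -/
theorem hasFDerivAt_agForm_iff (W : PlanarWeb D) {μ l₁ l₂ : ℝ × ℝ → ℝ} {x : ℝ × ℝ} (hx : x ∈ D) :
    HasFDerivAt (fun y => (l₁ y, l₂ y)) (W.agForm μ (x, (l₁ x, l₂ x))) x ↔
      W.HasCovAt 1 l₁ (W.agF₁₁ μ x (l₁ x) (l₂ x)) (W.agF₁₂ μ x (l₁ x) (l₂ x)) x ∧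
        W.HasCovAt 1 l₂ (W.agF₂₁ μ x (l₁ x) (l₂ x)) (W.agF₂₂ μ x (l₁ x) (l₂ x)) x := by
  obtain ⟨f11, f12, f21, f22⟩ := W.frame_dual hx
  constructor
  · intro h
    have e₁ := h.fst.fderiv
    have e₂ := h.snd.fderiv
    simp only at e₁ e₂
    refine ⟨⟨h.fst.differentiableAt, ?_, ?_⟩, ⟨h.snd.differentiableAt, ?_, ?_⟩⟩ <;>
      simp [δ₁, δ₂, pd₁, pd₂, e₁, e₂, agForm, f11, f12, f21, f22]
  · rintro ⟨⟨d₁, a₁, a₂⟩, ⟨d₂, b₁, b₂⟩⟩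
    refine (d₁.hasFDerivAt.prodMk d₂.hasFDerivAt).congr_fderiv ?_
    have p₁ : W.pd₁ l₁ x = W.agF₁₁ μ x (l₁ x) (l₂ x) + W.g₁ x * l₁ x := by
      rw [← a₁, δ₁]; push_cast; ring
    have p₂ : W.pd₂ l₁ x = W.agF₁₂ μ x (l₁ x) (l₂ x) + W.g₂ x * l₁ x := by
      rw [← a₂, δ₂]; push_cast; ring
    have q₁ : W.pd₁ l₂ x = W.agF₂₁ μ x (l₁ x) (l₂ x) + W.g₁ x * l₂ x := by
      rw [← b₁, δ₁]; push_cast; ring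
    have q₂ : W.pd₂ l₂ x = W.agF₂₂ μ x (l₁ x) (l₂ x) + W.g₂ x * l₂ x := by
      rw [← b₂, δ₂]; push_cast; ring
    refine ContinuousLinearMap.ext fun v => ?_
    rw [ContinuousLinearMap.prod_apply, W.fderiv_apply_eq hx, W.fderiv_apply_eq hx, p₁, p₂, q₁, q₂]
    simp [agForm]

theorem isAGSolutionOn_iff (W : PlanarWeb D) {μ l₁ l₂ : ℝ × ℝ → ℝ} {U : Set (ℝ × ℝ)}
    (hU : IsOpen U) :
    W.IsAGSolutionOn μ l₁ l₂ U ↔ ContDiffOn ℝ ∞ l₁ U ∧ ContDiffOn ℝ ∞ l₂ U ∧ ∀ x ∈ U,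
      W.HasCovAt 1 l₁ (W.agF₁₁ μ x (l₁ x) (l₂ x)) (W.agF₁₂ μ x (l₁ x) (l₂ x)) x ∧
        W.HasCovAt 1 l₂ (W.agF₂₁ μ x (l₁ x) (l₂ x)) (W.agF₂₂ μ x (l₁ x) (l₂ x)) x := by
  simp only [IsAGSolutionOn, ag_equations_iff]
  refine and_congr_right fun s₁ => and_congr_right fun s₂ => forall₂_congr fun x hx => ?_
  have d₁ := differentiableAt_of_contDiffOn hU s₁ hx
  have d₂ := differentiableAt_of_contDiffOn hU s₂ hx
  exact ⟨fun h => ⟨⟨d₁, h.1⟩, ⟨d₂, h.2⟩⟩, fun h => ⟨h.1.2, h.2.2⟩⟩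

theorem opI_eq_zero_of_isAGSolutionOn (W : PlanarWeb D) (hD : IsOpen D) {μ : ℝ × ℝ → ℝ}
    (hμ : ContDiffOn ℝ ∞ μ D) {U : Set (ℝ × ℝ)} (hU : IsOpen U) (hUD : U ⊆ D)
    {l₁ l₂ : ℝ × ℝ → ℝ} (h : W.IsAGSolutionOn μ l₁ l₂ U) {x : ℝ × ℝ} (hx : x ∈ U) :
    W.opI₁ μ x = 0 ∧ W.opI₂ μ x = 0 := by
  obtain ⟨s₁, s₂, H⟩ := (W.isAGSolutionOn_iff hU).1 h
  have n := hU.mem_nhds hx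
  obtain ⟨⟨a₁, a₂, b₁, b₂, hA, hB, e⟩, ⟨a₁', a₂', b₁', b₂', hA', hB', e'⟩⟩ :=
    W.ag_integrability hD hμ (hUD hx) (H x hx).1 (H x hx).2
  have c := HasCovAt.comm hD (hUD hx) (s₁.contDiffAt n)
    (Filter.eventually_of_mem n fun y hy => (H y hy).1) hA hB
  have c' := HasCovAt.comm hD (hUD hx) (s₂.contDiffAt n)
    (Filter.eventually_of_mem n fun y hy => (H y hy).2) hA' hB'
  push_cast at c c'
  constructor <;> linarith

/-- A one-form `(F₁ + g₁ l) ω₁ + (F₂ + g₂ l) ω₂` whose components are, at `x`, the derivatives of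
`l` is closed at `x` as soon as the covariant derivatives of `F₁` and `F₂` satisfy the Ricci
identity at `x`. -/
theorem formD_eq_zero_of_ricci (W : PlanarWeb D) (hD : IsOpen D) {x : ℝ × ℝ} (hx : x ∈ D)
    {l F₁ F₂ : ℝ × ℝ → ℝ} {a₁ a₂ b₁ b₂ : ℝ} (hl : W.HasCovAt 1 l (F₁ x) (F₂ x) x)
    (h₁ : W.HasCovAt 2 F₁ a₁ a₂ x) (h₂ : W.HasCovAt 2 F₂ b₁ b₂ x)
    (e : b₁ - a₂ = -(W.K x * l x)) (v w : ℝ × ℝ) :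
    formD (fun y => (F₁ y + W.g₁ y * l y) • W.ω₁ y + (F₂ y + W.g₂ y * l y) • W.ω₂ y) x v w = 0 := by
  have dg₁ := differentiableAt_of_contDiffOn hD (W.contDiffOn_g₁ hD) hx
  have dg₂ := differentiableAt_of_contDiffOn hD (W.contDiffOn_g₂ hD) hx
  obtain ⟨dl, l₁, l₂⟩ := hl
  obtain ⟨d₁, -, p₁⟩ := h₁
  obtain ⟨d₂, p₂, -⟩ := h₂
  have hK := W.K_eq hD hx
  have q₁ : W.pd₂ (fun y => F₁ y + W.g₁ y * l y) x =
      W.pd₂ F₁ x + (W.pd₂ W.g₁ x * l x + W.g₁ x * W.pd₂ l x) := by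
    simp only [pd₂, fderiv_fun_add d₁ (dg₁.fun_mul dl), fderiv_fun_mul dg₁ dl, add_apply,
      smul_apply, smul_eq_mul]
    ring
  have q₂ : W.pd₁ (fun y => F₂ y + W.g₂ y * l y) x =
      W.pd₁ F₂ x + (W.pd₁ W.g₂ x * l x + W.g₂ x * W.pd₁ l x) := by
    simp only [pd₁, fderiv_fun_add d₂ (dg₂.fun_mul dl), fderiv_fun_mul dg₂ dl, add_apply,
      smul_apply, smul_eq_mul]
    ring
  rw [W.formD_eq hx, W.formD_combination hD hx (d₁.fun_add (dg₁.fun_mul dl))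
    (d₂.fun_add (dg₂.fun_mul dl)), q₁, q₂]
  simp only [δ₁, δ₂] at l₁ l₂ p₁ p₂
  push_cast at l₁ l₂ p₁ p₂
  refine mul_eq_zero_of_left ?_ _
  rw [hK] at e
  linear_combination e + p₂ - p₁ + W.g₂ x * l₁ - W.g₁ x * l₂

/-- If `I₁(μ) = I₂(μ) = 0`, the total differential equation of the Akivis–Goldberg equations is
integrable. The condition at a point is tested on an affine pair `(λ₁, λ₂)` with the prescribed
one-jet. -/
theorem agForm_integrable (W : PlanarWeb D) (hD : IsOpen D) {μ : ℝ × ℝ → ℝ}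
    (hμ : ContDiffOn ℝ ∞ μ D) {z : (ℝ × ℝ) × (ℝ × ℝ)} (hz : z.1 ∈ D)
    (h₁ : W.opI₁ μ z.1 = 0) (h₂ : W.opI₂ μ z.1 = 0) (v w : ℝ × ℝ) :
    fderiv ℝ (W.agForm μ) z (v, W.agForm μ z v) w =
      fderiv ℝ (W.agForm μ) z (w, W.agForm μ z w) v := by
  obtain ⟨x, y₀⟩ := z
  simp only at hz h₁ h₂
  have hdΦ : DifferentiableAt ℝ (W.agForm μ) (x, y₀) :=
    ((W.contDiffOn_agForm hD hμ).contDiffAt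
      ((hD.prod isOpen_univ).mem_nhds ⟨hz, trivial⟩)).differentiableAt (by simp)
  let L := W.agForm μ (x, y₀)
  let l : ℝ × ℝ → ℝ × ℝ := fun y => y₀ + L (y - x)
  have lx : l x = y₀ := by simp [l]
  have hl : HasFDerivAt l L x :=
    ((L.hasFDerivAt.comp x ((hasFDerivAt_id x).sub_const x)).congr_fderiv L.comp_id).const_add y₀
  obtain ⟨c₁, c₂⟩ := (W.hasFDerivAt_agForm_iff (μ := μ) (l₁ := fun y => (l y).1)
    (l₂ := fun y => (l y).2) hz).1 (by simpa [lx] using hl)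
  obtain ⟨⟨a₁, a₂, b₁, b₂, hA, hB, e⟩, ⟨a₁', a₂', b₁', b₂', hA', hB', e'⟩⟩ :=
    W.ag_integrability hD hμ hz (l₁ := fun y => (l y).1) (l₂ := fun y => (l y).2) c₁ c₂
  rw [h₁, zero_div, add_zero] at e
  rw [h₂, zero_div, add_zero] at e'
  have z₁ := W.formD_eq_zero_of_ricci hD hz c₁ hA hB e v w
  have z₂ := W.formD_eq_zero_of_ricci hD hz c₂ hA' hB' e' v w
  -- the equation along the test pair, as a one-form with values in the plane
  let Θ : ℝ × ℝ → ℝ × ℝ →L[ℝ] ℝ × ℝ := fun y => W.agForm μ (y, l y)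
  have hΘ : HasFDerivAt Θ ((fderiv ℝ (W.agForm μ) (x, y₀)).comp
      ((ContinuousLinearMap.id ℝ (ℝ × ℝ)).prod L)) x := by
    have h := hdΦ.hasFDerivAt
    rw [← lx] at h ⊢
    exact HasFDerivAt.comp x h ((hasFDerivAt_id x).prodMk hl)
  have comp : ∀ P : ℝ × ℝ →L[ℝ] ℝ, ∀ u : ℝ × ℝ, fderiv ℝ (fun y => P.comp (Θ y)) x u =
      P.comp (fderiv ℝ (W.agForm μ) (x, y₀) (u, L u)) := by
    intro P u
    have h := (ContinuousLinearMap.compL ℝ (ℝ × ℝ) (ℝ × ℝ) ℝ P).hasFDerivAt.comp x hΘ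
    exact congrArg (fun A => A u) h.fderiv
  have t₁ : (fun y => (ContinuousLinearMap.fst ℝ ℝ ℝ).comp (Θ y)) = fun y =>
      (W.agF₁₁ μ y (l y).1 (l y).2 + W.g₁ y * (l y).1) • W.ω₁ y +
        (W.agF₁₂ μ y (l y).1 (l y).2 + W.g₂ y * (l y).1) • W.ω₂ y := by
    funext y
    ext <;> simp [Θ, agForm]
  have t₂ : (fun y => (ContinuousLinearMap.snd ℝ ℝ ℝ).comp (Θ y)) = fun y =>
      (W.agF₂₁ μ y (l y).1 (l y).2 + W.g₁ y * (l y).2) • W.ω₁ y +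
        (W.agF₂₂ μ y (l y).1 (l y).2 + W.g₂ y * (l y).2) • W.ω₂ y := by
    funext y
    ext <;> simp [Θ, agForm]
  rw [← t₁] at z₁
  rw [← t₂] at z₂
  simp only [formD, comp] at z₁ z₂
  ext
  · exact sub_eq_zero.1 z₁
  · exact sub_eq_zero.1 z₂

theorem exists_isAGSolutionOn (W : PlanarWeb D) (hD : IsOpen D) {μ : ℝ × ℝ → ℝ}
    (hμ : ContDiffOn ℝ ∞ μ D) (H : ∀ x ∈ D, W.opI₁ μ x = 0 ∧ W.opI₂ μ x = 0) {x₀ : ℝ × ℝ}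
    (hx₀ : x₀ ∈ D) (a₁ a₂ : ℝ) :
    ∃ U : Set (ℝ × ℝ), IsOpen U ∧ x₀ ∈ U ∧ U ⊆ D ∧
      ∃ l₁ l₂ : ℝ × ℝ → ℝ, W.IsAGSolutionOn μ l₁ l₂ U ∧ l₁ x₀ = a₁ ∧ l₂ x₀ = a₂ := by
  have hs := W.contDiffOn_agForm hD hμ
  have hn : D ×ˢ Set.univ ∈ nhds (x₀, (a₁, a₂)) := (hD.prod isOpen_univ).mem_nhds ⟨hx₀, trivial⟩
  obtain ⟨f, f0, hf⟩ := TotalDifferential.exists_hasFDerivAt (Φ := W.agForm μ) (x₀ := x₀)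
    (y₀ := (a₁, a₂)) (contDiffAt_infty.1 (hs.contDiffAt hn) 2)
    (Filter.eventually_of_mem hn fun z hz v w =>
      W.agForm_integrable hD hμ hz.1 (H _ hz.1).1 (H _ hz.1).2 v w)
  obtain ⟨U, hU, hUo, hxU⟩ := eventually_nhds_iff.1 (hf.and (hD.eventually_mem hx₀))
  have smooth : ContDiffOn ℝ ∞ f U := TotalDifferential.contDiffOn_of_hasFDerivAt hs hUo
    (fun x hx => (hU x hx).1) fun x hx => ⟨(hU x hx).2, trivial⟩
  refine ⟨U, hUo, hxU, fun x hx => (hU x hx).2, fun x => (f x).1, fun x => (f x).2,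
    (W.isAGSolutionOn_iff hUo).2 ⟨smooth.fst, smooth.snd, fun x hx =>
      (W.hasFDerivAt_agForm_iff (hU x hx).2).1 (hU x hx).1⟩, by simp [f0], by simp [f0]⟩

theorem isAGSolutionOn_unique (W : PlanarWeb D) (hD : IsOpen D) {μ : ℝ × ℝ → ℝ}
    (hμ : ContDiffOn ℝ ∞ μ D) {U : Set (ℝ × ℝ)} (hU : IsOpen U) (hU' : IsPreconnected U)
    (hUD : U ⊆ D) {x₀ : ℝ × ℝ} (hx₀ : x₀ ∈ U) {l₁ l₂ m₁ m₂ : ℝ × ℝ → ℝ}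
    (hl : W.IsAGSolutionOn μ l₁ l₂ U) (hm : W.IsAGSolutionOn μ m₁ m₂ U)
    (h₁ : l₁ x₀ = m₁ x₀) (h₂ : l₂ x₀ = m₂ x₀) : Set.EqOn l₁ m₁ U ∧ Set.EqOn l₂ m₂ U := by
  obtain ⟨-, -, hl⟩ := (W.isAGSolutionOn_iff hU).1 hl
  obtain ⟨-, -, hm⟩ := (W.isAGSolutionOn_iff hU).1 hm
  have h := TotalDifferential.eqOn_of_hasFDerivAt (Φ := W.agForm μ) hU hU'
    (f := fun y => (l₁ y, l₂ y)) (g := fun y => (m₁ y, m₂ y))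
    (fun x hx => contDiffAt_infty.1 ((W.contDiffOn_agForm hD hμ).contDiffAt
      ((hD.prod isOpen_univ).mem_nhds ⟨hUD hx, trivial⟩)) 1)
    (fun x hx => (W.hasFDerivAt_agForm_iff (hUD hx)).2 (hl x hx))
    (fun x hx => (W.hasFDerivAt_agForm_iff (hUD hx)).2 (hm x hx)) hx₀ (by simp [h₁, h₂])
  exact ⟨fun x hx => congrArg Prod.fst (h hx), fun x hx => congrArg Prod.snd (h hx)⟩

end PlanarWeb

end

theorem theorem7p1 (D : Set (ℝ × ℝ)) (hD : IsOpen D) (W : PlanarWeb D) :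
    -- 1. solvability of the Akivis–Goldberg equations with respect to `l₁`, `l₂`
    ((∀ μ : ℝ × ℝ → ℝ, ContDiffOn ℝ ∞ μ D →
        ((∀ x₀ ∈ D, ∃ U : Set (ℝ × ℝ), IsOpen U ∧ x₀ ∈ U ∧ U ⊆ D ∧
            ∃ l₁ l₂ : ℝ × ℝ → ℝ, W.IsAGSolutionOn μ l₁ l₂ U) ↔
          ∀ x ∈ D, W.opI₁ μ x = 0 ∧ W.opI₂ μ x = 0) ∧
        ((∀ x ∈ D, W.opI₁ μ x = 0 ∧ W.opI₂ μ x = 0) →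
          ∀ x₀ ∈ D, ∀ a₁ a₂ : ℝ, ∃ U : Set (ℝ × ℝ), IsOpen U ∧ x₀ ∈ U ∧ U ⊆ D ∧
            ∃ l₁ l₂ : ℝ × ℝ → ℝ, W.IsAGSolutionOn μ l₁ l₂ U ∧ l₁ x₀ = a₁ ∧ l₂ x₀ = a₂) ∧
        (∀ U : Set (ℝ × ℝ), IsOpen U → IsPreconnected U → U ⊆ D → ∀ x₀ ∈ U,
          ∀ l₁ l₂ m₁ m₂ : ℝ × ℝ → ℝ,
            W.IsAGSolutionOn μ l₁ l₂ U → W.IsAGSolutionOn μ m₁ m₂ U →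
            l₁ x₀ = m₁ x₀ → l₂ x₀ = m₂ x₀ → Set.EqOn l₁ m₁ U ∧ Set.EqOn l₂ m₂ U))) ∧
    -- 2. the Mayer bracket is the compatibility condition of `I₁ = I₂ = 0`
    ((∀ μ : ℝ × ℝ → ℝ, ContDiffOn ℝ ∞ μ D → ∀ x ∈ D, W.SolvesIToOrder μ 1 x →
        W.opMayer μ x = (W.curvJet x).I₁₂ (W.jet μ x)) ∧
      (∀ x ∈ D, ∀ j : Jet2,
        (∃ ν : ℝ × ℝ → ℝ, ContDiffOn ℝ ∞ ν D ∧ W.jet ν x = j ∧ W.SolvesIToOrder ν 1 x) ↔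
          (W.curvJet x).I₁ j = 0 ∧ (W.curvJet x).I₂ j = 0) ∧
      (∀ x ∈ D, ∀ j : Jet2,
        (∃ ν : ℝ × ℝ → ℝ, ContDiffOn ℝ ∞ ν D ∧ W.jet ν x = j ∧ W.SolvesIToOrder ν 2 x) ↔
          (W.curvJet x).I₁ j = 0 ∧ (W.curvJet x).I₂ j = 0 ∧ (W.curvJet x).I₁₂ j = 0) ∧
      (∀ μ : ℝ × ℝ → ℝ, ContDiffOn ℝ ∞ μ D →
        (∀ x ∈ D, W.opI₁ μ x = 0 ∧ W.opI₂ μ x = 0) →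
        ∀ x ∈ D, W.opMayer μ x = 0 ∧ (W.curvJet x).I₁₂ (W.jet μ x) = 0) ∧
      (∀ x ∈ D, W.K x ≠ 0 → ∀ j : Jet2,
        ((W.curvJet x).I₁ j = 0 ∧ (W.curvJet x).I₂ j = 0 ∧ (W.curvJet x).I₁₂ j = 0) ↔
          (W.curvJet x).PSystem j) ∧
      ((∀ x ∈ D, W.K x ≠ 0) → ∀ μ : ℝ × ℝ → ℝ, ContDiffOn ℝ ∞ μ D →
        ((∀ x ∈ D, W.opI₁ μ x = 0 ∧ W.opI₂ μ x = 0) ↔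
          ∀ x ∈ D, (W.curvJet x).PSystem (W.jet μ x)))) ∧
    -- 3. the compatibility conditions of the system `p_{ij} = P_{ij}` are `G₁ = G₂ = 0`
    ((∀ μ : ℝ × ℝ → ℝ, ContDiffOn ℝ ∞ μ D → ∀ x ∈ D, W.K x ≠ 0 →
        (W.curvJet x).PSystem (W.jet μ x) →
        W.δ₂ 3 (W.opP₁₁ μ) x - W.δ₁ 3 (W.opP₁₂ μ) x - 5 / 2 * W.K x * W.δ₁ 1 μ x -
            1 / 2 * W.δ₁ 2 W.K x * μ x =
          (W.curvJet x).G₁ (μ x) (W.δ₁ 1 μ x) (W.δ₂ 1 μ x) ∧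
        W.δ₂ 3 (W.opP₁₂ μ) x - W.δ₁ 3 (W.opP₂₂ μ) x - 5 / 2 * W.K x * W.δ₂ 1 μ x -
            1 / 2 * W.δ₂ 2 W.K x * μ x =
          (W.curvJet x).G₂ (μ x) (W.δ₁ 1 μ x) (W.δ₂ 1 μ x)) ∧
      (∀ x ∈ D, W.K x ≠ 0 → ∀ u p₁ p₂ : ℝ,
        (∃ ν : ℝ × ℝ → ℝ, ContDiffOn ℝ ∞ ν D ∧ ν x = u ∧ W.δ₁ 1 ν x = p₁ ∧ W.δ₂ 1 ν x = p₂ ∧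
            W.SolvesPToOrder ν 1 x) ↔
          (W.curvJet x).G₁ u p₁ p₂ = 0 ∧ (W.curvJet x).G₂ u p₁ p₂ = 0) ∧
      ((∀ x ∈ D, W.K x ≠ 0) → ∀ μ : ℝ × ℝ → ℝ, ContDiffOn ℝ ∞ μ D →
        (∀ x ∈ D, (W.curvJet x).PSystem (W.jet μ x)) →
        ∀ x ∈ D, (W.curvJet x).G₁ (μ x) (W.δ₁ 1 μ x) (W.δ₂ 1 μ x) = 0 ∧
          (W.curvJet x).G₂ (μ x) (W.δ₁ 1 μ x) (W.δ₂ 1 μ x) = 0)) := by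
  refine ⟨fun μ hμ => ⟨⟨fun h x hx => ?_, fun H x hx => ?_⟩, ?_, ?_⟩, ⟨?_, ?_, ?_, ?_, ?_, ?_⟩,
    ?_, ?_, ?_⟩
  · obtain ⟨U, hU, hxU, hUD, l₁, l₂, hl⟩ := h x hx
    exact W.opI_eq_zero_of_isAGSolutionOn hD hμ hU hUD hl hxU
  · obtain ⟨U, hU, hxU, hUD, l₁, l₂, hl, -⟩ := W.exists_isAGSolutionOn hD hμ H hx 0 0
    exact ⟨U, hU, hxU, hUD, l₁, l₂, hl⟩
  · exact fun H x₀ hx₀ a₁ a₂ => W.exists_isAGSolutionOn hD hμ H hx₀ a₁ a₂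
  · exact fun U hU hU' hUD x₀ hx₀ l₁ l₂ m₁ m₂ hl hm h₁ h₂ =>
      W.isAGSolutionOn_unique hD hμ hU hU' hUD hx₀ hl hm h₁ h₂
  · exact fun μ hμ x hx H => W.opMayer_eq_I₁₂ hD hμ hx H
  · exact fun x hx j => W.exists_solvesIToOrder_one hD hx j
  · exact fun x hx j => W.exists_solvesIToOrder_two hD hx j
  · exact fun μ hμ H x hx => W.I₁₂_eq_zero_of_solvesIToOrder_two hD hμ hx
      ⟨W.vanishesToOrder_of_eq_zero hD 3 (fun y hy => (H y hy).1) 2 hx,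
        W.vanishesToOrder_of_eq_zero hD 3 (fun y hy => (H y hy).2) 2 hx⟩
  · exact fun x _ hK j => PlanarWeb.PSystem_iff _ hK j
  · exact fun hK μ hμ => W.solutions_iff_PSystem hD hK hμ
  · exact fun μ hμ x hx hK H => W.δ_opP_sub hD hμ hx hK H
  · exact fun x hx hK u p₁ p₂ => W.exists_solvesPToOrder_one hD hx hK u p₁ p₂
  · exact fun hK μ hμ H x hx => W.G_eq_zero_of_PSystem hD hK hμ H hx
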